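/- **Lemma 0.2.** Let $K$ be a field and $k\ge 1$ an integer. Let $G_{k+5}$ be the graph on the vertex set $[k+5]=\{1,\dots,k+5\}$ with the $2k+5$ edges $e_1=\{1,3\}$; $e_i=\{1,i+3\}$ and $e_{k+1+i}=\{2,i+3\}$ for $2\le i\le k$; $e_{k+1}=\{1,k+4\}$; $e_{k+2}=\{2,4\}$; $e_{2k+2}=\{2,k+5\}$; $e_{2k+3}=\{3,4\}$; $e_{2k+4}=\{3,k+4\}$; $e_{2k+5}=\{4,k+5\}$. Let $K[G_{k+5}]\subset K[t_1,\dots,t_{k+5}]$ be its edge ring, that is, the $K$-subalgebra generated by the monomials $\mathbf t^{e}=t_at_b$, where $e=\{a,b\}$ is an edge. Let $K[\mathbf x]=K[x_1,\dots,x_{2k+5}]$, and let the toric ideal $I_{G_{k+5}}$ be the kernel of the $K$-algebra homomorphism $\pi:K[\mathbf x]\to K[G_{k+5}]$ with $\pi(x_i)=\mathbf t^{e_i}$. Let $<_{\mathrm{rev}}$ (resp. $<_{\mathrm{lex}}$) be the graded reverse lexicographic order (resp. the lexicographic order) on $K[\mathbf x]$ induced by $x_1>\cdots>x_{2k+5}$,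 and let $\mathrm{in}_<(I)$ be the ideal generated by the initial monomials of the nonzero elements of $I$. Then (i) $\operatorname{depth} K[\mathbf x]/\mathrm{in}_{<_{\mathrm{rev}}}(I_{G_{k+5}})=6$; (ii) $K[\mathbf x]/\mathrm{in}_{<_{\mathrm{lex}}}(I_{G_{k+5}})$ is Cohen–Macaulay. Here, for a proper homogeneous ideal $J$, $\operatorname{depth}K[\mathbf x]/J$ is the maximal length of a $K[\mathbf x]/J$-regular sequence of elements of $(x_1,\dots,x_{2k+5})$, and the graded algebra $K[\mathbf x]/J$ is Cohen–Macaulay if its depth is equal to its Krull dimension. -/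

import Mathlib

namespace EdgeRing

noncomputable section

/-! ### The reverse lexicographic order -/

/-- Type synonym of the exponent vectors `σ →₀ ℕ`, to be ordered by the (graded) reverse
lexicographic order. -/
def RevLexExp (σ : Type*) := σ →₀ ℕ

instance (σ : Type*) : AddCommMonoid (RevLexExp σ) :=
  inferInstanceAs (AddCommMonoid (σ →₀ ℕ))

/-- The sorting key of the reverse lexicographic order: first the total degree, then the exponents,
read from the last variable to the first one, a larger exponent giving a smaller monomial. -/
def revLexKey {σ : Type*} (a : σ →₀ ℕ) : ℕ ×ₗ Lex (σᵒᵈ → ℕᵒᵈ) :=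
  toLex (a.degree, toLex fun i => OrderDual.toDual (a (OrderDual.ofDual i)))

theorem revLexKey_injective {σ : Type*} : Function.Injective (revLexKey (σ := σ)) := by
  intro a b h
  have h2 := congrArg (fun x => ofLex (ofLex x).2) h
  ext i
  exact congrFun h2 (OrderDual.toDual i)

section Order

variable {σ : Type*} [LinearOrder σ] [Finite σ]

instance : LinearOrder (RevLexExp σ) :=
  LinearOrder.lift' (fun a : RevLexExp σ => revLexKey (σ := σ) a) revLexKey_injective

/-- The additive identification of exponent vectors with `RevLexExp σ`. -/
def toRevLex : (σ →₀ ℕ) ≃+ RevLexExp σ := AddEquiv.refl _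

/-- The order in explicit form: `x^a < x^b` if and only if `deg x^a < deg x^b`, or the degrees are
equal and, for the last index `i` at which `a` and `b` differ, `b i < a i`. -/
theorem toRevLex_lt_iff {a b : σ →₀ ℕ} :
    toRevLex a < toRevLex b ↔
      a.degree < b.degree ∨
        (a.degree = b.degree ∧ ∃ i, (∀ j, i < j → a j = b j) ∧ b i < a i) := by
  change revLexKey a < revLexKey b ↔ _
  unfold revLexKey
  rw [Prod.Lex.toLex_lt_toLex]
  rfl

theorem toRevLex_monotone : Monotone (toRevLex (σ := σ)) := by
  intro a b h
  rcases eq_or_ne a b with rfl | hne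
  · exact le_rfl
  · refine le_of_lt (toRevLex_lt_iff.2 (Or.inl ?_))
    obtain ⟨c, rfl⟩ := exists_add_of_le h
    have hc : c ≠ 0 := by
      rintro rfl
      exact hne (by simp)
    have hd : c.degree ≠ 0 := fun h0 => hc ((Finsupp.degree_eq_zero_iff c).1 h0)
    rw [map_add]
    omega

instance : IsOrderedAddMonoid (RevLexExp σ) where
  add_le_add_left := by
    intro a b h c
    rcases eq_or_lt_of_le h with rfl | hlt
    · exact le_rfl
    · refine le_of_lt ?_
      have hlt' := (toRevLex_lt_iff (σ := σ) (a := a) (b := b)).1 hlt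
      refine (toRevLex_lt_iff (σ := σ) (a := a + c) (b := b + c)).2 ?_
      have hda : (show σ →₀ ℕ from a + c).degree =
          (show σ →₀ ℕ from a).degree + (show σ →₀ ℕ from c).degree := map_add _ _ _
      have hdb : (show σ →₀ ℕ from b + c).degree =
          (show σ →₀ ℕ from b).degree + (show σ →₀ ℕ from c).degree := map_add _ _ _
      rcases hlt' with h1 | ⟨h1, i, h2, h3⟩
      · left
        exact lt_of_eq_of_lt hda (lt_of_lt_of_eq (Nat.add_lt_add_right h1 _) hdb.symm)
      · right
        refine ⟨hda.trans ((congrArg (· + _) h1).trans hdb.symm), i, fun j hj => ?_, ?_⟩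
        · exact congrArg (· + (show σ →₀ ℕ from c) j) (h2 j hj)
        · exact Nat.add_lt_add_right h3 ((show σ →₀ ℕ from c) i)

instance : WellFoundedLT (RevLexExp σ) := by
  refine ⟨?_⟩
  rw [wellFounded_iff_isEmpty_descending_chain]
  refine ⟨fun ⟨f, hf⟩ => ?_⟩
  have hanti : StrictAnti f := strictAnti_nat_of_succ_lt hf
  obtain ⟨m, n, hmn, hle⟩ :=
    wellQuasiOrdered_le (α := σ →₀ ℕ) (fun n => toRevLex.symm (f n))
  have h1 : f m ≤ f n := by simpa using toRevLex_monotone hle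
  exact absurd (hanti hmn) (not_lt.2 h1)

/-- The (graded) reverse lexicographic order induced by the ordering of the variables in which
the variable with the smaller index is the larger one. -/
def revLex : MonomialOrder σ where
  syn := RevLexExp σ
  toSyn := toRevLex
  toSyn_monotone := toRevLex_monotone

end Order

/-! ### Edge rings, toric ideals, initial ideals -/

section Algebra

variable (K : Type*) [Field K]

/-- The monomial `t_i t_j` of an unordered pair `{i, j}`. -/
def edgeMonomial {V : Type*} (e : Sym2 V) : MvPolynomial V K :=
  (e.map MvPolynomial.X).mul

/-- The edge ring `K[G]`: the subalgebra of `K[t]` generated by the monomials of the edges. -/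
def edgeRing {V : Type*} (G : SimpleGraph V) : Subalgebra K (MvPolynomial V K) :=
  Algebra.adjoin K (edgeMonomial K '' G.edgeSet)

/-- The homomorphism `π : K[x_1, …, x_n] → K[G]` that sends `x_i` to the monomial of the `i`-th edge,
for an enumeration `e` of the edges. -/
def toricMap {V : Type*} (G : SimpleGraph V) {n : ℕ} (e : Fin n ≃ G.edgeSet) :
    MvPolynomial (Fin n) K →ₐ[K] edgeRing K G :=
  MvPolynomial.aeval fun i =>
    ⟨edgeMonomial K (e i : Sym2 V),
      Algebra.subset_adjoin (Set.mem_image_of_mem _ (e i).2)⟩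

/-- The toric ideal `I_G`, the kernel of `π`. -/
def toricIdeal {V : Type*} (G : SimpleGraph V) {n : ℕ} (e : Fin n ≃ G.edgeSet) :
    Ideal (MvPolynomial (Fin n) K) :=
  RingHom.ker (toricMap K G e)

variable {K}

/-- The initial ideal of `I`: generated by the initial monomials of its nonzero elements. -/
def initialIdeal {σ : Type*} (m : MonomialOrder σ) (I : Ideal (MvPolynomial σ K)) :
    Ideal (MvPolynomial σ K) :=
  Ideal.span {p | ∃ f ∈ I, f ≠ 0 ∧ p = MvPolynomial.monomial (m.degree f) 1}

/-- The depth of an `R`-module `M` in the ideal `I`: the supremum of the lengths of the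
`M`-regular sequences contained in `I`. -/
def depthIn {R : Type*} [CommRing R] (I : Ideal R) (M : Type*) [AddCommGroup M] [Module R M] :
    ℕ∞ :=
  ⨆ rs ∈ {rs : List R | (∀ r ∈ rs, r ∈ I) ∧ RingTheory.Sequence.IsRegular M rs}, (rs.length : ℕ∞)

/-- The depth of `K[x]/J`, for a homogeneous ideal `J`: the depth in the graded maximal ideal
`(x_i : i ∈ σ)`. -/
def depthQuot {σ : Type*} (J : Ideal (MvPolynomial σ K)) : ℕ∞ :=
  depthIn (MvPolynomial.idealOfVars σ K) (MvPolynomial σ K ⧸ J)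

/-- The standard graded algebra `K[x]/J`, for a homogeneous ideal `J`, is Cohen–Macaulay if its
depth is equal to its Krull dimension. -/
def IsCohenMacaulayQuot {σ : Type*} (J : Ideal (MvPolynomial σ K)) : Prop :=
  (depthQuot J : WithBot ℕ∞) = ringKrullDim (MvPolynomial σ K ⧸ J)

end Algebra

/-! ### The graph `G_{k+5}` -/

/-- The two ends of the edge `e_m`, for `1 ≤ m ≤ 2 * k + 5`, as vertices in `{1, …, k + 5}`. -/
def ends (k m : ℕ) : ℕ × ℕ :=
  if m = 1 then (1, 3)
  else if m ≤ k then (1, m + 3)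
  else if m = k + 1 then (1, k + 4)
  else if m = k + 2 then (2, 4)
  else if m ≤ 2 * k + 1 then (2, m - (k + 1) + 3)
  else if m = 2 * k + 2 then (2, k + 5)
  else if m = 2 * k + 3 then (3, 4)
  else if m = 2 * k + 4 then (3, k + 4)
  else (4, k + 5)

theorem ends_bounds {k m : ℕ} (hk : 1 ≤ k) :
    1 ≤ (ends k m).1 ∧ (ends k m).1 < (ends k m).2 ∧ (ends k m).2 ≤ k + 5 := by
  unfold ends
  split_ifs <;> dsimp only <;> omega

theorem ends_injective {k m m' : ℕ} (hk : 1 ≤ k) (hm : 1 ≤ m) (hm' : 1 ≤ m')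
    (hm2 : m ≤ 2 * k + 5) (hm2' : m' ≤ 2 * k + 5) (h : ends k m = ends k m') : m = m' := by
  have key : ∀ m, 1 ≤ m → m ≤ 2 * k + 5 →
      (if (ends k m).1 = 1 then (if (ends k m).2 = 3 then 1 else (ends k m).2 - 3)
        else if (ends k m).1 = 2 then
          (if (ends k m).2 = 4 then k + 2
            else if (ends k m).2 = k + 5 then 2 * k + 2 else (ends k m).2 + k - 2)
        else if (ends k m).1 = 3 then (if (ends k m).2 = 4 then 2 * k + 3 else 2 * k + 4)
        else 2 * k + 5) = m := by
    intro m h1 h2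
    generalize hp : ends k m = p
    unfold ends at hp
    split_ifs at hp <;> subst hp <;> dsimp only <;> split_ifs <;> omega
  rw [← key m hm hm2, ← key m' hm' hm2', h]

/-- The vertex `v ∈ {1, …, k + 5}`, as an element of `Fin (k + 5)`. -/
def vertex (k v : ℕ) : Fin (k + 5) := Fin.ofNat (k + 5) (v - 1)

theorem vertex_injective {k v w : ℕ} (hv : 1 ≤ v) (hw : 1 ≤ w) (hv' : v ≤ k + 5)
    (hw' : w ≤ k + 5) (h : vertex k v = vertex k w) : v = w := by
  have h2 : (v - 1) % (k + 5) = (w - 1) % (k + 5) := congrArg Fin.val h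
  rw [Nat.mod_eq_of_lt (by omega), Nat.mod_eq_of_lt (by omega)] at h2
  omega

/-- The edge `e_{i+1}`, for `i = 0, …, 2 * k + 4`. -/
def edge (k : ℕ) (i : Fin (2 * k + 5)) : Sym2 (Fin (k + 5)) :=
  s(vertex k (ends k (i + 1)).1, vertex k (ends k (i + 1)).2)

/-- The graph `G_{k+5}`, with the edges `e_1, …, e_{2k+5}`. -/
def graph (k : ℕ) : SimpleGraph (Fin (k + 5)) := SimpleGraph.fromEdgeSet (Set.range (edge k))

theorem edge_mem {k : ℕ} (hk : 1 ≤ k) (i : Fin (2 * k + 5)) : edge k i ∈ (graph k).edgeSet := by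
  unfold graph
  rw [SimpleGraph.edgeSet_fromEdgeSet]
  refine ⟨⟨i, rfl⟩, ?_⟩
  have hb := ends_bounds (k := k) (m := i + 1) hk
  intro hd
  have hd' : vertex k (ends k (i + 1)).1 = vertex k (ends k (i + 1)).2 := hd
  have := vertex_injective (by omega) (by omega) (by omega) (by omega) hd'
  omega

theorem edge_bijective {k : ℕ} (hk : 1 ≤ k) :
    Function.Bijective
      (fun i : Fin (2 * k + 5) => (⟨edge k i, edge_mem hk i⟩ : (graph k).edgeSet)) := by
  constructor
  · intro i j hij
    have h : edge k i = edge k j := congrArg Subtype.val hij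
    have hi := ends_bounds (k := k) (m := i + 1) hk
    have hj := ends_bounds (k := k) (m := j + 1) hk
    have key : ends k (i + 1) = ends k (j + 1) := by
      unfold edge at h
      rw [Sym2.eq_iff] at h
      rcases h with ⟨h1, h2⟩ | ⟨h1, h2⟩
      · have e1 := vertex_injective (by omega) (by omega) (by omega) (by omega) h1
        have e2 := vertex_injective (by omega) (by omega) (by omega) (by omega) h2
        exact Prod.ext e1 e2
      · have e1 := vertex_injective (by omega) (by omega) (by omega) (by omega) h1
        have e2 := vertex_injective (by omega) (by omega) (by omega) (by omega) h2
        omega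
    have hin := ends_injective hk (by omega) (by omega) (by omega) (by omega) key
    exact Fin.ext (by omega)
  · rintro ⟨e, he⟩
    unfold graph at he
    rw [SimpleGraph.edgeSet_fromEdgeSet] at he
    obtain ⟨⟨i, rfl⟩, -⟩ := he
    exact ⟨i, rfl⟩

/-- The enumeration `e_1, …, e_{2k+5}` of the edges of `G_{k+5}`. -/
def edgeEquiv {k : ℕ} (hk : 1 ≤ k) : Fin (2 * k + 5) ≃ (graph k).edgeSet :=
  Equiv.ofBijective _ (edge_bijective hk)

end

end EdgeRing

/-!
Number the variables from zero and write `a_0, …, a_k, b_0, …, b_k, c, d, e` for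
`x_1, …, x_{2k+5}`; for `0 < i < k` the edges of `a_i` and `b_i` meet in a vertex of degree two.

**The initial ideals.** The toric map sends monomials to monomials, so the initial ideal is
spanned by the monomials that are not the least ones in their fibres (`initialIdeal_toricIdeal`).
Comparing degrees at the vertices of the graph, two exponent vectors of one fibre differ by `t_i`
at `a_i` and `-t_i` at `b_i` for `0 < i < k`, by `E, D, -D, -E` at `a_0, b_0, a_k, b_k`, and by
`-D-E, D, E` at `c, d, e`, with `∑ t_i = D - E` (`fibre_equations`). To identify the initial ideal
it is therefore enough to exhibit monomials that are not least in their fibres and to check that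
two distinct monomials of one fibre are never both outside the ideal they generate
(`initialIdeal_toricIdeal_eq_monIdeal`). This gives

* lex: the staircase ideal of all `A_i B_j` with `0 ≤ i < j ≤ k`, where `A_i = a_i` for `i > 0`,
  `B_j = b_j` for `j < k`, `A_0 = a_0 e` and `B_k = b_0 d` (`initialIdeal_lex`);
* rev: the ideal generated by `b_i a_j` for `0 < i < j < k`, by `c b_k a_j` and `c b_i a_k` for
  `0 < i, j < k`, by `a_k b_k c ^ 2`, and by `a_i a_j b_0 b_k d` for `0 < i ≤ j < k`
  (`initialIdeal_revLex`).

**Lower bounds.** If linear forms are a regular sequence modulo `(I : f)` and modulo `I + (f)`, they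
are one modulo `I`. Splitting repeatedly, a monomial ideal is filtered by prime ideals generated by
variables (`PrimeFiltered`), and it is enough that the forms are linearly independent modulo each of
these sets of variables (`PrimeFiltered.weaklyRegularMod`). For lex this works with `k + 5` forms and
primes of dimension `k + 5`, and the same filtration bounds the Krull dimension by `k + 5`
(`PrimeFiltered.ringKrullDim_le`), whence the Cohen–Macaulay property. For rev it works with six forms.

**Upper bound.** The depth is at most `dim R ⧸ P` for every associated prime `P` (`depthQuot_le`).
Modulo the rev initial ideal the annihilator of `a_k b_k c` is the prime generated by `c` and the
`a_i`, `b_i` with `0 < i < k`, which leaves the six variables `a_0, b_0, a_k, b_k, d, e`.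
-/

namespace EdgeRing

open MvPolynomial
open scoped Pointwise

/-! ### Regular sequences modulo an ideal -/

section Regular

variable {R : Type*} [CommRing R]

/-- The sequence `rs` is weakly regular on `R ⧸ I`, expressed inside `R`. -/
def WeaklyRegularMod : Ideal R → List R → Prop
  | _, [] => True
  | I, r :: rs => (∀ g, r * g ∈ I → g ∈ I) ∧ WeaklyRegularMod (I ⊔ Ideal.span {r}) rs

theorem isWeaklyRegular_quotient_iff (I : Ideal R) (rs : List R) :
    RingTheory.Sequence.IsWeaklyRegular (R ⧸ I) rs ↔ WeaklyRegularMod I rs := by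
  induction rs generalizing I with
  | nil => simp [WeaklyRegularMod]
  | cons r rs ih =>
    rw [RingTheory.Sequence.isWeaklyRegular_cons_iff, WeaklyRegularMod, ← ih]
    refine and_congr ?_ ?_
    · rw [isSMulRegular_iff_right_eq_zero_of_smul]
      constructor
      · intro h g hg
        have := h (Ideal.Quotient.mk I g)
        rw [← Ideal.Quotient.eq_zero_iff_mem]
        exact this (by
          rw [← Ideal.Quotient.eq_zero_iff_mem] at hg
          rwa [Algebra.smul_def, Ideal.Quotient.algebraMap_eq, ← map_mul])
      · intro h y hy
        obtain ⟨g, rfl⟩ := Ideal.Quotient.mk_surjective y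
        rw [Algebra.smul_def, Ideal.Quotient.algebraMap_eq, ← map_mul,
          Ideal.Quotient.eq_zero_iff_mem] at hy
        rw [Ideal.Quotient.eq_zero_iff_mem]
        exact h g hy
    · refine LinearEquiv.isWeaklyRegular_congr ?_ rs
      have hker : (I ⊔ Ideal.span {r}) =
          LinearMap.ker ((Submodule.mkQ (r • (⊤ : Submodule R (R ⧸ I)))).comp
            (Submodule.mkQ I)) := by
        ext g
        rw [LinearMap.mem_ker, LinearMap.comp_apply, Submodule.mkQ_apply, Submodule.mkQ_apply,
          Submodule.Quotient.mk_eq_zero, Submodule.mem_smul_pointwise_iff_exists,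
          sup_comm, Ideal.mem_span_singleton_sup]
        constructor
        · rintro ⟨a, b, hb, rfl⟩
          refine ⟨Submodule.Quotient.mk a, trivial, ?_⟩
          rw [← Submodule.Quotient.mk_smul, Submodule.Quotient.eq, smul_eq_mul]
          have : r * a - (a * r + b) = -b := by ring
          rw [this]
          exact I.neg_mem hb
        · rintro ⟨y, -, hy⟩
          obtain ⟨a, rfl⟩ := Submodule.Quotient.mk_surjective I y
          rw [← Submodule.Quotient.mk_smul, Submodule.Quotient.eq, smul_eq_mul] at hy
          refine ⟨a, -(r * a - g), I.neg_mem hy, by ring⟩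
      exact ((Submodule.quotEquivOfEq _ _ hker).trans
        (LinearMap.quotKerEquivOfSurjective _
          ((Submodule.mkQ_surjective _).comp (Submodule.mkQ_surjective _)))).symm

/-- Weak regularity passes from the two ends of `0 → R ⧸ (I : f) → R ⧸ I → R ⧸ (I + f) → 0` to the
middle term. -/
theorem WeaklyRegularMod.of_colon_of_sup {I I₁ : Ideal R} {f : R} (h : ∀ g, f * g ∈ I ↔ g ∈ I₁)
    {rs : List R} (h₁ : WeaklyRegularMod I₁ rs) (h₂ : WeaklyRegularMod (I ⊔ Ideal.span {f}) rs) :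
    WeaklyRegularMod I rs := by
  induction rs generalizing I I₁ with
  | nil => trivial
  | cons r rs ih =>
    refine ⟨fun g hg => ?_, ih (I₁ := I₁ ⊔ Ideal.span {r}) (fun g => ?_) h₁.2 ?_⟩
    · have h3 := h₂.1 g (Ideal.mem_sup_left hg)
      rw [sup_comm, Ideal.mem_span_singleton_sup] at h3
      obtain ⟨t, i, hi, rfl⟩ := h3
      have h4 : f * (r * t) ∈ I := by
        have := I.sub_mem hg (I.mul_mem_left r hi)
        convert this using 1
        ring
      have h5 := (h t).2 (h₁.1 t ((h _).1 h4))
      rw [mul_comm] at h5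
      exact I.add_mem h5 hi
    · rw [sup_comm, Ideal.mem_span_singleton_sup, sup_comm, Ideal.mem_span_singleton_sup]
      constructor
      · rintro ⟨t, i, hi, hti⟩
        have h3 : r * t ∈ I ⊔ Ideal.span {f} := by
          rw [sup_comm, Ideal.mem_span_singleton_sup]
          exact ⟨g, -i, I.neg_mem hi, by rw [mul_comm g, ← hti]; ring⟩
        have h4 := h₂.1 t h3
        rw [sup_comm, Ideal.mem_span_singleton_sup] at h4
        obtain ⟨t', i', hi', rfl⟩ := h4
        refine ⟨t', g - t' * r, (h _).1 ?_, by ring⟩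
        have : f * (g - t' * r) = i' * r + i := by
          rw [mul_sub, ← hti]; ring
        rw [this]
        exact I.add_mem (I.mul_mem_right r hi') hi
      · rintro ⟨t, i, hi, rfl⟩
        exact ⟨f * t, f * i, (h i).2 hi, by ring⟩
    · have h3 := h₂.2
      rwa [sup_assoc, sup_comm (Ideal.span {f}), ← sup_assoc] at h3

end Regular

/-! ### Depth and associated primes -/

section Depth

variable {R : Type*} [CommRing R]

theorem ringKrullDim_quotient_eq_coheight (p : PrimeSpectrum R) :
    ringKrullDim (R ⧸ p.asIdeal) = Order.coheight p := by
  rw [ringKrullDim_quotient, Order.coheight_eq_krullDim_Ici]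
  have : PrimeSpectrum.zeroLocus (p.asIdeal : Set R) = Set.Ici p := by
    ext q
    rfl
  rw [this]

/-- A regular element `x` of a prime `m` moves an associated prime `P ≤ m` of `R ⧸ I` to an
associated prime of `R ⧸ (I + x)` that lies in `m` and contains `P` and `x`. -/
theorem exists_prime_colon_sup_span [IsNoetherianRing R] {m I P : Ideal R} (hm : m.IsPrime)
    (hP : P.IsPrime) (hPm : P ≤ m) {f x : R} (hf : ∀ g, g * f ∈ I ↔ g ∈ P) (hx : x ∈ m)
    (hreg : ∀ g, x * g ∈ I → g ∈ I) :
    ∃ Q : Ideal R, Q.IsPrime ∧ Q ≤ m ∧ P ≤ Q ∧ x ∈ Q ∧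
      ∃ f', ∀ g, g * f' ∈ I ⊔ Ideal.span {x} ↔ g ∈ Q := by
  -- `L f` is the contraction to `R` of the localization at `m` of the ideal `I + f`.
  let L : R → Ideal R := fun f =>
    { carrier := {g | ∃ s, s ∉ m ∧ s * g ∈ I ⊔ Ideal.span {f}}
      add_mem' := by
        rintro a b ⟨s, hs, hsa⟩ ⟨t, ht, htb⟩
        refine ⟨s * t, fun h => (hm.mem_or_mem h).elim hs ht, ?_⟩
        have : s * t * (a + b) = t * (s * a) + s * (t * b) := by ring
        rw [this]
        exact Ideal.add_mem _ (Ideal.mul_mem_left _ _ hsa) (Ideal.mul_mem_left _ _ htb)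
      zero_mem' := ⟨1, fun h => hm.ne_top ((Ideal.eq_top_iff_one _).2 h), by simp⟩
      smul_mem' := by
        rintro r a ⟨s, hs, hsa⟩
        refine ⟨s, hs, ?_⟩
        have : s * (r • a) = r * (s * a) := by simp only [smul_eq_mul]; ring
        rw [this]
        exact Ideal.mul_mem_left _ _ hsa }
  obtain ⟨J, ⟨f, hf, rfl⟩, hmax⟩ := set_has_maximal_iff_noetherian.2 (inferInstance :
    IsNoetherian R R) {J | ∃ f, (∀ g, g * f ∈ I ↔ g ∈ P) ∧ J = L f} ⟨_, f, hf, rfl⟩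
  -- Maximality of `L f` forces `(I + x : f) ≤ m`.
  have key : ∀ s, s * f ∈ I ⊔ Ideal.span {x} → s ∈ m := by
    intro s hsf
    by_contra hs
    rw [sup_comm, Ideal.mem_span_singleton_sup] at hsf
    obtain ⟨f₁, i, hi, hsf⟩ := hsf
    have hf₁ : ∀ g, g * f₁ ∈ I ↔ g ∈ P := by
      intro g
      have e : g * s * f = g * (f₁ * x + i) := by rw [hsf]; ring
      constructor
      · intro h
        have : g * s * f ∈ I := by
          rw [e]
          have : g * (f₁ * x + i) = x * (g * f₁) + g * i := by ring
          rw [this]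
          exact I.add_mem (I.mul_mem_left _ h) (I.mul_mem_left _ hi)
        exact (hP.mem_or_mem ((hf _).1 this)).resolve_right fun h => hs (hPm h)
      · intro h
        apply hreg
        have h2 : g * s * f ∈ I := (hf _).2 (P.mul_mem_right s h)
        have : x * (g * f₁) = g * s * f - g * i := by rw [e]; ring
        rw [this]
        exact I.sub_mem h2 (I.mul_mem_left _ hi)
    refine hmax (L f₁) ⟨f₁, hf₁, rfl⟩ (lt_of_le_of_ne ?_ ?_)
    · rintro g ⟨t, ht, htg⟩
      refine ⟨s * t, fun h => (hm.mem_or_mem h).elim hs ht, ?_⟩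
      rw [sup_comm, Ideal.mem_span_singleton_sup] at htg ⊢
      obtain ⟨a, j, hj, h⟩ := htg
      refine ⟨a * x, a * i + s * j, I.add_mem (I.mul_mem_left _ hi) (I.mul_mem_left _ hj), ?_⟩
      have : s * t * g = a * (s * f) + s * j := by rw [mul_assoc, ← h]; ring
      rw [this, ← hsf]
      ring
    · intro h
      have h1 : f₁ ∈ L f := by
        rw [h]
        exact ⟨1, fun h => hm.ne_top ((Ideal.eq_top_iff_one _).2 h),
          Ideal.mem_sup_right (by rw [one_mul]; exact Ideal.mem_span_singleton_self _)⟩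
      obtain ⟨t, ht, htf⟩ := h1
      rw [sup_comm, Ideal.mem_span_singleton_sup] at htf
      obtain ⟨a, j, hj, htf⟩ := htf
      have h2 : (s * t - a * x) * f₁ ∈ I := by
        have : (s * t - a * x) * f₁ = s * j + a * i := by
          have e1 : s * t * f₁ = a * (s * f) + s * j := by rw [mul_assoc, ← htf]; ring
          rw [sub_mul, e1, ← hsf]
          ring
        rw [this]
        exact I.add_mem (I.mul_mem_left _ hj) (I.mul_mem_left _ hi)
      have h3 := hPm ((hf₁ _).1 h2)
      have h4 : s * t ∈ m := by
        have := m.add_mem h3 (m.mul_mem_left a hx)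
        rwa [sub_add_cancel] at this
      exact (hm.mem_or_mem h4).elim hs ht
  have hle : Submodule.colon (I ⊔ Ideal.span {x}) {f} ≤ m := by
    intro s hs
    exact key s (by simpa [Submodule.mem_colon_singleton] using hs)
  obtain ⟨Q, hQ, hQm⟩ := Ideal.exists_minimalPrimes_le hle
  obtain ⟨f', rfl⟩ := Submodule.exists_eq_colon_of_mem_minimalPrimes hQ
  refine ⟨_, hQ.1.1, hQm, ?_, ?_, f', fun g => ?_⟩
  · intro g hg
    apply hQ.1.2
    rw [Submodule.mem_colon_singleton]
    exact Ideal.mem_sup_left ((hf g).2 hg)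
  · apply hQ.1.2
    rw [Submodule.mem_colon_singleton]
    exact Ideal.mem_sup_right (Ideal.mul_mem_right _ _ (Ideal.mem_span_singleton_self x))
  · rw [Submodule.mem_colon_singleton, smul_eq_mul]

/-- The length of a regular sequence is bounded by the dimension of `R ⧸ P`, for each associated
prime `P` of the quotient. -/
theorem WeaklyRegularMod.length_le_ringKrullDim [IsNoetherianRing R] {m I P : Ideal R}
    (hm : m.IsPrime) (hP : P.IsPrime) (hPm : P ≤ m) {f : R} (hf : ∀ g, g * f ∈ I ↔ g ∈ P)
    {rs : List R} (hrs : ∀ r ∈ rs, r ∈ m) (h : WeaklyRegularMod I rs) :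
    (rs.length : WithBot ℕ∞) ≤ ringKrullDim (R ⧸ P) := by
  have hco := ringKrullDim_quotient_eq_coheight (⟨P, hP⟩ : PrimeSpectrum R)
  rw [hco]
  suffices h2 : (rs.length : ℕ∞) ≤ Order.coheight (⟨P, hP⟩ : PrimeSpectrum R) by
    exact_mod_cast h2
  clear hco
  induction rs generalizing I P f with
  | nil => simp
  | cons x rs ih =>
    obtain ⟨Q, hQ, hQm, hPQ, hxQ, f', hf'⟩ := exists_prime_colon_sup_span hm hP hPm hf
      (hrs x (by simp)) h.1
    have h1 := ih hQ hQm hf' (fun r hr => hrs r (by simp [hr])) h.2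
    have hxP : x ∉ P := by
      intro hx
      have h2 := h.1 f ((hf x).2 hx)
      exact hP.ne_top ((Ideal.eq_top_iff_one _).2 ((hf 1).1 (by rwa [one_mul])))
    have hlt : (⟨P, hP⟩ : PrimeSpectrum R) < ⟨Q, hQ⟩ :=
      lt_of_le_of_ne hPQ fun e => hxP (by
        have := congrArg PrimeSpectrum.asIdeal e
        simp only at this
        rwa [this])
    have h3 := Order.coheight_add_one_le hlt
    rw [List.length_cons, Nat.cast_add, Nat.cast_one]
    exact (add_le_add_left h1 1).trans h3

end Depth

section DepthQuot

variable {K : Type*} [Field K] {σ : Type*}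

theorem idealOfVars_isPrime : (idealOfVars σ K).IsPrime := by
  have h : idealOfVars σ K = RingHom.ker (constantCoeff (σ := σ) (R := K)) := by
    ext p
    rw [← pow_one (idealOfVars σ K), mem_pow_idealOfVars_iff', RingHom.mem_ker,
      constantCoeff_eq]
    simp only [Nat.lt_one_iff, Finsupp.degree_eq_zero_iff, forall_eq]
  rw [h]
  exact RingHom.ker_isPrime _

theorem isRegular_quotient {J : Ideal (MvPolynomial σ K)} (hJ : J ≤ idealOfVars σ K)
    {rs : List (MvPolynomial σ K)} (hrs : ∀ r ∈ rs, r ∈ idealOfVars σ K)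
    (h : WeaklyRegularMod J rs) :
    RingTheory.Sequence.IsRegular (MvPolynomial σ K ⧸ J) rs := by
  refine ⟨(isWeaklyRegular_quotient_iff J rs).2 h, fun htop => ?_⟩
  have h1 : Ideal.ofList rs ≤ idealOfVars σ K := by
    rw [Ideal.ofList, Ideal.span_le]
    exact fun r hr => hrs r hr
  have h2 : (Submodule.mkQ J 1) ∈
      Submodule.map (Submodule.mkQ J) (idealOfVars σ K) := by
    have h3 : Submodule.mkQ J 1 ∈ (⊤ : Submodule (MvPolynomial σ K) (MvPolynomial σ K ⧸ J)) :=
      trivial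
    rw [htop, ← Submodule.range_mkQ J, LinearMap.range_eq_map, ← Submodule.map_smul''] at h3
    refine Submodule.map_mono ?_ h3
    rw [Ideal.smul_eq_mul, Ideal.mul_top]
    exact h1
  rw [← Submodule.mem_comap, Submodule.comap_map_mkQ, sup_eq_right.2 hJ] at h2
  exact (idealOfVars_isPrime (K := K) (σ := σ)).ne_top ((Ideal.eq_top_iff_one _).2 h2)

theorem le_depthQuot {J : Ideal (MvPolynomial σ K)} (hJ : J ≤ idealOfVars σ K)
    {rs : List (MvPolynomial σ K)} (hrs : ∀ r ∈ rs, r ∈ idealOfVars σ K)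
    (h : WeaklyRegularMod J rs) : (rs.length : ℕ∞) ≤ depthQuot J :=
  le_iSup₂_of_le (f := fun (rs : List (MvPolynomial σ K)) _ => (rs.length : ℕ∞)) rs
    ⟨hrs, isRegular_quotient hJ hrs h⟩ le_rfl

variable [Finite σ]

/-- `depth R ⧸ J ≤ dim R ⧸ P` for an associated prime `P = (J : f)`. -/
theorem depthQuot_le {J P : Ideal (MvPolynomial σ K)} (hP : P.IsPrime) (hPm : P ≤ idealOfVars σ K)
    {f : MvPolynomial σ K} (hf : ∀ g, g * f ∈ J ↔ g ∈ P) :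
    (depthQuot J : WithBot ℕ∞) ≤ ringKrullDim (MvPolynomial σ K ⧸ P) := by
  rw [ringKrullDim_quotient_eq_coheight (⟨P, hP⟩ : PrimeSpectrum _), WithBot.coe_le_coe]
  refine iSup₂_le fun rs hrs => ?_
  have := WeaklyRegularMod.length_le_ringKrullDim idealOfVars_isPrime hP hPm hf hrs.1
    ((isWeaklyRegular_quotient_iff J rs).1 hrs.2.toIsWeaklyRegular)
  rw [ringKrullDim_quotient_eq_coheight (⟨P, hP⟩ : PrimeSpectrum _)] at this
  exact_mod_cast this

/-- A regular sequence whose length is at least the dimension shows that the quotient is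
Cohen–Macaulay. -/
theorem isCohenMacaulayQuot_of_weaklyRegularMod {J : Ideal (MvPolynomial σ K)}
    (hJ : J ≤ idealOfVars σ K) {rs : List (MvPolynomial σ K)}
    (hrs : ∀ r ∈ rs, r ∈ idealOfVars σ K) (h : WeaklyRegularMod J rs)
    (hdim : ringKrullDim (MvPolynomial σ K ⧸ J) ≤ rs.length) : IsCohenMacaulayQuot J := by
  refine le_antisymm ?_ (hdim.trans ?_)
  · have hcolon : Submodule.colon J {(1 : MvPolynomial σ K)} ≤ idealOfVars σ K := by
      intro g hg
      rw [Submodule.mem_colon_singleton, smul_eq_mul, mul_one] at hg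
      exact hJ hg
    have := idealOfVars_isPrime (K := K) (σ := σ)
    obtain ⟨Q, hQ, hQm⟩ := Ideal.exists_minimalPrimes_le hcolon
    obtain ⟨f, rfl⟩ := Submodule.exists_eq_colon_of_mem_minimalPrimes hQ
    refine (depthQuot_le hQ.1.1 hQm (f := f) fun g => ?_).trans ?_
    · rw [Submodule.mem_colon_singleton, smul_eq_mul]
    · have hle : J ≤ Submodule.colon J {f} := by
        intro g hg
        rw [Submodule.mem_colon_singleton, smul_eq_mul]
        exact J.mul_mem_right _ hg
      exact ringKrullDim_le_of_surjective (Ideal.Quotient.factor hle)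
        (Ideal.Quotient.factor_surjective hle)
  · have := le_depthQuot hJ hrs h
    exact_mod_cast this

end DepthQuot

/-! ### Linear forms -/

section LinearForms

variable {K : Type*} [Field K] {σ : Type*} [Fintype σ]

variable (K σ) in
/-- The linear form in the variables with a given coefficient vector. -/
noncomputable def linForm : (σ → K) →ₗ[K] MvPolynomial σ K :=
  Fintype.linearCombination K (fun x => (X x : MvPolynomial σ K))

theorem linForm_apply (v : σ → K) : linForm K σ v = ∑ x, v x • (X x : MvPolynomial σ K) := by
  simp [linForm, Fintype.linearCombination_apply]

theorem linForm_single [DecidableEq σ] (x : σ) : linForm K σ (Pi.single x 1) = X x := by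
  simp [linForm]

theorem linForm_mem_idealOfVars (v : σ → K) : linForm K σ v ∈ idealOfVars σ K := by
  rw [linForm_apply]
  refine Ideal.sum_mem _ fun x _ => ?_
  rw [smul_eq_C_mul]
  exact Ideal.mul_mem_left _ _ (Ideal.subset_span ⟨x, rfl⟩)

theorem linForm_injective : Function.Injective (linForm K σ) := by
  classical
  intro v w h
  ext x
  have := congrArg (coeff (Finsupp.single x 1)) h
  simpa [linForm_apply, coeff_sum, coeff_X, Finsupp.single_left_inj] using this

/-- The ideal generated by the linear forms of a subspace. -/
noncomputable def linIdeal (W : Submodule K (σ → K)) : Ideal (MvPolynomial σ K) :=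
  Ideal.span (linForm K σ '' W)

theorem linIdeal_sup_span (W : Submodule K (σ → K)) (v : σ → K) :
    linIdeal (W ⊔ Submodule.span K {v}) = linIdeal W ⊔ Ideal.span {linForm K σ v} := by
  refine le_antisymm (Ideal.span_le.2 ?_) (sup_le (Ideal.span_mono ?_) ?_)
  · rintro _ ⟨u, hu, rfl⟩
    obtain ⟨w, hw, y, hy, rfl⟩ := Submodule.mem_sup.1 hu
    obtain ⟨t, rfl⟩ := Submodule.mem_span_singleton.1 hy
    rw [map_add, map_smul, smul_eq_C_mul]
    exact Ideal.add_mem _ (Ideal.mem_sup_left (Ideal.subset_span ⟨w, hw, rfl⟩))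
      (Ideal.mul_mem_left _ _ (Ideal.mem_sup_right (Ideal.mem_span_singleton_self _)))
  · exact Set.image_mono (SetLike.coe_subset_coe.2 le_sup_left)
  · rw [Ideal.span_singleton_le_iff_mem]
    exact Ideal.subset_span ⟨v, Submodule.mem_sup_right (Submodule.mem_span_singleton_self v), rfl⟩

/-- The ideal of a subspace `W` is the kernel of an endomorphism of the polynomial ring, induced by
a linear projection with kernel `W`. -/
theorem exists_algHom_ker_eq_linIdeal (W : Submodule K (σ → K)) :
    ∃ φ : MvPolynomial σ K →ₐ[K] MvPolynomial σ K, RingHom.ker φ = linIdeal W ∧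
      ∀ v, φ (linForm K σ v) = 0 → v ∈ W := by
  classical
  obtain ⟨W', hW⟩ := W.exists_isCompl
  let p : (σ → K) →ₗ[K] (σ → K) := W'.subtype.comp (W'.projectionOnto W hW.symm)
  have hp : LinearMap.ker p = W := by
    rw [LinearMap.ker_comp_of_ker_eq_bot _ (Submodule.ker_subtype _)]
    exact Submodule.ker_projectionOnto hW.symm
  have hpp : ∀ v, p v - v ∈ W := by
    intro v
    rw [← hp, LinearMap.mem_ker, map_sub, sub_eq_zero]
    change ((W'.projectionOnto W hW.symm) ((W'.projectionOnto W hW.symm v : W') : σ → K) :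
      σ → K) = _
    rw [Submodule.projectionOnto_apply_left]
    rfl
  let φ : MvPolynomial σ K →ₐ[K] MvPolynomial σ K :=
    aeval fun x => linForm K σ (p (Pi.single x 1))
  have hφ : ∀ v, φ (linForm K σ v) = linForm K σ (p v) := by
    intro v
    rw [linForm_apply, map_sum]
    conv_rhs => rw [pi_eq_sum_univ' v, map_sum, map_sum]
    refine Finset.sum_congr rfl fun x _ => ?_
    rw [map_smul, map_smul, map_smul, aeval_X]
  refine ⟨φ, le_antisymm (fun f hf => ?_) (Ideal.span_le.2 ?_), fun v hv => ?_⟩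
  · have h1 : ((Ideal.Quotient.mkₐ K (linIdeal W)).comp φ) = Ideal.Quotient.mkₐ K (linIdeal W) := by
      refine MvPolynomial.algHom_ext fun x => ?_
      rw [AlgHom.comp_apply, aeval_X, Ideal.Quotient.mkₐ_eq_mk, Ideal.Quotient.eq,
        ← linForm_single (K := K) x, ← map_sub]
      exact Ideal.subset_span ⟨_, hpp _, rfl⟩
    have h2 := DFunLike.congr_fun h1 f
    rw [AlgHom.comp_apply, (RingHom.mem_ker).1 hf, map_zero, Ideal.Quotient.mkₐ_eq_mk] at h2
    exact Ideal.Quotient.eq_zero_iff_mem.1 h2.symm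
  · rintro _ ⟨w, hw, rfl⟩
    rw [SetLike.mem_coe, RingHom.mem_ker, hφ]
    rw [SetLike.mem_coe, ← hp, LinearMap.mem_ker] at hw
    rw [hw, map_zero]
  · rw [hφ, ← map_zero (linForm K σ)] at hv
    rw [← hp, LinearMap.mem_ker]
    exact linForm_injective hv

theorem linIdeal_isPrime (W : Submodule K (σ → K)) : (linIdeal W).IsPrime := by
  obtain ⟨φ, hφ, -⟩ := exists_algHom_ker_eq_linIdeal W
  rw [← hφ]
  exact RingHom.ker_isPrime _

theorem linForm_mem_linIdeal {W : Submodule K (σ → K)} {v : σ → K} :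
    linForm K σ v ∈ linIdeal W ↔ v ∈ W := by
  refine ⟨fun h => ?_, fun h => Ideal.subset_span ⟨v, h, rfl⟩⟩
  obtain ⟨φ, hφ, h2⟩ := exists_algHom_ker_eq_linIdeal W
  rw [← hφ] at h
  exact h2 v h

/-- Linear forms that are linearly independent modulo `W` form a regular sequence modulo the ideal
of `W`. -/
theorem weaklyRegularMod_linIdeal {ι : Type*} [DecidableEq ι] (θ : ι → σ → K) (l : List ι)
    (hl : l.Nodup) (W : Submodule K (σ → K))
    (h : ∀ c : ι → K, ∑ i ∈ l.toFinset, c i • θ i ∈ W → ∀ i ∈ l, c i = 0) :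
    WeaklyRegularMod (linIdeal W) (l.map fun i => linForm K σ (θ i)) := by
  induction l generalizing W with
  | nil => trivial
  | cons i l ih =>
    have hi : i ∉ l := (List.nodup_cons.1 hl).1
    have hi' : i ∉ l.toFinset := by simpa using hi
    refine ⟨fun g hg => ((linIdeal_isPrime W).mem_or_mem hg).resolve_left fun hW => ?_, ?_⟩
    · rw [linForm_mem_linIdeal] at hW
      have := h (Pi.single i 1) (by
        rw [List.toFinset_cons, Finset.sum_insert hi', Finset.sum_eq_zero, add_zero]
        · simpa using hW
        · intro j hj
          rw [Pi.single_eq_of_ne (by rintro rfl; exact hi' hj), zero_smul]) i (by simp)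
      simp at this
    · rw [← linIdeal_sup_span]
      refine ih (List.nodup_cons.1 hl).2 _ fun c hc => ?_
      obtain ⟨w, hw, y, hy, hwy⟩ := Submodule.mem_sup.1 hc
      obtain ⟨t, rfl⟩ := Submodule.mem_span_singleton.1 hy
      have h2 := h (Function.update c i (-t)) (by
        rw [List.toFinset_cons, Finset.sum_insert hi', Function.update_self]
        have : ∑ j ∈ l.toFinset, Function.update c i (-t) j • θ j =
            ∑ j ∈ l.toFinset, c j • θ j := Finset.sum_congr rfl fun j hj => by
          rw [Function.update_of_ne (by rintro rfl; exact hi' hj)]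
        rw [this, ← hwy]
        simpa using hw)
      intro j hj
      have h3 := h2 j (by simp [hj])
      rwa [Function.update_of_ne (by rintro rfl; exact hi hj)] at h3

/-- The coordinate subspace of the vectors supported on `S`. -/
def coordSubspace (K : Type*) [Field K] {σ : Type*} (S : Set σ) : Submodule K (σ → K) where
  carrier := {v | ∀ x, x ∉ S → v x = 0}
  add_mem' := fun ha hb x hx => by simp [ha x hx, hb x hx]
  zero_mem' := fun _ _ => rfl
  smul_mem' := fun c v hv x hx => by simp [hv x hx]

theorem linIdeal_coordSubspace (S : Set σ) :
    linIdeal (coordSubspace K S) = Ideal.span (X '' S : Set (MvPolynomial σ K)) := by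
  classical
  refine le_antisymm (Ideal.span_le.2 ?_) (Ideal.span_le.2 ?_)
  · rintro _ ⟨v, hv, rfl⟩
    rw [linForm_apply]
    refine Ideal.sum_mem _ fun x _ => ?_
    by_cases hx : x ∈ S
    · rw [smul_eq_C_mul]
      exact Ideal.mul_mem_left _ _ (Ideal.subset_span ⟨x, hx, rfl⟩)
    · rw [hv x hx, zero_smul]
      exact Ideal.zero_mem _
  · rintro _ ⟨x, hx, rfl⟩
    rw [← linForm_single]
    refine Ideal.subset_span ⟨_, fun y hy => ?_, rfl⟩
    rw [Pi.single_eq_of_ne]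
    rintro rfl
    exact hy hx

theorem isPrime_span_X_image (S : Set σ) :
    (Ideal.span (X '' S : Set (MvPolynomial σ K))).IsPrime := by
  rw [← linIdeal_coordSubspace]
  exact linIdeal_isPrime _

theorem ringKrullDim_quotient_span_X_image_le (S : Set σ) :
    ringKrullDim (MvPolynomial σ K ⧸ Ideal.span (X '' S : Set (MvPolynomial σ K))) ≤
      Nat.card (Sᶜ : Set σ) := by
  let f : MvPolynomial (Sᶜ : Set σ) K →ₐ[K]
      MvPolynomial σ K ⧸ Ideal.span (X '' S : Set (MvPolynomial σ K)) :=
    (Ideal.Quotient.mkₐ K _).comp (rename Subtype.val)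
  have hf : Function.Surjective f := by
    have hr : ∀ p, Ideal.Quotient.mkₐ K (Ideal.span (X '' S)) p ∈ f.range := by
      intro p
      induction p using MvPolynomial.induction_on with
      | C a => exact ⟨C a, by simp [f]⟩
      | add p q hp hq => rw [map_add]; exact add_mem hp hq
      | mul_X p x hp =>
        rw [map_mul]
        refine mul_mem hp ?_
        by_cases hx : x ∈ S
        · have : (Ideal.Quotient.mkₐ K (Ideal.span (X '' S : Set (MvPolynomial σ K)))) (X x) = 0 :=
            Ideal.Quotient.eq_zero_iff_mem.2 (Ideal.subset_span ⟨x, hx, rfl⟩)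
          rw [this]
          exact zero_mem _
        · exact ⟨X ⟨x, hx⟩, by simp [f]⟩
    intro y
    obtain ⟨p, rfl⟩ := Ideal.Quotient.mkₐ_surjective K _ y
    exact hr p
  refine (ringKrullDim_le_of_surjective f.toRingHom hf).trans ?_
  rw [MvPolynomial.ringKrullDim_of_isNoetherianRing, ringKrullDim_eq_zero_of_field, zero_add]

end LinearForms

/-! ### Prime filtrations of monomial ideals -/

section Monomial

variable {K : Type*} [Field K] {σ : Type*}

variable (K) in
/-- The monomial ideal generated by the monomials with exponent vectors in `U`. -/
noncomputable def monIdeal (U : Set (σ →₀ ℕ)) : Ideal (MvPolynomial σ K) :=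
  Ideal.span ((fun u => monomial u (1 : K)) '' U)

theorem mem_monIdeal {U : Set (σ →₀ ℕ)} (hU : IsUpperSet U) {p : MvPolynomial σ K} :
    p ∈ monIdeal K U ↔ ∀ u, coeff u p ≠ 0 → u ∈ U := by
  rw [monIdeal, mem_ideal_span_monomial_image]
  simp only [mem_support_iff]
  exact forall₂_congr fun u _ => ⟨fun ⟨v, hv, h⟩ => hU h hv, fun h => ⟨u, h, le_rfl⟩⟩

theorem monomial_mul_mem_monIdeal {U : Set (σ →₀ ℕ)} (hU : IsUpperSet U) (f : σ →₀ ℕ)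
    (g : MvPolynomial σ K) :
    monomial f 1 * g ∈ monIdeal K U ↔ g ∈ monIdeal K {u | u + f ∈ U} := by
  have hU' : IsUpperSet {u | u + f ∈ U} := fun u v h hu => hU (add_le_add_left h f) hu
  rw [mem_monIdeal hU, mem_monIdeal hU']
  constructor
  · intro h u hu
    refine h (u + f) ?_
    rwa [add_comm u f, coeff_monomial_mul, one_mul]
  · intro h u hu
    rw [coeff_monomial_mul'] at hu
    split_ifs at hu with hfu
    · rw [one_mul] at hu
      have := h _ hu
      rwa [Set.mem_ofPred_eq, tsub_add_cancel_of_le hfu] at this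
    · exact absurd rfl hu

theorem monIdeal_sup_span (U : Set (σ →₀ ℕ)) (f : σ →₀ ℕ) :
    monIdeal K U ⊔ Ideal.span {monomial f 1} = monIdeal K (U ∪ {u | f ≤ u}) := by
  rw [monIdeal, monIdeal, Set.image_union, Ideal.span_union]
  congr 1
  refine le_antisymm (Ideal.span_mono ?_) (Ideal.span_le.2 ?_)
  · rw [Set.singleton_subset_iff]
    exact ⟨f, le_refl f, rfl⟩
  · rintro _ ⟨u, hu, rfl⟩
    rw [SetLike.mem_coe, Ideal.mem_span_singleton]
    refine ⟨monomial (u - f) 1, ?_⟩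
    rw [monomial_mul, one_mul, add_tsub_cancel_of_le hu]

theorem isUpperSet_exists_ne_zero (S : Set σ) : IsUpperSet {u : σ →₀ ℕ | ∃ s ∈ S, u s ≠ 0} := by
  rintro u v h ⟨s, hs, hus⟩
  have := h s
  exact ⟨s, hs, by omega⟩

theorem monIdeal_exists_ne_zero (S : Set σ) :
    monIdeal K {u : σ →₀ ℕ | ∃ s ∈ S, u s ≠ 0} = Ideal.span (X '' S) := by
  ext p
  rw [mem_monIdeal (isUpperSet_exists_ne_zero S), mem_ideal_span_X_image]
  simp only [mem_support_iff]
  rfl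

/-- `PrimeFiltered P U` says that the quotient by the monomial ideal with exponent set `U` is built
up, through extensions `0 → R ⧸ (I : x^f) → R ⧸ I → R ⧸ (I + x^f) → 0`, from quotients by ideals
generated by sets `S` of variables with `P S`. -/
inductive PrimeFiltered (P : Set σ → Prop) : Set (σ →₀ ℕ) → Prop
  | prime (S : Set σ) (hS : P S) : PrimeFiltered P {u | ∃ s ∈ S, u s ≠ 0}
  | split {U : Set (σ →₀ ℕ)} (hU : IsUpperSet U) (f : σ →₀ ℕ)
      (h₁ : PrimeFiltered P {u | u + f ∈ U}) (h₂ : PrimeFiltered P (U ∪ {u | f ≤ u})) :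
      PrimeFiltered P U

/-- Linear forms that stay linearly independent on each piece of a prime filtration form a regular
sequence. -/
theorem PrimeFiltered.weaklyRegularMod [Fintype σ] {P : Set σ → Prop} {U : Set (σ →₀ ℕ)}
    (h : PrimeFiltered P U) {ι : Type*} [DecidableEq ι] (θ : ι → σ → K) (l : List ι)
    (hl : l.Nodup)
    (hP : ∀ S, P S → ∀ c : ι → K, (∀ x, x ∉ S → ∑ i ∈ l.toFinset, c i * θ i x = 0) →
      ∀ i ∈ l, c i = 0) :
    WeaklyRegularMod (monIdeal K U) (l.map fun i => linForm K σ (θ i)) := by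
  induction h with
  | prime S hS =>
    rw [monIdeal_exists_ne_zero, ← linIdeal_coordSubspace]
    refine weaklyRegularMod_linIdeal θ l hl _ fun c hc => hP S hS c fun x hx => ?_
    simpa using hc x hx
  | split hU f _ _ ih₁ ih₂ =>
    rw [← monIdeal_sup_span] at ih₂
    exact WeaklyRegularMod.of_colon_of_sup (fun g => monomial_mul_mem_monIdeal hU f g) ih₁ ih₂

theorem PrimeFiltered.exists_subset_of_isPrime {P : Set σ → Prop} {U : Set (σ →₀ ℕ)}
    (h : PrimeFiltered P U) {Q : Ideal (MvPolynomial σ K)} (hQ : Q.IsPrime)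
    (hUQ : monIdeal K U ≤ Q) : ∃ S, P S ∧ Ideal.span (X '' S) ≤ Q := by
  induction h with
  | prime S hS => exact ⟨S, hS, by rwa [← monIdeal_exists_ne_zero]⟩
  | split hU f _ _ ih₁ ih₂ =>
    by_cases hf : monomial f (1 : K) ∈ Q
    · apply ih₂
      rw [← monIdeal_sup_span]
      exact sup_le hUQ ((Ideal.span_singleton_le_iff_mem _).2 hf)
    · exact ih₁ fun g hg => (hQ.mem_or_mem
        (hUQ ((monomial_mul_mem_monIdeal hU f g).2 hg))).resolve_left hf

theorem PrimeFiltered.ringKrullDim_le [Fintype σ] {P : Set σ → Prop} {U : Set (σ →₀ ℕ)}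
    (h : PrimeFiltered P U) (d : ℕ) (hd : ∀ S, P S → Nat.card (Sᶜ : Set σ) ≤ d) :
    ringKrullDim (MvPolynomial σ K ⧸ monIdeal K U) ≤ d := by
  rw [ringKrullDim_quotient]
  refine iSup_le fun p => ?_
  let q : LTSeries (PrimeSpectrum (MvPolynomial σ K)) :=
    p.map Subtype.val (fun _ _ h => h)
  have hq : monIdeal K U ≤ q.head.asIdeal := p.head.2
  obtain ⟨S, hS, hSq⟩ := h.exists_subset_of_isPrime q.head.isPrime hq
  have h1 : (p.length : WithBot ℕ∞) ≤ (Order.coheight q.head : WithBot ℕ∞) := by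
    have : (q.length : ℕ∞) ≤ Order.coheight q.head := Order.length_le_coheight_head
    exact_mod_cast this
  rw [← ringKrullDim_quotient_eq_coheight] at h1
  refine h1.trans ((ringKrullDim_le_of_surjective (Ideal.Quotient.factor hSq)
    (Ideal.Quotient.factor_surjective hSq)).trans
      ((ringKrullDim_quotient_span_X_image_le S).trans ?_))
  exact_mod_cast hd S hS

end Monomial

/-! ### Squarefree monomial ideals and staircases -/

section Squarefree

variable {σ : Type*}

/-- The exponents of the squarefree monomial ideal generated by the products of the variables in
`F`, for `F ∈ 𝓕`. -/
def sqfree (𝓕 : Set (Finset σ)) : Set (σ →₀ ℕ) := {u | ∃ F ∈ 𝓕, ∀ x ∈ F, u x ≠ 0}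

theorem isUpperSet_sqfree (𝓕 : Set (Finset σ)) : IsUpperSet (sqfree 𝓕) := by
  rintro u v h ⟨F, hF, hu⟩
  refine ⟨F, hF, fun x hx => ?_⟩
  have := h x
  have := hu x hx
  omega

theorem sqfree_subset {𝓕 𝓖 : Set (Finset σ)} (h : ∀ F ∈ 𝓕, ∃ G ∈ 𝓖, G ⊆ F) :
    sqfree 𝓕 ⊆ sqfree 𝓖 := by
  rintro u ⟨F, hF, hu⟩
  obtain ⟨G, hG, hGF⟩ := h F hF
  exact ⟨G, hG, fun x hx => hu x (hGF hx)⟩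

theorem sqfree_union (𝓕 𝓖 : Set (Finset σ)) : sqfree (𝓕 ∪ 𝓖) = sqfree 𝓕 ∪ sqfree 𝓖 := by
  ext u
  simp only [sqfree, Set.mem_union, Set.mem_ofPred_eq, or_and_right, exists_or]

theorem PrimeFiltered.of_singletons {P : Set σ → Prop} {S : Set σ} (hS : P S) :
    PrimeFiltered P (sqfree ((fun x => ({x} : Finset σ)) '' S)) := by
  convert PrimeFiltered.prime S hS using 1
  ext u
  simp [sqfree]

variable [DecidableEq σ]

/-- The exponent vector of the product of the variables in `F`. -/
noncomputable def indExp (F : Finset σ) : σ →₀ ℕ := Finsupp.indicator F fun _ _ => 1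

theorem indExp_apply (F : Finset σ) (x : σ) : indExp F x = if x ∈ F then 1 else 0 := by
  simp [indExp, Finsupp.indicator_apply]

theorem indExp_le_iff {F : Finset σ} {u : σ →₀ ℕ} : indExp F ≤ u ↔ ∀ x ∈ F, u x ≠ 0 := by
  constructor
  · intro h x hx
    have := h x
    rw [indExp_apply, if_pos hx] at this
    omega
  · intro h x
    rw [indExp_apply]
    split_ifs with hx
    · exact Nat.one_le_iff_ne_zero.2 (h x hx)
    · exact Nat.zero_le _

theorem sqfree_insert (F : Finset σ) (𝓕 : Set (Finset σ)) :
    sqfree (insert F 𝓕) = sqfree 𝓕 ∪ {u | indExp F ≤ u} := by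
  rw [Set.insert_eq, Set.union_comm, sqfree_union]
  congr 1
  ext u
  simp [sqfree, indExp_le_iff]

theorem add_indExp_mem_sqfree (F : Finset σ) (𝓕 : Set (Finset σ)) :
    {u | u + indExp F ∈ sqfree 𝓕} = sqfree ((· \ F) '' 𝓕) := by
  ext u
  simp only [sqfree, Set.mem_ofPred_eq, Set.exists_mem_image]
  refine exists_congr fun G => and_congr_right fun _ => forall_congr' fun x => ?_
  rw [Finsupp.add_apply, indExp_apply, Finset.mem_sdiff]
  split_ifs with hx <;> simp [hx]

/-- The splitting step for a squarefree monomial ideal; the two families of generators need only be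
given up to redundant members. -/
theorem PrimeFiltered.split_sqfree {P : Set σ → Prop} {𝓕 𝓖₁ 𝓖₂ : Set (Finset σ)} (F : Finset σ)
    (h₁ : PrimeFiltered P (sqfree 𝓖₁)) (h₂ : PrimeFiltered P (sqfree 𝓖₂))
    (h₁₁ : ∀ G ∈ 𝓕, ∃ H ∈ 𝓖₁, H ⊆ G \ F) (h₁₂ : ∀ H ∈ 𝓖₁, ∃ G ∈ 𝓕, G \ F ⊆ H)
    (h₂₁ : ∀ G ∈ 𝓕, ∃ H ∈ 𝓖₂, H ⊆ G) (h₂₂ : ∃ H ∈ 𝓖₂, H ⊆ F)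
    (h₂₃ : ∀ H ∈ 𝓖₂, (∃ G ∈ 𝓕, G ⊆ H) ∨ F ⊆ H) : PrimeFiltered P (sqfree 𝓕) := by
  refine PrimeFiltered.split (isUpperSet_sqfree 𝓕) (indExp F) ?_ ?_
  · rw [add_indExp_mem_sqfree]
    convert h₁ using 1
    refine (sqfree_subset ?_).antisymm (sqfree_subset ?_)
    · rintro _ ⟨G, hG, rfl⟩
      exact h₁₁ G hG
    · intro H hH
      obtain ⟨G, hG, h⟩ := h₁₂ H hH
      exact ⟨_, ⟨G, hG, rfl⟩, h⟩
  · rw [← sqfree_insert]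
    convert h₂ using 1
    refine (sqfree_subset ?_).antisymm (sqfree_subset ?_)
    · rintro G (rfl | hG)
      · exact h₂₂
      · exact h₂₁ G hG
    · intro H hH
      rcases h₂₃ H hH with ⟨G, hG, h⟩ | h
      · exact ⟨G, Or.inr hG, h⟩
      · exact ⟨F, Or.inl rfl, h⟩

/-- The staircase ideal, generated by the products `A i * B j` with `m ≤ i < j ≤ n` (and a fixed
family `𝓔`), is filtered by the ideals generated by the `A i` with `i < q` and the `B j` with
`q < j`, for `m ≤ q ≤ n`. -/
theorem PrimeFiltered.staircase {P : Set σ → Prop} (A B : ℕ → Finset σ) (𝓔 : Set (Finset σ))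
    {m n : ℕ} (hmn : m ≤ n)
    (hE : ∀ i, m ≤ i → i < n → ∀ E ∈ 𝓔, Disjoint E (A i))
    (hA : ∀ i j, m ≤ i → i < n → m ≤ j → j < n → i ≠ j → Disjoint (A i) (A j))
    (hB : ∀ i j, m ≤ i → i < n → m < j → j ≤ n → Disjoint (B j) (A i))
    (h : ∀ q, m ≤ q → q ≤ n → PrimeFiltered P
      (sqfree (𝓔 ∪ (A '' Set.Ico m q ∪ B '' Set.Ioc q n)))) :
    PrimeFiltered P (sqfree (𝓔 ∪ {F | ∃ i j, m ≤ i ∧ i < j ∧ j ≤ n ∧ F = A i ∪ B j})) := by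
  have key : ∀ q, m ≤ q → q ≤ n → PrimeFiltered P
      (sqfree (𝓔 ∪ (A '' Set.Ico m q ∪ {F | ∃ i j, q ≤ i ∧ i < j ∧ j ≤ n ∧ F = A i ∪ B j}))) := by
    intro q hmq hqn
    revert hmq
    induction hqn using Nat.decreasingInduction with
    | self =>
      intro _
      have h1 := h n hmn le_rfl
      have h2 : {F | ∃ i j, n ≤ i ∧ i < j ∧ j ≤ n ∧ F = A i ∪ B j} = (∅ : Set (Finset σ)) := by
        ext F
        simp only [Set.mem_ofPred_eq, Set.mem_empty_iff_false, iff_false]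
        rintro ⟨i, j, h1, h2, h3, -⟩
        omega
      rw [Set.Ioc_self, Set.image_empty] at h1
      rwa [h2]
    | of_succ q hqn ih =>
      intro hmq
      refine PrimeFiltered.split_sqfree (A q) (h q hmq hqn.le) (ih (by omega)) ?_ ?_ ?_ ?_ ?_
      · rintro G (hG | ⟨i, hi, rfl⟩ | ⟨i, j, hi, hij, hj, rfl⟩)
        · exact ⟨G, Or.inl hG, (sdiff_eq_left.2 (hE q hmq hqn G hG)).ge⟩
        · exact ⟨A i, Or.inr (Or.inl ⟨i, hi, rfl⟩),
            (sdiff_eq_left.2 (hA i q hi.1 (hi.2.trans hqn) hmq hqn hi.2.ne)).ge⟩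
        · refine ⟨B j, Or.inr (Or.inr ⟨j, ⟨by omega, hj⟩, rfl⟩), ?_⟩
          rw [Finset.subset_sdiff]
          exact ⟨Finset.subset_union_right, hB q j hmq hqn (by omega) hj⟩
      · rintro H (hH | ⟨i, hi, rfl⟩ | ⟨j, hj, rfl⟩)
        · exact ⟨H, Or.inl hH, Finset.sdiff_subset⟩
        · exact ⟨_, Or.inr (Or.inl ⟨i, hi, rfl⟩), Finset.sdiff_subset⟩
        · refine ⟨_, Or.inr (Or.inr ⟨q, j, le_rfl, hj.1, hj.2, rfl⟩), ?_⟩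
          rw [Finset.union_sdiff_distrib, Finset.sdiff_self, Finset.empty_union]
          exact Finset.sdiff_subset
      · rintro G (hG | ⟨i, hi, rfl⟩ | ⟨i, j, hi, hij, hj, rfl⟩)
        · exact ⟨G, Or.inl hG, le_rfl⟩
        · exact ⟨_, Or.inr (Or.inl ⟨i, ⟨hi.1, hi.2.trans q.lt_succ_self⟩, rfl⟩), le_rfl⟩
        · rcases hi.eq_or_lt with rfl | hi
          · exact ⟨_, Or.inr (Or.inl ⟨q, ⟨hmq, q.lt_succ_self⟩, rfl⟩), Finset.subset_union_left⟩
          · exact ⟨_, Or.inr (Or.inr ⟨i, j, hi, hij, hj, rfl⟩), le_rfl⟩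
      · exact ⟨_, Or.inr (Or.inl ⟨q, ⟨hmq, q.lt_succ_self⟩, rfl⟩), le_rfl⟩
      · rintro H (hH | ⟨i, hi, rfl⟩ | ⟨i, j, hi, hij, hj, rfl⟩)
        · exact Or.inl ⟨H, Or.inl hH, le_rfl⟩
        · rcases (Nat.lt_succ_iff.1 hi.2).eq_or_lt with rfl | h2
          · exact Or.inr le_rfl
          · exact Or.inl ⟨_, Or.inr (Or.inl ⟨i, ⟨hi.1, h2⟩, rfl⟩), le_rfl⟩
        · exact Or.inl ⟨_, Or.inr (Or.inr ⟨i, j, by omega, hij, hj, rfl⟩), le_rfl⟩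
  convert key m le_rfl hmn using 2
  rw [Set.Ico_self, Set.image_empty, Set.empty_union]

/-- An ideal generated by squarefree monomials in disjoint sets of variables is filtered by the
ideals generated by one variable of each of these sets. -/
theorem PrimeFiltered.of_disjoint_blocks [Nonempty σ] {P : Set σ → Prop} {ι : Type*}
    [DecidableEq ι] (s : Finset ι) (C : ι → Finset σ) (hne : ∀ i ∈ s, (C i).Nonempty)
    (hdisj : ∀ i ∈ s, ∀ j ∈ s, i ≠ j → Disjoint (C i) (C j))
    (h : ∀ f : ι → σ, (∀ i ∈ s, f i ∈ C i) → P (f '' s)) :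
    PrimeFiltered P (sqfree (C '' s)) := by
  induction hn : ∑ i ∈ s, (C i).card using Nat.strong_induction_on generalizing C with
  | _ n ih =>
    by_cases h1 : ∀ i ∈ s, (C i).card = 1
    · have h2 : ∀ i, ∃ x, i ∈ s → C i = {x} := by
        intro i
        by_cases hi : i ∈ s
        · obtain ⟨x, hx⟩ := Finset.card_eq_one.1 (h1 i hi)
          exact ⟨x, fun _ => hx⟩
        · exact ⟨Classical.arbitrary σ, fun h => absurd h hi⟩
      choose f hf using h2
      convert PrimeFiltered.of_singletons (h f fun i hi => by rw [hf i hi]; simp) using 2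
      rw [Set.image_image]
      exact Set.image_congr fun i hi => hf i hi
    · push Not at h1
      obtain ⟨i₀, hi₀, hcard⟩ := h1
      obtain ⟨x, hx⟩ := hne i₀ hi₀
      have hcard' : 1 < (C i₀).card :=
        lt_of_le_of_ne (Finset.card_pos.2 ⟨x, hx⟩) (Ne.symm hcard)
      -- Replacing the block at `i₀` by a smaller one.
      have key : ∀ D : Finset σ, D ⊆ C i₀ → D.Nonempty → D.card < (C i₀).card →
          PrimeFiltered P (sqfree (Function.update C i₀ D '' s)) := by
        intro D hD hDne hDc
        have hsub : ∀ i, Function.update C i₀ D i ⊆ C i := by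
          intro i
          rcases eq_or_ne i i₀ with rfl | hi
          · rwa [Function.update_self]
          · rw [Function.update_of_ne hi]
        refine ih _ ?_ _ (fun i hi => ?_)
          (fun i hi j hj hij => (hdisj i hi j hj hij).mono (hsub i) (hsub j))
          (fun f hf => h f fun i hi => hsub i (hf i hi)) rfl
        · rw [← hn]
          refine Finset.sum_lt_sum (fun i _ => Finset.card_le_card (hsub i)) ⟨i₀, hi₀, ?_⟩
          rwa [Function.update_self]
        · rcases eq_or_ne i i₀ with rfl | hi'
          · rwa [Function.update_self]
          · rw [Function.update_of_ne hi']
            exact hne i hi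
      have hxi : ∀ i ∈ s, i ≠ i₀ → C i \ {x} = C i := fun i hi hii => by
        rw [Finset.sdiff_singleton_eq_erase, Finset.erase_eq_of_notMem]
        exact fun hxi => Finset.disjoint_left.1 (hdisj i hi i₀ hi₀ hii) hxi hx
      refine PrimeFiltered.split_sqfree {x} (key (C i₀ \ {x}) Finset.sdiff_subset ?_ ?_)
        (key {x} (Finset.singleton_subset_iff.2 hx) (Finset.singleton_nonempty x) (by simpa))
        ?_ ?_ ?_ ?_ ?_
      · rw [Finset.sdiff_singleton_eq_erase]
        exact (Finset.one_lt_card_iff_nontrivial.1 hcard').erase_nonempty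
      · rw [Finset.sdiff_singleton_eq_erase]
        exact Finset.card_erase_lt_of_mem hx
      · rintro _ ⟨i, hi, rfl⟩
        refine ⟨_, ⟨i, hi, rfl⟩, ?_⟩
        rcases eq_or_ne i i₀ with rfl | hii
        · rw [Function.update_self]
        · rw [Function.update_of_ne hii, hxi i hi hii]
      · rintro _ ⟨i, hi, rfl⟩
        refine ⟨_, ⟨i, hi, rfl⟩, ?_⟩
        rcases eq_or_ne i i₀ with rfl | hii
        · rw [Function.update_self]
        · rw [Function.update_of_ne hii, hxi i hi hii]
      · rintro _ ⟨i, hi, rfl⟩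
        refine ⟨_, ⟨i, hi, rfl⟩, ?_⟩
        rcases eq_or_ne i i₀ with rfl | hii
        · rwa [Function.update_self, Finset.singleton_subset_iff]
        · rw [Function.update_of_ne hii]
      · exact ⟨_, ⟨i₀, hi₀, rfl⟩, by rw [Function.update_self]⟩
      · rintro _ ⟨i, hi, rfl⟩
        rcases eq_or_ne i i₀ with rfl | hii
        · right
          rw [Function.update_self]
        · exact Or.inl ⟨_, ⟨i, hi, rfl⟩, by rw [Function.update_of_ne hii]⟩

/-- Splitting off variables `x ∈ T` that do not affect the membership in `U` and `W`. -/
theorem PrimeFiltered.union_inter {P : Set σ → Prop} {U W : Set (σ →₀ ℕ)} (hU : IsUpperSet U)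
    (hW : IsUpperSet W) (T : Finset σ)
    (hTU : ∀ x ∈ T, ∀ u, u + Finsupp.single x 1 ∈ U ↔ u ∈ U)
    (hTW : ∀ x ∈ T, ∀ u, u + Finsupp.single x 1 ∈ W ↔ u ∈ W)
    (hT : ∀ x ∈ T, PrimeFiltered P (U ∪ {u | u x ≠ 0})) (h : PrimeFiltered P (U ∪ W)) :
    PrimeFiltered P (U ∪ {u | u ∈ W ∧ ∀ x ∈ T, u x ≠ 0}) := by
  induction T using Finset.induction_on with
  | empty => simpa using h
  | insert x T hx ih =>
    refine PrimeFiltered.split (hU.union ?_) (Finsupp.single x 1) ?_ ?_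
    · rintro u v huv ⟨hu, hu'⟩
      refine ⟨hW huv hu, fun y hy => ?_⟩
      have := huv y
      have := hu' y hy
      omega
    · convert ih (fun y hy => hTU y (Finset.mem_insert_of_mem hy))
        (fun y hy => hTW y (Finset.mem_insert_of_mem hy))
        (fun y hy => hT y (Finset.mem_insert_of_mem hy)) using 1
      ext u
      simp only [Set.mem_ofPred_eq, Set.mem_union, hTU x (Finset.mem_insert_self x T),
        hTW x (Finset.mem_insert_self x T), Finset.forall_mem_insert, Finsupp.add_apply,
        Finsupp.single_eq_same]
      refine or_congr_right (and_congr_right fun _ => ?_)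
      refine ⟨fun h y hy => ?_, fun h => ⟨by omega, fun y hy => ?_⟩⟩
      · have := h.2 y hy
        rwa [Finsupp.single_eq_of_ne (by rintro rfl; exact hx hy), add_zero] at this
      · have := h y hy
        omega
    · convert hT x (Finset.mem_insert_self x T) using 1
      ext u
      simp only [Set.mem_ofPred_eq, Set.mem_union, Finset.forall_mem_insert,
        Finsupp.single_le_iff, Nat.one_le_iff_ne_zero]
      tauto

end Squarefree

/-! ### Initial ideals of toric ideals -/

section Toric

variable {K : Type*} [Field K] {V : Type*} {n : ℕ}

/-- The exponent vector of the image of `x^u` under the toric map whose `i`-th variable goes to the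
monomial with exponent vector `E i`. -/
noncomputable def toricExp (E : Fin n → V →₀ ℕ) : (Fin n →₀ ℕ) →ₗ[ℕ] (V →₀ ℕ) :=
  Finsupp.linearCombination ℕ E

theorem toricExp_single (E : Fin n → V →₀ ℕ) (i : Fin n) :
    toricExp E (Finsupp.single i 1) = E i := by
  simp [toricExp]

theorem toricExp_apply (E : Fin n → V →₀ ℕ) (u : Fin n →₀ ℕ) (v : V) :
    toricExp E u v = ∑ i, u i * E i v := by
  simp [toricExp, Finsupp.linearCombination_apply, Finsupp.sum_fintype, Finsupp.finsetSum_apply]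

theorem toricMap_monomial {G : SimpleGraph V} {e : Fin n ≃ G.edgeSet} {E : Fin n → V →₀ ℕ}
    (hE : ∀ i, edgeMonomial K (e i : Sym2 V) = monomial (E i) 1) (u : Fin n →₀ ℕ) (c : K) :
    (toricMap K G e (monomial u c) : MvPolynomial V K) = monomial (toricExp E u) c := by
  have h : ((edgeRing K G).val.comp (toricMap K G e)) =
      aeval fun i => (monomial (E i) 1 : MvPolynomial V K) := by
    refine MvPolynomial.algHom_ext fun i => ?_
    simp [toricMap, hE]
  have h2 := DFunLike.congr_fun h (monomial u c)
  rw [AlgHom.comp_apply, Subalgebra.val_apply] at h2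
  rw [h2, aeval_monomial, toricExp, Finsupp.linearCombination_apply, Finsupp.prod, Finsupp.sum,
    monomial_sum_index, algebraMap_eq]
  congr 1
  refine Finset.prod_congr rfl fun i _ => ?_
  rw [monomial_pow, one_pow]

/-- The initial ideal of a toric ideal is generated by the monomials that are not the least ones in
their fibres. -/
theorem initialIdeal_toricIdeal {G : SimpleGraph V} {e : Fin n ≃ G.edgeSet} {E : Fin n → V →₀ ℕ}
    (hE : ∀ i, edgeMonomial K (e i : Sym2 V) = monomial (E i) 1) (m : MonomialOrder (Fin n)) :
    initialIdeal m (toricIdeal K G e) =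
      monIdeal K {u | ∃ w, m.toSyn w < m.toSyn u ∧ toricExp E w = toricExp E u} := by
  classical
  refine le_antisymm (Ideal.span_le.2 ?_) (Ideal.span_le.2 ?_)
  · rintro _ ⟨f, hf, hf0, rfl⟩
    refine Ideal.subset_span ⟨m.degree f, ?_, rfl⟩
    by_contra hno
    have h1 : (toricMap K G e f : MvPolynomial V K) = 0 := by
      rw [(RingHom.mem_ker).1 hf]
      rfl
    have h2 : (toricMap K G e f : MvPolynomial V K) =
        ∑ w ∈ f.support, monomial (toricExp E w) (coeff w f) := by
      conv_lhs => rw [f.as_sum, map_sum]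
      rw [AddSubmonoidClass.coe_finsetSum]
      exact Finset.sum_congr rfl fun w _ => toricMap_monomial hE w _
    have h3 := congrArg (coeff (toricExp E (m.degree f))) (h2.symm.trans h1)
    rw [coeff_sum, coeff_zero, Finset.sum_eq_single (m.degree f)] at h3
    · rw [coeff_monomial, if_pos rfl] at h3
      exact (m.leadingCoeff_ne_zero_iff.2 hf0) h3
    · intro w hw hne
      rw [coeff_monomial, if_neg]
      intro heq
      refine hno ⟨w, lt_of_le_of_ne (m.le_degree hw) fun h => hne (m.toSyn.injective h), heq⟩
    · intro h
      exact absurd (m.degree_mem_support hf0) h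
  · rintro _ ⟨u, ⟨w, hlt, heq⟩, rfl⟩
    have hlt' : m.toSyn (m.degree (monomial w (1 : K))) <
        m.toSyn (m.degree (monomial u (1 : K))) := by
      simpa [m.degree_monomial] using hlt
    have hdeg : m.degree (monomial u (1 : K) - monomial w 1) = u := by
      rw [m.degree_sub_of_lt hlt', m.degree_monomial, if_neg one_ne_zero]
    refine Ideal.subset_span ⟨monomial u 1 - monomial w 1, ?_, ?_, ?_⟩
    · rw [toricIdeal, RingHom.mem_ker, map_sub, sub_eq_zero]
      refine Subtype.ext ?_
      change (toricMap K G e (monomial u 1) : MvPolynomial V K) = toricMap K G e (monomial w 1)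
      rw [toricMap_monomial hE, toricMap_monomial hE, heq]
    · intro h0
      rw [sub_eq_zero] at h0
      rw [h0] at hlt'
      exact lt_irrefl _ hlt'
    · dsimp only
      rw [hdeg]

/-- A set `U` of exponents generates the initial ideal as soon as its elements are not the least
ones in their fibres and each fibre has at most one element outside `U`. -/
theorem initialIdeal_toricIdeal_eq_monIdeal {G : SimpleGraph V} {e : Fin n ≃ G.edgeSet}
    {E : Fin n → V →₀ ℕ} (hE : ∀ i, edgeMonomial K (e i : Sym2 V) = monomial (E i) 1)
    (m : MonomialOrder (Fin n)) {U : Set (Fin n →₀ ℕ)}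
    (hU : ∀ u ∈ U, ∃ w, m.toSyn w < m.toSyn u ∧ toricExp E w = toricExp E u)
    (huniq : ∀ u w, u ∉ U → w ∉ U → toricExp E u = toricExp E w → u = w) :
    initialIdeal m (toricIdeal K G e) = monIdeal K U := by
  rw [initialIdeal_toricIdeal hE]
  congr 1
  refine Set.Subset.antisymm ?_ hU
  rintro u ⟨w, hlt, heq⟩
  by_contra hu
  have hwf : WellFounded fun a b : Fin n →₀ ℕ => m.toSyn a < m.toSyn b :=
    InvImage.wf m.toSyn wellFounded_lt
  obtain ⟨w₀, hw₀, hmin⟩ := hwf.has_min {w | toricExp E w = toricExp E u} ⟨u, rfl⟩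
  have h0 : w₀ ∉ U := by
    intro h
    obtain ⟨w', hlt', heq'⟩ := hU w₀ h
    exact hmin w' (heq'.trans hw₀) hlt'
  have := huniq u w₀ hu h0 hw₀.symm
  subst this
  exact hmin w heq hlt

/-- Replacing a divisor `x^g` of `x^u` by a smaller monomial of the same fibre. -/
theorem exists_lt_of_le {E : Fin n → V →₀ ℕ} (m : MonomialOrder (Fin n)) {g g' u : Fin n →₀ ℕ}
    (hu : g ≤ u) (hlt : m.toSyn g' < m.toSyn g) (h : toricExp E g' = toricExp E g) :
    ∃ w, m.toSyn w < m.toSyn u ∧ toricExp E w = toricExp E u := by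
  obtain ⟨r, rfl⟩ := exists_add_of_le hu
  refine ⟨g' + r, ?_, by rw [map_add, map_add, h]⟩
  rw [map_add, map_add]
  exact add_lt_add_left hlt _

end Toric

/-! ### The fibres of the toric map of `G_{k+5}` -/

section Fibre

/-- The variable `x_{m+1}`. Its edge is `a_m` for `m ≤ k` and `b_i` for `m = k + 1 + i`, `i ≤ k`,
where `a_i` and `b_i` are the edges at the vertices `1` and `2`, such that `a_i` and `b_i` have a
common vertex for `0 < i < k`; the edges `c`, `d`, `e` between the other vertices have
`m = 2 * k + 2`, `2 * k + 3`, `2 * k + 4`. -/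
def idx (k m : ℕ) : Fin (2 * k + 5) := Fin.ofNat (2 * k + 5) m

theorem idx_val {k m : ℕ} (hm : m < 2 * k + 5) : (idx k m : ℕ) = m := Nat.mod_eq_of_lt hm

theorem idx_coe {k : ℕ} (i : Fin (2 * k + 5)) : idx k i = i := Fin.ext (idx_val i.2)

theorem idx_inj {k m n : ℕ} (hm : m < 2 * k + 5) (hn : n < 2 * k + 5) :
    idx k m = idx k n ↔ m = n := by
  refine ⟨fun h => ?_, fun h => h ▸ rfl⟩
  rw [← idx_val hm, ← idx_val hn, h]

theorem forall_idx {k : ℕ} {p : Fin (2 * k + 5) → Prop} :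
    (∀ i, p i) ↔ ∀ m, m < 2 * k + 5 → p (idx k m) :=
  ⟨fun h m _ => h _, fun h i => by rw [← idx_coe i]; exact h i i.2⟩

theorem single_idx_apply {k m n : ℕ} (hm : m < 2 * k + 5) (hn : n < 2 * k + 5) :
    (Finsupp.single (idx k m) 1 : Fin (2 * k + 5) →₀ ℕ) (idx k n) = if m = n then 1 else 0 := by
  rw [Finsupp.single_apply]
  exact if_congr (idx_inj hm hn) rfl rfl

/-- The exponent vector of the monomial `t^{e_{i+1}}`. -/
noncomputable def edgeExp (k : ℕ) (i : Fin (2 * k + 5)) : Fin (k + 5) →₀ ℕ :=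
  Finsupp.single (vertex k (ends k (i + 1)).1) 1 + Finsupp.single (vertex k (ends k (i + 1)).2) 1

theorem edgeMonomial_edgeEquiv (K : Type*) [Field K] {k : ℕ} (hk : 1 ≤ k) (i : Fin (2 * k + 5)) :
    edgeMonomial K (edgeEquiv hk i : Sym2 (Fin (k + 5))) = monomial (edgeExp k i) 1 := by
  change edgeMonomial K s(vertex k (ends k (i + 1)).1, vertex k (ends k (i + 1)).2) = _
  rw [edgeMonomial, edgeExp, Sym2.map_mk, Sym2.mul_mk, X, X, monomial_mul, one_mul]

theorem edgeExp_idx {k m : ℕ} (hm : m < 2 * k + 5) :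
    edgeExp k (idx k m) = Finsupp.single (vertex k (ends k (m + 1)).1) 1 +
      Finsupp.single (vertex k (ends k (m + 1)).2) 1 := by
  rw [edgeExp, idx_val hm]

theorem ends_a_zero (k : ℕ) : ends k (0 + 1) = (1, 3) := by simp [ends]

theorem ends_a {k i : ℕ} (h : 1 ≤ i) (hi : i < k) : ends k (i + 1) = (1, i + 4) := by
  unfold ends
  rw [if_neg (by omega), if_pos (by omega)]

theorem ends_a_last {k : ℕ} (hk : 1 ≤ k) : ends k (k + 1) = (1, k + 4) := by
  unfold ends
  rw [if_neg (by omega), if_neg (by omega), if_pos rfl]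

theorem ends_b_zero {k : ℕ} (hk : 1 ≤ k) : ends k (k + 1 + 1) = (2, 4) := by
  unfold ends
  rw [if_neg (by omega), if_neg (by omega), if_neg (by omega), if_pos (by omega)]

theorem ends_b {k i : ℕ} (h : 1 ≤ i) (hi : i < k) : ends k (k + 1 + i + 1) = (2, i + 4) := by
  unfold ends
  rw [if_neg (by omega), if_neg (by omega), if_neg (by omega), if_neg (by omega),
    if_pos (by omega)]
  congr 1
  omega

theorem ends_b_last {k : ℕ} (hk : 1 ≤ k) : ends k (2 * k + 1 + 1) = (2, k + 5) := by
  unfold ends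
  rw [if_neg (by omega), if_neg (by omega), if_neg (by omega), if_neg (by omega),
    if_neg (by omega), if_pos (by omega)]

theorem ends_c {k : ℕ} (hk : 1 ≤ k) : ends k (2 * k + 2 + 1) = (3, 4) := by
  unfold ends
  rw [if_neg (by omega), if_neg (by omega), if_neg (by omega), if_neg (by omega),
    if_neg (by omega), if_neg (by omega), if_pos (by omega)]

theorem ends_d {k : ℕ} (hk : 1 ≤ k) : ends k (2 * k + 3 + 1) = (3, k + 4) := by
  unfold ends
  rw [if_neg (by omega), if_neg (by omega), if_neg (by omega), if_neg (by omega),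
    if_neg (by omega), if_neg (by omega), if_neg (by omega), if_pos (by omega)]

theorem ends_e {k : ℕ} (hk : 1 ≤ k) : ends k (2 * k + 4 + 1) = (4, k + 5) := by
  unfold ends
  rw [if_neg (by omega), if_neg (by omega), if_neg (by omega), if_neg (by omega),
    if_neg (by omega), if_neg (by omega), if_neg (by omega), if_neg (by omega)]

theorem sum_idx {k : ℕ} (hk : 1 ≤ k) (F : Fin (2 * k + 5) → ℕ) :
    ∑ i, F i = F (idx k 0) + ∑ i ∈ Finset.Ico 1 k, F (idx k i) + F (idx k k) +
      (F (idx k (k + 1)) + ∑ i ∈ Finset.Ico 1 k, F (idx k (k + 1 + i)) + F (idx k (2 * k + 1))) +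
      F (idx k (2 * k + 2)) + F (idx k (2 * k + 3)) + F (idx k (2 * k + 4)) := by
  have h1 : ∑ i, F i = ∑ m ∈ Finset.range (2 * k + 5), F (idx k m) := by
    rw [Finset.sum_range]
    exact Finset.sum_congr rfl fun i _ => by rw [idx_coe]
  have h2 : ∀ g : ℕ → ℕ, ∑ m ∈ Finset.range (k + 1), g m =
      g 0 + ∑ i ∈ Finset.Ico 1 k, g i + g k := by
    intro g
    rw [Finset.sum_range_succ, Finset.range_eq_Ico, Finset.sum_eq_sum_Ico_succ_bot hk]
  have h3 : 2 * k + 2 = (k + 1) + (k + 1) := by ring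
  rw [h1, Finset.sum_range_succ, Finset.sum_range_succ, Finset.sum_range_succ]
  conv_lhs => rw [h3, Finset.sum_range_add, h2, h2]
  have h4 : k + 1 + k = 2 * k + 1 := by ring
  rw [h4, ← h3, add_zero]

/-- The degree of a monomial of the fibre at the vertex `v`. -/
theorem toricExp_edgeExp_vertex {k : ℕ} (hk : 1 ≤ k) (u : Fin (2 * k + 5) →₀ ℕ) {v : ℕ}
    (hv : 1 ≤ v) (hv' : v ≤ k + 5) :
    toricExp (edgeExp k) u (vertex k v) = ∑ i : Fin (2 * k + 5), u i *
      ((if (ends k (i + 1)).1 = v then 1 else 0) + if (ends k (i + 1)).2 = v then 1 else 0) := by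
  rw [toricExp_apply]
  refine Finset.sum_congr rfl fun i _ => ?_
  have hb := ends_bounds (k := k) (m := i + 1) hk
  rw [edgeExp, Finsupp.add_apply, Finsupp.single_apply, Finsupp.single_apply]
  congr 2
  · exact if_congr ⟨fun h => vertex_injective (by omega) hv (by omega) hv' h, fun h => h ▸ rfl⟩
      rfl rfl
  · exact if_congr ⟨fun h => vertex_injective (by omega) hv (by omega) hv' h, fun h => h ▸ rfl⟩
      rfl rfl

theorem toricExp_edgeExp_formula {k : ℕ} (hk : 1 ≤ k) (u : Fin (2 * k + 5) →₀ ℕ) {v : ℕ}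
    (hv : 1 ≤ v) (hv' : v ≤ k + 5) :
    toricExp (edgeExp k) u (vertex k v) =
      u (idx k 0) * ((if 1 = v then 1 else 0) + if 3 = v then 1 else 0) +
      ∑ i ∈ Finset.Ico 1 k, u (idx k i) * ((if 1 = v then 1 else 0) + if i + 4 = v then 1 else 0) +
      u (idx k k) * ((if 1 = v then 1 else 0) + if k + 4 = v then 1 else 0) +
      (u (idx k (k + 1)) * ((if 2 = v then 1 else 0) + if 4 = v then 1 else 0) +
      ∑ i ∈ Finset.Ico 1 k,
        u (idx k (k + 1 + i)) * ((if 2 = v then 1 else 0) + if i + 4 = v then 1 else 0) +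
      u (idx k (2 * k + 1)) * ((if 2 = v then 1 else 0) + if k + 5 = v then 1 else 0)) +
      u (idx k (2 * k + 2)) * ((if 3 = v then 1 else 0) + if 4 = v then 1 else 0) +
      u (idx k (2 * k + 3)) * ((if 3 = v then 1 else 0) + if k + 4 = v then 1 else 0) +
      u (idx k (2 * k + 4)) * ((if 4 = v then 1 else 0) + if k + 5 = v then 1 else 0) := by
  rw [toricExp_edgeExp_vertex hk u hv hv', sum_idx hk]
  have hA : ∀ i ∈ Finset.Ico 1 k, u (idx k i) *
      ((if (ends k (idx k i + 1)).1 = v then 1 else 0) +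
        if (ends k (idx k i + 1)).2 = v then 1 else 0) =
      u (idx k i) * ((if 1 = v then 1 else 0) + if i + 4 = v then 1 else 0) := by
    intro i hi
    rw [Finset.mem_Ico] at hi
    rw [idx_val (by omega), ends_a hi.1 hi.2]
  have hB : ∀ i ∈ Finset.Ico 1 k, u (idx k (k + 1 + i)) *
      ((if (ends k (idx k (k + 1 + i) + 1)).1 = v then 1 else 0) +
        if (ends k (idx k (k + 1 + i) + 1)).2 = v then 1 else 0) =
      u (idx k (k + 1 + i)) * ((if 2 = v then 1 else 0) + if i + 4 = v then 1 else 0) := by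
    intro i hi
    rw [Finset.mem_Ico] at hi
    rw [idx_val (by omega), ends_b hi.1 hi.2]
  rw [Finset.sum_congr rfl hA, Finset.sum_congr rfl hB, idx_val (m := 0) (by omega),
    idx_val (m := k) (by omega), idx_val (m := k + 1) (by omega),
    idx_val (m := 2 * k + 1) (by omega), idx_val (m := 2 * k + 2) (by omega),
    idx_val (m := 2 * k + 3) (by omega), idx_val (m := 2 * k + 4) (by omega),
    ends_a_zero, ends_a_last hk, ends_b_zero hk, ends_b_last hk, ends_c hk, ends_d hk, ends_e hk]

end Fibre

section FibreEquations

/-- The equations of a fibre: the degrees at all vertices of the graph. -/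
theorem fibre_equations {k : ℕ} (hk : 1 ≤ k) {u w : Fin (2 * k + 5) →₀ ℕ}
    (h : toricExp (edgeExp k) u = toricExp (edgeExp k) w) :
    (∀ i ∈ Finset.Ico 1 k, u (idx k i) + u (idx k (k + 1 + i)) =
      w (idx k i) + w (idx k (k + 1 + i))) ∧
    (u (idx k 0) + ∑ i ∈ Finset.Ico 1 k, u (idx k i) + u (idx k k) =
      w (idx k 0) + ∑ i ∈ Finset.Ico 1 k, w (idx k i) + w (idx k k)) ∧
    (u (idx k (k + 1)) + ∑ i ∈ Finset.Ico 1 k, u (idx k (k + 1 + i)) + u (idx k (2 * k + 1)) =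
      w (idx k (k + 1)) + ∑ i ∈ Finset.Ico 1 k, w (idx k (k + 1 + i)) + w (idx k (2 * k + 1))) ∧
    (u (idx k 0) + u (idx k (2 * k + 2)) + u (idx k (2 * k + 3)) =
      w (idx k 0) + w (idx k (2 * k + 2)) + w (idx k (2 * k + 3))) ∧
    (u (idx k (k + 1)) + u (idx k (2 * k + 2)) + u (idx k (2 * k + 4)) =
      w (idx k (k + 1)) + w (idx k (2 * k + 2)) + w (idx k (2 * k + 4))) ∧
    (u (idx k k) + u (idx k (2 * k + 3)) = w (idx k k) + w (idx k (2 * k + 3))) ∧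
    (u (idx k (2 * k + 1)) + u (idx k (2 * k + 4)) =
      w (idx k (2 * k + 1)) + w (idx k (2 * k + 4))) := by
  have key : ∀ v, 1 ≤ v → v ≤ k + 5 → toricExp (edgeExp k) u (vertex k v) =
      toricExp (edgeExp k) w (vertex k v) := fun v _ _ => by rw [h]
  have h0 : ∀ (f : ℕ → ℕ) (v : ℕ), (∀ i ∈ Finset.Ico 1 k, i + 4 ≠ v) →
      ∑ i ∈ Finset.Ico 1 k, f i * (if i + 4 = v then 1 else 0) = 0 := fun f v hv =>
    Finset.sum_eq_zero fun i hi => by rw [if_neg (hv i hi), mul_zero]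
  have e : ∀ v, v ≤ 4 ∨ k + 4 ≤ v → ∀ i ∈ Finset.Ico 1 k, i + 4 ≠ v := by
    intro v hv i hi
    rw [Finset.mem_Ico] at hi
    omega
  refine ⟨fun i hi => ?_, ?_, ?_, ?_, ?_, ?_, ?_⟩
  · have hi' := Finset.mem_Ico.1 hi
    have h1 := key (i + 4) (by omega) (by omega)
    rw [toricExp_edgeExp_formula hk u (by omega) (by omega),
      toricExp_edgeExp_formula hk w (by omega) (by omega)] at h1
    have n1 : ¬ (1 = i + 4) := by omega
    have n2 : ¬ (2 = i + 4) := by omega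
    have n3 : ¬ (3 = i + 4) := by omega
    have n4 : ¬ (4 = i + 4) := by omega
    have n5 : ¬ (k + 4 = i + 4) := by omega
    have n6 : ¬ (k + 5 = i + 4) := by omega
    have hi1 : 1 ≤ i := hi'.1
    have hi2 : i < k := hi'.2
    have n7 : k ≠ i := by omega
    have n8 : i ≠ 0 := by omega
    simpa [n1, n2, n3, n4, n5, n6, n7, n8, hi1, hi2] using h1
  · have h1 := key 1 (by omega) (by omega)
    rw [toricExp_edgeExp_formula hk u (by omega) (by omega),
      toricExp_edgeExp_formula hk w (by omega) (by omega)] at h1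
    simpa using h1
  · have h1 := key 2 (by omega) (by omega)
    rw [toricExp_edgeExp_formula hk u (by omega) (by omega),
      toricExp_edgeExp_formula hk w (by omega) (by omega)] at h1
    simpa using h1
  · have h1 := key 3 (by omega) (by omega)
    rw [toricExp_edgeExp_formula hk u (by omega) (by omega),
      toricExp_edgeExp_formula hk w (by omega) (by omega)] at h1
    simpa using h1
  · have h1 := key 4 (by omega) (by omega)
    rw [toricExp_edgeExp_formula hk u (by omega) (by omega),
      toricExp_edgeExp_formula hk w (by omega) (by omega)] at h1
    have n1 : ¬ (1 = 4) := by omega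
    have n2 : ¬ (2 = 4) := by omega
    have n3 : ¬ (3 = 4) := by omega
    have n5 : ¬ (k + 4 = 4) := by omega
    have n6 : ¬ (k + 5 = 4) := by omega
    simp only [n1, n2, n3, n5, n6, if_false, zero_add, h0 _ 4 (e 4 (Or.inl le_rfl))] at h1
    simpa using h1
  · have h1 := key (k + 4) (by omega) (by omega)
    rw [toricExp_edgeExp_formula hk u (by omega) (by omega),
      toricExp_edgeExp_formula hk w (by omega) (by omega)] at h1
    have n1 : ¬ (1 = k + 4) := by omega
    have n2 : ¬ (2 = k + 4) := by omega
    have n3 : ¬ (3 = k + 4) := by omega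
    have n4 : ¬ (4 = k + 4) := by omega
    simp only [n1, n2, n3, n4, if_false, zero_add, h0 _ (k + 4) (e _ (Or.inr le_rfl))] at h1
    simpa using h1
  · have h1 := key (k + 5) (by omega) (by omega)
    rw [toricExp_edgeExp_formula hk u (by omega) (by omega),
      toricExp_edgeExp_formula hk w (by omega) (by omega)] at h1
    have n1 : ¬ (1 = k + 5) := by omega
    have n2 : ¬ (2 = k + 5) := by omega
    have n3 : ¬ (3 = k + 5) := by omega
    have n4 : ¬ (4 = k + 5) := by omega
    simp only [n1, n2, n3, n4, if_false, zero_add,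
      h0 _ (k + 5) (e _ (Or.inr (by omega)))] at h1
    simpa using h1

theorem edgeExp_idx_eq {k m a b : ℕ} (hm : m < 2 * k + 5) (h : ends k (m + 1) = (a, b)) :
    edgeExp k (idx k m) = Finsupp.single (vertex k a) 1 + Finsupp.single (vertex k b) 1 := by
  rw [edgeExp_idx hm, h]

/-- The binomial relations between the edge monomials that generate the toric ideal. -/
theorem edgeExp_relation_stair {k i j : ℕ} (hi : 1 ≤ i) (hi' : i < k) (hj : 1 ≤ j) (hj' : j < k) :
    edgeExp k (idx k j) + edgeExp k (idx k (k + 1 + i)) =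
      edgeExp k (idx k i) + edgeExp k (idx k (k + 1 + j)) := by
  rw [edgeExp_idx_eq (by omega) (ends_a hi hi'), edgeExp_idx_eq (by omega) (ends_a hj hj'),
    edgeExp_idx_eq (by omega) (ends_b hi hi'), edgeExp_idx_eq (by omega) (ends_b hj hj')]
  abel

theorem edgeExp_relation_a {k i : ℕ} (hi : 1 ≤ i) (hi' : i < k) :
    edgeExp k (idx k i) + edgeExp k (idx k (2 * k + 1)) + edgeExp k (idx k (2 * k + 2)) =
      edgeExp k (idx k 0) + edgeExp k (idx k (k + 1 + i)) + edgeExp k (idx k (2 * k + 4)) := by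
  have hk : 1 ≤ k := by omega
  rw [edgeExp_idx_eq (by omega) (ends_a hi hi'), edgeExp_idx_eq (by omega) (ends_b_last hk),
    edgeExp_idx_eq (by omega) (ends_c hk), edgeExp_idx_eq (by omega) (ends_a_zero k),
    edgeExp_idx_eq (by omega) (ends_b hi hi'), edgeExp_idx_eq (by omega) (ends_e hk)]
  abel

theorem edgeExp_relation_b {k i : ℕ} (hi : 1 ≤ i) (hi' : i < k) :
    edgeExp k (idx k (k + 1 + i)) + edgeExp k (idx k k) + edgeExp k (idx k (2 * k + 2)) =
      edgeExp k (idx k i) + edgeExp k (idx k (k + 1)) + edgeExp k (idx k (2 * k + 3)) := by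
  have hk : 1 ≤ k := by omega
  rw [edgeExp_idx_eq (by omega) (ends_a hi hi'), edgeExp_idx_eq (by omega) (ends_a_last hk),
    edgeExp_idx_eq (by omega) (ends_c hk), edgeExp_idx_eq (by omega) (ends_b_zero hk),
    edgeExp_idx_eq (by omega) (ends_b hi hi'), edgeExp_idx_eq (by omega) (ends_d hk)]
  abel

theorem edgeExp_relation_triangles {k : ℕ} (hk : 1 ≤ k) :
    edgeExp k (idx k k) + edgeExp k (idx k (2 * k + 1)) + edgeExp k (idx k (2 * k + 2)) +
        edgeExp k (idx k (2 * k + 2)) =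
      edgeExp k (idx k 0) + edgeExp k (idx k (k + 1)) + edgeExp k (idx k (2 * k + 3)) +
        edgeExp k (idx k (2 * k + 4)) := by
  rw [edgeExp_idx_eq (by omega) (ends_a_last hk), edgeExp_idx_eq (by omega) (ends_b_last hk),
    edgeExp_idx_eq (by omega) (ends_c hk), edgeExp_idx_eq (by omega) (ends_a_zero k),
    edgeExp_idx_eq (by omega) (ends_b_zero hk), edgeExp_idx_eq (by omega) (ends_d hk),
    edgeExp_idx_eq (by omega) (ends_e hk)]
  abel

theorem edgeExp_relation_square {k i j : ℕ} (hi : 1 ≤ i) (hi' : i < k) (hj : 1 ≤ j) (hj' : j < k) :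
    edgeExp k (idx k 0) + edgeExp k (idx k k) + edgeExp k (idx k (k + 1 + i)) +
        edgeExp k (idx k (k + 1 + j)) + edgeExp k (idx k (2 * k + 4)) =
      edgeExp k (idx k i) + edgeExp k (idx k j) + edgeExp k (idx k (k + 1)) +
        edgeExp k (idx k (2 * k + 1)) + edgeExp k (idx k (2 * k + 3)) := by
  have hk : 1 ≤ k := by omega
  rw [edgeExp_idx_eq (by omega) (ends_a_last hk), edgeExp_idx_eq (by omega) (ends_b_last hk),
    edgeExp_idx_eq (by omega) (ends_a hi hi'), edgeExp_idx_eq (by omega) (ends_a hj hj'),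
    edgeExp_idx_eq (by omega) (ends_b hi hi'), edgeExp_idx_eq (by omega) (ends_b hj hj'),
    edgeExp_idx_eq (by omega) (ends_a_zero k),
    edgeExp_idx_eq (by omega) (ends_b_zero hk), edgeExp_idx_eq (by omega) (ends_d hk),
    edgeExp_idx_eq (by omega) (ends_e hk)]
  abel

/-- Two pairs of sequences without a position `i < j` such that `p i` and `q j` are nonzero
coincide, if the sums `p i + q i` and the totals of the first sequences do. -/
theorem eq_of_staircase {k : ℕ} {p q p' q' : ℕ → ℕ}
    (hs : ∀ i ∈ Finset.Ico 1 k, p i + q i = p' i + q' i)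
    (hsum : ∑ i ∈ Finset.Ico 1 k, p i = ∑ i ∈ Finset.Ico 1 k, p' i)
    (h : ∀ i j, 1 ≤ i → i < j → j < k → p i = 0 ∨ q j = 0)
    (h' : ∀ i j, 1 ≤ i → i < j → j < k → p' i = 0 ∨ q' j = 0) :
    ∀ i ∈ Finset.Ico 1 k, p i = p' i := by
  by_cases h1 : ∀ i ∈ Finset.Ico 1 k, p i ≤ p' i
  · exact (Finset.sum_eq_sum_iff_of_le h1).1 hsum
  by_cases h2 : ∀ i ∈ Finset.Ico 1 k, p' i ≤ p i
  · exact fun i hi => ((Finset.sum_eq_sum_iff_of_le h2).1 hsum.symm i hi).symm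
  exfalso
  push Not at h1 h2
  obtain ⟨i, hi, h1⟩ := h1
  obtain ⟨j, hj, h2⟩ := h2
  have hsi := hs i hi
  have hsj := hs j hj
  rw [Finset.mem_Ico] at hi hj
  rcases lt_trichotomy i j with hij | rfl | hij
  · have := h i j hi.1 hij hj.2
    omega
  · omega
  · have := h' j i hj.1 hij hi.2
    omega

/-- An element of a fibre is determined by its coordinates `a_i` with `0 < i < k`, `d` and `e`. -/
theorem eq_of_fibre {k : ℕ} (hk : 1 ≤ k) {u w : Fin (2 * k + 5) →₀ ℕ}
    (h : toricExp (edgeExp k) u = toricExp (edgeExp k) w)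
    (ha : ∀ i ∈ Finset.Ico 1 k, u (idx k i) = w (idx k i))
    (hd : u (idx k (2 * k + 3)) = w (idx k (2 * k + 3)))
    (he : u (idx k (2 * k + 4)) = w (idx k (2 * k + 4))) : u = w := by
  obtain ⟨f1, f2, f3, f4, f5, f6, f7⟩ := fibre_equations hk h
  have hsa := Finset.sum_congr rfl ha
  have hb : ∀ i ∈ Finset.Ico 1 k, u (idx k (k + 1 + i)) = w (idx k (k + 1 + i)) := by
    intro i hi
    have := f1 i hi
    have := ha i hi
    omega
  have hsb := Finset.sum_congr rfl hb
  refine DFunLike.ext _ _ (forall_idx.2 fun m hm => ?_)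
  by_cases h1 : m ∈ Finset.Ico 1 k
  · exact ha m h1
  by_cases h2 : m - (k + 1) ∈ Finset.Ico 1 k
  · have := hb _ h2
    rw [Finset.mem_Ico] at h2
    rwa [show k + 1 + (m - (k + 1)) = m by omega] at this
  rw [Finset.mem_Ico] at h1 h2
  have : m = 0 ∨ m = k ∨ m = k + 1 ∨ m = 2 * k + 1 ∨ m = 2 * k + 2 ∨ m = 2 * k + 3 ∨
    m = 2 * k + 4 := by omega
  rcases this with rfl | rfl | rfl | rfl | rfl | rfl | rfl <;> omega

/-- The difference of two elements of a fibre: if `d` grows by `D` and `e` by `E`, then the total of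
the `a_i`, `0 < i < k`, grows by `D - E`, and so on. -/
theorem fibre_differences {k : ℕ} (hk : 1 ≤ k) {u w : Fin (2 * k + 5) →₀ ℕ}
    (h : toricExp (edgeExp k) u = toricExp (edgeExp k) w) :
    ∃ D E : ℤ, (u (idx k (2 * k + 3)) : ℤ) = w (idx k (2 * k + 3)) + D ∧
      (u (idx k (2 * k + 4)) : ℤ) = w (idx k (2 * k + 4)) + E ∧
      (u (idx k (2 * k + 2)) : ℤ) = w (idx k (2 * k + 2)) - D - E ∧
      (u (idx k 0) : ℤ) = w (idx k 0) + E ∧ (u (idx k (k + 1)) : ℤ) = w (idx k (k + 1)) + D ∧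
      (u (idx k k) : ℤ) = w (idx k k) - D ∧
      (u (idx k (2 * k + 1)) : ℤ) = w (idx k (2 * k + 1)) - E ∧
      ((∑ i ∈ Finset.Ico 1 k, u (idx k i) : ℕ) : ℤ) =
        (∑ i ∈ Finset.Ico 1 k, w (idx k i) : ℕ) + D - E ∧
      ((∑ i ∈ Finset.Ico 1 k, u (idx k (k + 1 + i)) : ℕ) : ℤ) =
        (∑ i ∈ Finset.Ico 1 k, w (idx k (k + 1 + i)) : ℕ) - D + E := by
  obtain ⟨f1, f2, f3, f4, f5, f6, f7⟩ := fibre_equations hk h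
  have hs := Finset.sum_congr rfl f1
  rw [Finset.sum_add_distrib, Finset.sum_add_distrib] at hs
  refine ⟨u (idx k (2 * k + 3)) - w (idx k (2 * k + 3)),
    u (idx k (2 * k + 4)) - w (idx k (2 * k + 4)), ?_⟩
  generalize ∑ i ∈ Finset.Ico 1 k, u (idx k i) = Sa at *
  generalize ∑ i ∈ Finset.Ico 1 k, w (idx k i) = Sa' at *
  generalize ∑ i ∈ Finset.Ico 1 k, u (idx k (k + 1 + i)) = Sb at *
  generalize ∑ i ∈ Finset.Ico 1 k, w (idx k (k + 1 + i)) = Sb' at *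
  refine ⟨?_, ?_, ?_, ?_, ?_, ?_, ?_, ?_, ?_⟩ <;> omega

end FibreEquations

/-! ### The two initial ideals of the toric ideal of `G_{k+5}` -/

section InitialIdeals

theorem lex_lt_of_idx {k n : ℕ} {g g' : Fin (2 * k + 5) →₀ ℕ} (hn : n < 2 * k + 5)
    (heq : ∀ m, m < n → g' (idx k m) = g (idx k m)) (hlt : g' (idx k n) < g (idx k n)) :
    MonomialOrder.lex.toSyn g' < MonomialOrder.lex.toSyn g := by
  rw [MonomialOrder.lex_lt_iff, Finsupp.Lex.lt_iff]
  refine ⟨idx k n, fun j hj => ?_, hlt⟩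
  have hj' : (j : ℕ) < n := by
    have := Fin.lt_def.1 hj
    rwa [idx_val hn] at this
  have := heq j hj'
  rwa [idx_coe] at this

theorem revLex_lt_of_idx {k n : ℕ} {g g' : Fin (2 * k + 5) →₀ ℕ} (hn : n < 2 * k + 5)
    (hdeg : g'.degree = g.degree)
    (heq : ∀ m, n < m → m < 2 * k + 5 → g' (idx k m) = g (idx k m))
    (hlt : g (idx k n) < g' (idx k n)) :
    (revLex (σ := Fin (2 * k + 5))).toSyn g' < revLex.toSyn g := by
  refine toRevLex_lt_iff.2 (Or.inr ⟨hdeg, idx k n, fun j hj => ?_, hlt⟩)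
  have hj' : n < (j : ℕ) := by
    have := Fin.lt_def.1 hj
    rwa [idx_val hn] at this
  have := heq j hj' j.2
  rwa [idx_coe] at this


/-- The exponent vector of the product of the variables with the indices of a list. -/
noncomputable def listExp (k : ℕ) (l : List ℕ) : Fin (2 * k + 5) →₀ ℕ :=
  (l.map fun m => Finsupp.single (idx k m) 1).sum

theorem listExp_apply {k : ℕ} {l : List ℕ} (hl : ∀ m ∈ l, m < 2 * k + 5) {n : ℕ}
    (hn : n < 2 * k + 5) : listExp k l (idx k n) = l.count n := by
  induction l with
  | nil => rfl
  | cons m l ih =>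
    have ih' := ih fun m hm => hl m (by simp [hm])
    rw [listExp] at ih' ⊢
    rw [List.map_cons, List.sum_cons, Finsupp.add_apply, ih',
      single_idx_apply (hl m (by simp)) hn, List.count_cons, add_comm]
    simp

theorem degree_listExp (k : ℕ) (l : List ℕ) : (listExp k l).degree = l.length := by
  induction l with
  | nil => simp [listExp]
  | cons m l ih =>
    rw [listExp] at ih ⊢
    rw [List.map_cons, List.sum_cons, map_add, ih, Finsupp.degree_single, List.length_cons,
      add_comm]

theorem toricExp_listExp (k : ℕ) (l : List ℕ) :
    toricExp (edgeExp k) (listExp k l) = (l.map fun m => edgeExp k (idx k m)).sum := by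
  rw [listExp, map_list_sum, List.map_map]
  congr 1
  refine List.map_congr_left fun m _ => ?_
  exact toricExp_single _ _

theorem exists_lex_lt {k : ℕ} {u : Fin (2 * k + 5) →₀ ℕ} {l l' : List ℕ} (n : ℕ)
    (hl : ∀ m ∈ l, n ≤ m ∧ m < 2 * k + 5) (hl' : ∀ m ∈ l', n < m ∧ m < 2 * k + 5) (hn : n ∈ l)
    (hu : ∀ m, m < 2 * k + 5 → l.count m ≤ u (idx k m))
    (hE : (l'.map fun m => edgeExp k (idx k m)).sum = (l.map fun m => edgeExp k (idx k m)).sum) :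
    ∃ w, MonomialOrder.lex.toSyn w < MonomialOrder.lex.toSyn u ∧
      toricExp (edgeExp k) w = toricExp (edgeExp k) u := by
  refine exists_lt_of_le MonomialOrder.lex (g := listExp k l) (g' := listExp k l')
    (Finsupp.le_def.2 (forall_idx.2 fun m hm => ?_))
    (lex_lt_of_idx (hl n hn).2 (fun m hm => ?_) ?_) ?_
  · rw [listExp_apply (fun m h => (hl m h).2) hm]
    exact hu m hm
  · have hm' := hm.trans (hl n hn).2
    rw [listExp_apply (fun m h => (hl m h).2) hm', listExp_apply (fun m h => (hl' m h).2) hm',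
      List.count_eq_zero_of_not_mem fun h => (hl m h).1.not_gt hm,
      List.count_eq_zero_of_not_mem fun h => (hl' m h).1.not_gt hm]
  · rw [listExp_apply (fun m h => (hl m h).2) (hl n hn).2,
      listExp_apply (fun m h => (hl' m h).2) (hl n hn).2,
      List.count_eq_zero_of_not_mem fun h => lt_irrefl n (hl' n h).1]
    exact List.count_pos_iff.2 hn
  · rw [toricExp_listExp, toricExp_listExp, hE]

theorem exists_revLex_lt {k : ℕ} {u : Fin (2 * k + 5) →₀ ℕ} {l l' : List ℕ} (n : ℕ)
    (hl : ∀ m ∈ l, m < n) (hl' : ∀ m ∈ l', m ≤ n) (hn : n ∈ l') (hn' : n < 2 * k + 5)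
    (hu : ∀ m, m < 2 * k + 5 → l.count m ≤ u (idx k m))
    (hE : (l'.map fun m => edgeExp k (idx k m)).sum = (l.map fun m => edgeExp k (idx k m)).sum)
    (hlen : l'.length = l.length) :
    ∃ w, (revLex (σ := Fin (2 * k + 5))).toSyn w < revLex.toSyn u ∧
      toricExp (edgeExp k) w = toricExp (edgeExp k) u := by
  refine exists_lt_of_le revLex (g := listExp k l) (g' := listExp k l')
    (Finsupp.le_def.2 (forall_idx.2 fun m hm => ?_))
    (revLex_lt_of_idx hn' ?_ (fun m hm hm' => ?_) ?_) ?_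
  · rw [listExp_apply (fun m h => (hl m h).trans hn') hm]
    exact hu m hm
  · rw [degree_listExp, degree_listExp, hlen]
  · rw [listExp_apply (fun m h => (hl m h).trans hn') hm',
      listExp_apply (fun m h => (hl' m h).trans_lt hn') hm',
      List.count_eq_zero_of_not_mem fun h => (hl m h).not_gt hm,
      List.count_eq_zero_of_not_mem fun h => (hl' m h).not_gt hm]
  · rw [listExp_apply (fun m h => (hl m h).trans hn') hn',
      listExp_apply (fun m h => (hl' m h).trans_lt hn') hn',
      List.count_eq_zero_of_not_mem fun h => lt_irrefl n (hl n h)]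
    exact List.count_pos_iff.2 hn
  · rw [toricExp_listExp, toricExp_listExp, hE]

/-- The blocks `A 0 = {a_0, e}` and `A i = {a_i}`, `0 < i < k`, of the staircase of the
lexicographic initial ideal. -/
def lexBlockA (k i : ℕ) : Finset (Fin (2 * k + 5)) :=
  if i = 0 then {idx k 0, idx k (2 * k + 4)} else {idx k i}

/-- The blocks `B j = {b_j}`, `0 < j < k`, and `B k = {b_0, d}` of the staircase of the
lexicographic initial ideal. -/
def lexBlockB (k j : ℕ) : Finset (Fin (2 * k + 5)) :=
  if j = k then {idx k (k + 1), idx k (2 * k + 3)} else {idx k (k + 1 + j)}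

/-- The exponents of the lexicographic initial ideal. -/
def lexExps (k : ℕ) : Set (Fin (2 * k + 5) →₀ ℕ) :=
  sqfree {F | ∃ i j, 0 ≤ i ∧ i < j ∧ j ≤ k ∧ F = lexBlockA k i ∪ lexBlockB k j}

theorem mem_lexExps {k : ℕ} {u : Fin (2 * k + 5) →₀ ℕ} :
    u ∈ lexExps k ↔ ∃ i j, i < j ∧ j ≤ k ∧ (∀ x ∈ lexBlockA k i, u x ≠ 0) ∧
      ∀ x ∈ lexBlockB k j, u x ≠ 0 := by
  simp only [lexExps, sqfree, Set.mem_ofPred_eq]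
  constructor
  · rintro ⟨_, ⟨i, j, -, hij, hj, rfl⟩, h⟩
    exact ⟨i, j, hij, hj, fun x hx => h x (Finset.mem_union_left _ hx),
      fun x hx => h x (Finset.mem_union_right _ hx)⟩
  · rintro ⟨i, j, hij, hj, h1, h2⟩
    exact ⟨_, ⟨i, j, Nat.zero_le i, hij, hj, rfl⟩, fun x hx =>
      (Finset.mem_union.1 hx).elim (h1 x) (h2 x)⟩

theorem forall_mem_lexBlockA {k i : ℕ} {u : Fin (2 * k + 5) →₀ ℕ} :
    (∀ x ∈ lexBlockA k i, u x ≠ 0) ↔ u (idx k i) ≠ 0 ∧ (i = 0 → u (idx k (2 * k + 4)) ≠ 0) := by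
  unfold lexBlockA
  split_ifs with h <;> simp [h]

theorem forall_mem_lexBlockB {k j : ℕ} {u : Fin (2 * k + 5) →₀ ℕ} :
    (∀ x ∈ lexBlockB k j, u x ≠ 0) ↔
      (j ≠ k → u (idx k (k + 1 + j)) ≠ 0) ∧
        (j = k → u (idx k (k + 1)) ≠ 0 ∧ u (idx k (2 * k + 3)) ≠ 0) := by
  unfold lexBlockB
  split_ifs with h <;> simp [h]

theorem exists_lex_lt_of_mem {k : ℕ} (hk : 1 ≤ k) {u : Fin (2 * k + 5) →₀ ℕ} (hu : u ∈ lexExps k) :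
    ∃ w, MonomialOrder.lex.toSyn w < MonomialOrder.lex.toSyn u ∧
      toricExp (edgeExp k) w = toricExp (edgeExp k) u := by
  obtain ⟨i, j, hij, hj, hA, hB⟩ := mem_lexExps.1 hu
  rw [forall_mem_lexBlockA] at hA
  rw [forall_mem_lexBlockB] at hB
  obtain ⟨hA, hA'⟩ := hA
  obtain ⟨hB, hB'⟩ := hB
  rcases Nat.eq_zero_or_pos i with rfl | hi
  · have he := hA' rfl
    rcases eq_or_ne j k with rfl | hjk
    · obtain ⟨hb, hd⟩ := hB' rfl
      refine exists_lex_lt (l := [0, j + 1, 2 * j + 3, 2 * j + 4])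
        (l' := [j, 2 * j + 1, 2 * j + 2, 2 * j + 2]) 0 ?_ ?_ (by simp) ?_ ?_
      · simp; omega
      · simp; omega
      · intro m hm
        simp only [List.count_cons, List.count_nil, beq_iff_eq]
        split_ifs <;> subst_vars <;> omega
      · simpa [add_assoc] using edgeExp_relation_triangles hk
    · have hb := hB hjk
      refine exists_lex_lt (l := [0, k + 1 + j, 2 * k + 4])
        (l' := [j, 2 * k + 1, 2 * k + 2]) 0 ?_ ?_ (by simp) ?_ ?_
      · simp; omega
      · simp; omega
      · intro m hm
        simp only [List.count_cons, List.count_nil, beq_iff_eq]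
        split_ifs <;> subst_vars <;> omega
      · simpa [add_assoc] using edgeExp_relation_a (k := k) (i := j) (by omega) (by omega)
  · rcases eq_or_ne j k with rfl | hjk
    · obtain ⟨hb, hd⟩ := hB' rfl
      refine exists_lex_lt (l := [i, j + 1, 2 * j + 3])
        (l' := [j + 1 + i, j, 2 * j + 2]) i ?_ ?_ (by simp) ?_ ?_
      · simp; omega
      · simp; omega
      · intro m hm
        simp only [List.count_cons, List.count_nil, beq_iff_eq]
        split_ifs <;> subst_vars <;> omega
      · simpa [add_assoc] using edgeExp_relation_b hi hij
    · have hb := hB hjk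
      refine exists_lex_lt (l := [i, k + 1 + j])
        (l' := [j, k + 1 + i]) i ?_ ?_ (by simp) ?_ ?_
      · simp; omega
      · simp; omega
      · intro m hm
        simp only [List.count_cons, List.count_nil, beq_iff_eq]
        split_ifs <;> subst_vars <;> omega
      · simpa [add_assoc] using edgeExp_relation_stair (k := k) (i := i) (j := j) (by omega)
          (by omega) (by omega) (by omega)

theorem le_of_notMem_lexExps {k : ℕ} (hk : 1 ≤ k) {u w : Fin (2 * k + 5) →₀ ℕ}
    (h : toricExp (edgeExp k) u = toricExp (edgeExp k) w) (hu : u ∉ lexExps k) :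
    u (idx k (2 * k + 3)) ≤ w (idx k (2 * k + 3)) ∧
      u (idx k (2 * k + 4)) ≤ w (idx k (2 * k + 4)) := by
  obtain ⟨D, E, hd, he, hc, ha0, hb0, hak, hbk, hsa, hsb⟩ := fibre_differences hk h
  have hno : ∀ i j, i < j → j ≤ k → u (idx k i) ≠ 0 → (i = 0 → u (idx k (2 * k + 4)) ≠ 0) →
      (j ≠ k → u (idx k (k + 1 + j)) ≠ 0) →
      (j = k → u (idx k (k + 1)) ≠ 0 ∧ u (idx k (2 * k + 3)) ≠ 0) → False :=
    fun i j hij hj h1 h2 h3 h4 => hu (mem_lexExps.2 ⟨i, j, hij, hj,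
      forall_mem_lexBlockA.2 ⟨h1, h2⟩, forall_mem_lexBlockB.2 ⟨h3, h4⟩⟩)
  have hD : D ≤ 0 := by
    by_contra hD
    rcases le_or_gt E 0 with hE | hE
    · have hpos : ∑ i ∈ Finset.Ico 1 k, u (idx k i) ≠ 0 := by omega
      obtain ⟨i, hi, hui⟩ := Finset.exists_ne_zero_of_sum_ne_zero hpos
      rw [Finset.mem_Ico] at hi
      exact hno i k hi.2 le_rfl hui (by omega) (by omega) fun _ => by omega
    · exact hno 0 k (by omega) le_rfl (by omega) (by omega) (by omega) fun _ => by omega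
  have hE : E ≤ 0 := by
    by_contra hE
    have hpos : ∑ i ∈ Finset.Ico 1 k, u (idx k (k + 1 + i)) ≠ 0 := by omega
    obtain ⟨j, hj, huj⟩ := Finset.exists_ne_zero_of_sum_ne_zero hpos
    rw [Finset.mem_Ico] at hj
    exact hno 0 j (by omega) hj.2.le (by omega) (by omega) (by omega) (by omega)
  omega

theorem lexExps_unique {k : ℕ} (hk : 1 ≤ k) {u w : Fin (2 * k + 5) →₀ ℕ}
    (hu : u ∉ lexExps k) (hw : w ∉ lexExps k)
    (h : toricExp (edgeExp k) u = toricExp (edgeExp k) w) : u = w := by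
  have hd := le_antisymm (le_of_notMem_lexExps hk h hu).1 (le_of_notMem_lexExps hk h.symm hw).1
  have he := le_antisymm (le_of_notMem_lexExps hk h hu).2 (le_of_notMem_lexExps hk h.symm hw).2
  obtain ⟨D, E, hd', he', -, -, -, -, -, hsa, -⟩ := fibre_differences hk h
  have hstair : ∀ u : Fin (2 * k + 5) →₀ ℕ, u ∉ lexExps k → ∀ i j, 1 ≤ i → i < j → j < k →
      u (idx k i) = 0 ∨ u (idx k (k + 1 + j)) = 0 := by
    intro u hu i j hi hij hj
    by_contra! hne
    exact hu (mem_lexExps.2 ⟨i, j, hij, hj.le, forall_mem_lexBlockA.2 ⟨hne.1, by omega⟩,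
      forall_mem_lexBlockB.2 ⟨fun _ => hne.2, by omega⟩⟩)
  refine eq_of_fibre hk h (eq_of_staircase (p := fun i => u (idx k i))
    (q := fun i => u (idx k (k + 1 + i))) (p' := fun i => w (idx k i))
    (q' := fun i => w (idx k (k + 1 + i))) (fibre_equations hk h).1 ?_ (hstair u hu) (hstair w hw))
    hd he
  omega

theorem initialIdeal_lex (K : Type*) [Field K] {k : ℕ} (hk : 1 ≤ k) :
    initialIdeal MonomialOrder.lex (toricIdeal K (graph k) (edgeEquiv hk)) =
      monIdeal K (lexExps k) :=
  initialIdeal_toricIdeal_eq_monIdeal (edgeMonomial_edgeEquiv K hk) _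
    (fun _ hu => exists_lex_lt_of_mem hk hu) fun _ _ hu hw h => lexExps_unique hk hu hw h

/-- The exponents of the reverse lexicographic initial ideal. Its generators are `a_j b_i` for
`0 < i < j < k`, `a_j b_k c` and `a_k b_i c` for `0 < i, j < k`, `a_k b_k c ^ 2`, and
`a_i a_j b_0 b_k d` for `0 < i ≤ j < k`. -/
def revExps (k : ℕ) : Set (Fin (2 * k + 5) →₀ ℕ) :=
  {u | (∃ i j, 1 ≤ i ∧ i < j ∧ j < k ∧ u (idx k (k + 1 + i)) ≠ 0 ∧ u (idx k j) ≠ 0) ∨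
    (∃ j, 1 ≤ j ∧ j < k ∧ u (idx k (2 * k + 2)) ≠ 0 ∧ u (idx k (2 * k + 1)) ≠ 0 ∧
      u (idx k j) ≠ 0) ∨
    (∃ i, 1 ≤ i ∧ i < k ∧ u (idx k (2 * k + 2)) ≠ 0 ∧ u (idx k k) ≠ 0 ∧
      u (idx k (k + 1 + i)) ≠ 0) ∨
    (2 ≤ u (idx k (2 * k + 2)) ∧ u (idx k k) ≠ 0 ∧ u (idx k (2 * k + 1)) ≠ 0) ∨
    (2 ≤ ∑ i ∈ Finset.Ico 1 k, u (idx k i) ∧ u (idx k (k + 1)) ≠ 0 ∧ u (idx k (2 * k + 1)) ≠ 0 ∧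
      u (idx k (2 * k + 3)) ≠ 0)}

theorem exists_count_le_of_two_le_sum {ι : Type*} [DecidableEq ι] {s : Finset ι} {p : ι → ℕ}
    (h : 2 ≤ ∑ i ∈ s, p i) : ∃ i ∈ s, ∃ j ∈ s, ∀ m, [i, j].count m ≤ p m := by
  obtain ⟨i, hi, hpi⟩ := Finset.exists_ne_zero_of_sum_ne_zero (by omega : ∑ i ∈ s, p i ≠ 0)
  by_cases h2 : 2 ≤ p i
  · refine ⟨i, hi, i, hi, fun m => ?_⟩
    simp only [List.count_cons, List.count_nil, beq_iff_eq]
    split_ifs with hm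
    · subst hm
      omega
    · omega
  · have h3 : ∑ j ∈ s.erase i, p j ≠ 0 := by
      have := Finset.add_sum_erase s p hi
      omega
    obtain ⟨j, hj, hpj⟩ := Finset.exists_ne_zero_of_sum_ne_zero h3
    refine ⟨i, hi, j, Finset.mem_of_mem_erase hj, fun m => ?_⟩
    have hne := Finset.ne_of_mem_erase hj
    simp only [List.count_cons, List.count_nil, beq_iff_eq]
    split_ifs with h1 h2 h2
    · exact absurd (h1.trans h2.symm) hne
    · subst h1
      omega
    · subst h2
      omega
    · omega

theorem exists_revLex_lt_of_two_le_sum {k : ℕ} {u : Fin (2 * k + 5) →₀ ℕ}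
    (hs : 2 ≤ ∑ i ∈ Finset.Ico 1 k, u (idx k i)) (hb0 : u (idx k (k + 1)) ≠ 0)
    (hb : u (idx k (2 * k + 1)) ≠ 0) (hd : u (idx k (2 * k + 3)) ≠ 0) :
    ∃ w, (revLex (σ := Fin (2 * k + 5))).toSyn w < revLex.toSyn u ∧
      toricExp (edgeExp k) w = toricExp (edgeExp k) u := by
  obtain ⟨i, hi, j, hj, hij⟩ := exists_count_le_of_two_le_sum hs
  rw [Finset.mem_Ico] at hi hj
  refine exists_revLex_lt (l := [i, j, k + 1, 2 * k + 1, 2 * k + 3])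
    (l' := [0, k, k + 1 + i, k + 1 + j, 2 * k + 4]) (2 * k + 4) ?_ ?_ (by simp) (by omega) ?_ ?_ rfl
  · simp; omega
  · simp; omega
  · intro m hm
    have := hij m
    simp only [List.count_cons, List.count_nil, beq_iff_eq] at this ⊢
    by_cases h1 : k + 1 = m
    · subst h1
      split_ifs <;> omega
    by_cases h2 : 2 * k + 1 = m
    · subst h2
      split_ifs <;> omega
    by_cases h3 : 2 * k + 3 = m
    · subst h3
      split_ifs <;> omega
    rw [if_neg h1, if_neg h2, if_neg h3]
    omega
  · simpa [add_assoc] using (edgeExp_relation_square (k := k) (i := i) (j := j) hi.1 hi.2 hj.1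
      hj.2)

theorem exists_revLex_lt_of_mem {k : ℕ} (hk : 1 ≤ k) {u : Fin (2 * k + 5) →₀ ℕ}
    (hu : u ∈ revExps k) :
    ∃ w, (revLex (σ := Fin (2 * k + 5))).toSyn w < revLex.toSyn u ∧
      toricExp (edgeExp k) w = toricExp (edgeExp k) u := by
  rcases hu with ⟨i, j, hi, hij, hj, hb, ha⟩ | ⟨j, hj1, hj, hc, hb, ha⟩ | ⟨i, hi1, hi, hc, ha, hb⟩ |
    ⟨hc, ha, hb⟩ | ⟨hs, hb0, hb, hd⟩
  · refine exists_revLex_lt (l := [j, k + 1 + i]) (l' := [i, k + 1 + j]) (k + 1 + j)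
      ?_ ?_ (by simp) (by omega) ?_ ?_ rfl
    · simp; omega
    · simp; omega
    · intro m hm
      simp only [List.count_cons, List.count_nil, beq_iff_eq]
      split_ifs <;> subst_vars <;> omega
    · simpa [add_assoc] using (edgeExp_relation_stair (k := k) (i := i) (j := j) (by omega)
        (by omega) (by omega) (by omega)).symm
  · refine exists_revLex_lt (l := [j, 2 * k + 1, 2 * k + 2]) (l' := [0, k + 1 + j, 2 * k + 4])
      (2 * k + 4) ?_ ?_ (by simp) (by omega) ?_ ?_ rfl
    · simp; omega
    · simp; omega
    · intro m hm
      simp only [List.count_cons, List.count_nil, beq_iff_eq]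
      split_ifs <;> subst_vars <;> omega
    · simpa [add_assoc] using (edgeExp_relation_a (k := k) (i := j) (by omega) (by omega)).symm
  · refine exists_revLex_lt (l := [k + 1 + i, k, 2 * k + 2]) (l' := [i, k + 1, 2 * k + 3])
      (2 * k + 3) ?_ ?_ (by simp) (by omega) ?_ ?_ rfl
    · simp; omega
    · simp; omega
    · intro m hm
      simp only [List.count_cons, List.count_nil, beq_iff_eq]
      split_ifs <;> subst_vars <;> omega
    · simpa [add_assoc] using (edgeExp_relation_b (k := k) (i := i) (by omega) (by omega)).symm
  · refine exists_revLex_lt (l := [k, 2 * k + 1, 2 * k + 2, 2 * k + 2])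
      (l' := [0, k + 1, 2 * k + 3, 2 * k + 4]) (2 * k + 4) ?_ ?_ (by simp) (by omega) ?_ ?_ rfl
    · simp; omega
    · simp; omega
    · intro m hm
      simp only [List.count_cons, List.count_nil, beq_iff_eq]
      split_ifs <;> subst_vars <;> omega
    · simpa [add_assoc] using (edgeExp_relation_triangles hk).symm
  · exact exists_revLex_lt_of_two_le_sum hs hb0 hb hd

theorem le_of_notMem_revExps {k : ℕ} (hk : 1 ≤ k) {u w : Fin (2 * k + 5) →₀ ℕ}
    (h : toricExp (edgeExp k) u = toricExp (edgeExp k) w) (hu : u ∉ revExps k)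
    (hw : w ∉ revExps k) :
    u (idx k (2 * k + 3)) ≤ w (idx k (2 * k + 3)) ∧
      (u (idx k (2 * k + 3)) = w (idx k (2 * k + 3)) →
        u (idx k (2 * k + 4)) ≤ w (idx k (2 * k + 4))) := by
  obtain ⟨D, E, hd, he, hc, ha0, hb0, hak, hbk, hsa, hsb⟩ := fibre_differences hk h
  have hD : D ≤ 0 := by
    by_contra hD
    rcases lt_trichotomy E 0 with hE | rfl | hE
    · exact hu (Or.inr (Or.inr (Or.inr (Or.inr ⟨by omega, by omega, by omega, by omega⟩))))
    · have hpos : ∑ i ∈ Finset.Ico 1 k, w (idx k (k + 1 + i)) ≠ 0 := by omega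
      obtain ⟨i, hi, hwi⟩ := Finset.exists_ne_zero_of_sum_ne_zero hpos
      rw [Finset.mem_Ico] at hi
      exact hw (Or.inr (Or.inr (Or.inl ⟨i, hi.1, hi.2, by omega, by omega, hwi⟩)))
    · exact hw (Or.inr (Or.inr (Or.inr (Or.inl ⟨by omega, by omega, by omega⟩))))
  refine ⟨by omega, fun hd0 => ?_⟩
  by_contra hE
  have hpos : ∑ i ∈ Finset.Ico 1 k, w (idx k i) ≠ 0 := by omega
  obtain ⟨i, hi, hwi⟩ := Finset.exists_ne_zero_of_sum_ne_zero hpos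
  rw [Finset.mem_Ico] at hi
  exact hw (Or.inr (Or.inl ⟨i, hi.1, hi.2, by omega, by omega, hwi⟩))

theorem revExps_unique {k : ℕ} (hk : 1 ≤ k) {u w : Fin (2 * k + 5) →₀ ℕ}
    (hu : u ∉ revExps k) (hw : w ∉ revExps k)
    (h : toricExp (edgeExp k) u = toricExp (edgeExp k) w) : u = w := by
  have h1 := le_of_notMem_revExps hk h hu hw
  have h2 := le_of_notMem_revExps hk h.symm hw hu
  have hd := le_antisymm h1.1 h2.1
  have he := le_antisymm (h1.2 hd) (h2.2 hd.symm)
  obtain ⟨D, E, hd', he', -, -, -, -, -, -, hsb⟩ := fibre_differences hk h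
  have hstair : ∀ u : Fin (2 * k + 5) →₀ ℕ, u ∉ revExps k → ∀ i j, 1 ≤ i → i < j → j < k →
      u (idx k (k + 1 + i)) = 0 ∨ u (idx k j) = 0 := by
    intro u hu i j hi hij hj
    by_contra! hne
    exact hu (Or.inl ⟨i, j, hi, hij, hj, hne.1, hne.2⟩)
  have hf := (fibre_equations hk h).1
  have hb := eq_of_staircase (p := fun i => u (idx k (k + 1 + i)))
    (q := fun i => u (idx k i)) (p' := fun i => w (idx k (k + 1 + i)))
    (q' := fun i => w (idx k i)) (fun i hi => by simpa only [add_comm] using hf i hi) (by omega)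
    (hstair u hu) (hstair w hw)
  refine eq_of_fibre hk h (fun i hi => ?_) hd he
  have := hf i hi
  have := hb i hi
  omega

theorem initialIdeal_revLex (K : Type*) [Field K] {k : ℕ} (hk : 1 ≤ k) :
    initialIdeal revLex (toricIdeal K (graph k) (edgeEquiv hk)) = monIdeal K (revExps k) :=
  initialIdeal_toricIdeal_eq_monIdeal (edgeMonomial_edgeEquiv K hk) _
    (fun _ hu => exists_revLex_lt_of_mem hk hu) fun _ _ hu hw h => revExps_unique hk hu hw h

end InitialIdeals

/-! ### The lexicographic initial ideal is Cohen–Macaulay -/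

section Forms

variable {K : Type*} [Field K] {σ : Type*}

open Classical in
/-- The coefficient vector of the sum of the variables `x` with `r x`. -/
noncomputable def sumForm (K : Type*) [Field K] (r : σ → Prop) : σ → K :=
  fun x => if r x then 1 else 0

/-- Reading off one coefficient of a linear combination of sums of variables, when the other
summands that involve the variable `x` are known to vanish. -/
theorem coeff_eq_zero_of_sum_sumForm {R : ℕ → σ → Prop} {N : ℕ} {c : ℕ → K} {x : σ}
    (h : ∑ i ∈ (List.range N).toFinset, c i * sumForm K (R i) x = 0) {i₀ : ℕ} (hi₀ : i₀ < N)
    (hR : R i₀ x) (h0 : ∀ i, i < N → i ≠ i₀ → R i x → c i = 0) : c i₀ = 0 := by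
  rw [Finset.sum_eq_single i₀] at h
  · simpa [sumForm, hR] using h
  · intro i hi hne
    rw [List.mem_toFinset, List.mem_range] at hi
    by_cases hRi : R i x
    · rw [h0 i hi hne hRi, zero_mul]
    · rw [sumForm, if_neg hRi, mul_zero]
  · intro hn
    exact absurd (by simpa using hi₀) hn

theorem monIdeal_le_idealOfVars {U : Set (σ →₀ ℕ)} (hU : 0 ∉ U) :
    monIdeal K U ≤ idealOfVars σ K := by
  refine Ideal.span_le.2 ?_
  rintro _ ⟨u, hu, rfl⟩
  rw [SetLike.mem_coe, idealOfVars, ← Set.image_univ, mem_ideal_span_X_image]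
  intro m hm
  have hmu : m = u := by simpa using support_monomial_subset hm
  subst hmu
  have hne : m ≠ 0 := fun h => hU (h ▸ hu)
  obtain ⟨x, hx⟩ := Finsupp.ne_iff.1 hne
  exact ⟨x, trivial, hx⟩

end Forms

section Lex

/-- The blocks of the `q`-th complete intersection in the filtration of the staircase. -/
def lexBlock (k q m : ℕ) : Finset (Fin (2 * k + 5)) :=
  if m < q then lexBlockA k m else lexBlockB k (m + 1)

/-- The sets of variables that generate the primes in the filtration of the lexicographic initial
ideal. -/
def lexPiece (k : ℕ) (S : Set (Fin (2 * k + 5))) : Prop :=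
  ∃ q, q ≤ k ∧ ∃ f : ℕ → Fin (2 * k + 5), (∀ m ∈ Finset.range k, f m ∈ lexBlock k q m) ∧
    S = f '' (Finset.range k : Set ℕ)

theorem val_of_mem_lexBlockA {k m : ℕ} (hm : m < k) {x : Fin (2 * k + 5)}
    (hx : x ∈ lexBlockA k m) : (x : ℕ) = m ∨ (m = 0 ∧ (x : ℕ) = 2 * k + 4) := by
  unfold lexBlockA at hx
  split_ifs at hx with h
  · rw [Finset.mem_insert, Finset.mem_singleton] at hx
    rcases hx with rfl | rfl
    · rw [idx_val (by omega)]
      omega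
    · rw [idx_val (by omega)]
      omega
  · rw [Finset.mem_singleton] at hx
    subst hx
    rw [idx_val (by omega)]
    omega

theorem val_of_mem_lexBlockB {k m : ℕ} (hm : m ≤ k) {x : Fin (2 * k + 5)}
    (hx : x ∈ lexBlockB k m) : (m < k ∧ (x : ℕ) = k + 1 + m) ∨
      (m = k ∧ ((x : ℕ) = k + 1 ∨ (x : ℕ) = 2 * k + 3)) := by
  unfold lexBlockB at hx
  split_ifs at hx with h
  · rw [Finset.mem_insert, Finset.mem_singleton] at hx
    rcases hx with rfl | rfl
    · rw [idx_val (by omega)]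
      omega
    · rw [idx_val (by omega)]
      omega
  · rw [Finset.mem_singleton] at hx
    subst hx
    rw [idx_val (by omega)]
    omega

theorem val_of_mem_lexBlock {k q m : ℕ} (hm : m < k) {x : Fin (2 * k + 5)}
    (hx : x ∈ lexBlock k q m) : (m < q ∧ ((x : ℕ) = m ∨ (m = 0 ∧ (x : ℕ) = 2 * k + 4))) ∨
      (q ≤ m ∧ ((m + 1 < k ∧ (x : ℕ) = k + 2 + m) ∨
        (m + 1 = k ∧ ((x : ℕ) = k + 1 ∨ (x : ℕ) = 2 * k + 3)))) := by
  unfold lexBlock at hx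
  split_ifs at hx with h
  · have := val_of_mem_lexBlockA hm hx
    omega
  · have := val_of_mem_lexBlockB (by omega) hx
    omega

theorem lexBlockA_nonempty (k i : ℕ) : (lexBlockA k i).Nonempty := by
  unfold lexBlockA
  split_ifs <;> simp

theorem lexBlockB_nonempty (k i : ℕ) : (lexBlockB k i).Nonempty := by
  unfold lexBlockB
  split_ifs <;> simp

theorem primeFiltered_lexExps (k : ℕ) : PrimeFiltered (lexPiece k) (lexExps k) := by
  have h := PrimeFiltered.staircase (P := lexPiece k) (lexBlockA k) (lexBlockB k) ∅
    (Nat.zero_le k) (by simp) ?_ ?_ ?_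
  · rwa [Set.empty_union] at h
  · intro i j _ hi _ hj hij
    rw [Finset.disjoint_left]
    intro x hx hx'
    have := val_of_mem_lexBlockA hi hx
    have := val_of_mem_lexBlockA hj hx'
    omega
  · intro i j _ hi _ hj
    rw [Finset.disjoint_left]
    intro x hx hx'
    have := val_of_mem_lexBlockB hj hx
    have := val_of_mem_lexBlockA hi hx'
    omega
  · intro q _ hq
    have hset : ∅ ∪ (lexBlockA k '' Set.Ico 0 q ∪ lexBlockB k '' Set.Ioc q k) =
        lexBlock k q '' (Finset.range k : Set ℕ) := by
      rw [Set.empty_union]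
      ext F
      simp only [Set.mem_union, Set.mem_image, Set.mem_Ico, Set.mem_Ioc, Finset.coe_range,
        Set.mem_Iio, lexBlock]
      constructor
      · rintro (⟨i, hi, rfl⟩ | ⟨j, hj, rfl⟩)
        · exact ⟨i, by omega, if_pos hi.2⟩
        · refine ⟨j - 1, by omega, ?_⟩
          rw [if_neg (by omega), Nat.sub_add_cancel (by omega)]
      · rintro ⟨m, hm, rfl⟩
        split_ifs with h
        · exact Or.inl ⟨m, by omega, rfl⟩
        · exact Or.inr ⟨m + 1, by omega, rfl⟩
    rw [hset]
    refine PrimeFiltered.of_disjoint_blocks (Finset.range k) (lexBlock k q) (fun i _ => ?_)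
      (fun i hi j hj hij => ?_) fun f hf => ⟨q, hq, f, hf, rfl⟩
    · unfold lexBlock
      split_ifs
      · exact lexBlockA_nonempty k i
      · exact lexBlockB_nonempty k _
    · rw [Finset.disjoint_left]
      intro x hx hx'
      rw [Finset.mem_range] at hi hj
      have := val_of_mem_lexBlock hi hx
      have := val_of_mem_lexBlock hj hx'
      omega

theorem card_compl_le_of_lexPiece {k : ℕ} {S : Set (Fin (2 * k + 5))} (hS : lexPiece k S) :
    Nat.card (Sᶜ : Set (Fin (2 * k + 5))) ≤ k + 5 := by
  classical
  obtain ⟨q, hq, f, hf, rfl⟩ := hS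
  have hinj : Set.InjOn f (Finset.range k : Set ℕ) := by
    intro m hm n hn hmn
    have h1 := val_of_mem_lexBlock (Finset.mem_range.1 hm) (hf m hm)
    have h2 := val_of_mem_lexBlock (Finset.mem_range.1 hn) (hf n hn)
    rw [hmn] at h1
    rw [Finset.mem_coe, Finset.mem_range] at hm hn
    omega
  have h1 : (f '' (Finset.range k : Set ℕ)).ncard = k := by
    rw [hinj.ncard_image, Set.ncard_coe_finset, Finset.card_range]
  have h2 := Set.ncard_add_ncard_compl (f '' (Finset.range k : Set ℕ))
  rw [h1, Nat.card_eq_fintype_card, Fintype.card_fin] at h2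
  rw [Nat.card_coe_set_eq]
  omega

/-- The variable with index `n` occurs in the `i`-th form of the system of parameters `a_i + b_{i+1}`
(`0 ≤ i < k - 1`), `a_{k-1} + b_0`, `a_0 + e`, `b_0 + d`, `a_k`, `b_k`, `c` for the lexicographic
initial ideal. -/
def lexForm (k i n : ℕ) : Prop :=
  (i < k ∧ (n = i ∨ (i + 1 < k ∧ n = k + 2 + i) ∨ (i + 1 = k ∧ n = k + 1))) ∨
    (i = k ∧ (n = 0 ∨ n = 2 * k + 4)) ∨ (i = k + 1 ∧ (n = k + 1 ∨ n = 2 * k + 3)) ∨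
    (i = k + 2 ∧ n = k) ∨ (i = k + 3 ∧ n = 2 * k + 1) ∨ (i = k + 4 ∧ n = 2 * k + 2)

theorem lexForm_independent {K : Type*} [Field K] {k : ℕ} (hk : 1 ≤ k)
    {S : Set (Fin (2 * k + 5))} (hS : lexPiece k S) (c : ℕ → K)
    (hc : ∀ x, x ∉ S → ∑ i ∈ (List.range (k + 5)).toFinset,
      c i * sumForm K (fun x : Fin (2 * k + 5) => lexForm k i x) x = 0) :
    ∀ i ∈ List.range (k + 5), c i = 0 := by
  obtain ⟨q, hq, f, hf, rfl⟩ := hS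
  have hval := fun m (hm : m < k) => val_of_mem_lexBlock hm (hf m (Finset.mem_range.2 hm))
  -- The coefficient of the variable with index `n`.
  have hread : ∀ n, n < 2 * k + 5 → (∀ m, m < k → (f m : ℕ) ≠ n) → ∀ i₀, i₀ < k + 5 →
      lexForm k i₀ n → (∀ i, i < k + 5 → i ≠ i₀ → lexForm k i n → c i = 0) → c i₀ = 0 := by
    intro n hn hfn i₀ hi₀ hR h0
    have hx : idx k n ∉ f '' (Finset.range k : Set ℕ) := by
      rintro ⟨m, hm, hmn⟩
      have := hfn m (Finset.mem_range.1 hm)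
      rw [hmn, idx_val hn] at this
      exact this rfl
    exact coeff_eq_zero_of_sum_sumForm (hc _ hx) hi₀ (by rwa [idx_val hn])
      (fun i hi hne hRi => h0 i hi hne (by rwa [idx_val hn] at hRi))
  have h1 : ∀ m, m < k → c m = 0 := by
    intro m hm
    rcases lt_or_ge m q with hmq | hmq
    · rcases Nat.lt_or_ge (m + 1) k with hmk | hmk
      · refine hread (k + 2 + m) (by omega) (fun i hi => ?_) m (by omega)
          (by unfold lexForm; omega) (fun i hi hne hR => ?_)
        · have := hval i hi
          omega
        · unfold lexForm at hR
          omega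
      · have hd : c (k + 1) = 0 := by
          refine hread (2 * k + 3) (by omega) (fun i hi => ?_) _ (by omega)
            (by unfold lexForm; omega) (fun i hi hne hR => ?_)
          · have := hval i hi
            omega
          · unfold lexForm at hR
            omega
        refine hread (k + 1) (by omega) (fun i hi => ?_) m (by omega)
          (by unfold lexForm; omega) (fun i hi hne hR => ?_)
        · have := hval i hi
          omega
        · have : i = k + 1 := by
            unfold lexForm at hR
            omega
          rwa [this]
    · rcases Nat.eq_zero_or_pos m with rfl | hm0
      · have he : c k = 0 := by
          refine hread (2 * k + 4) (by omega) (fun i hi => ?_) _ (by omega)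
            (by unfold lexForm; omega) (fun i hi hne hR => ?_)
          · have := hval i hi
            omega
          · unfold lexForm at hR
            omega
        refine hread 0 (by omega) (fun i hi => ?_) 0 (by omega)
          (by unfold lexForm; omega) (fun i hi hne hR => ?_)
        · have := hval i hi
          omega
        · have : i = k := by
            unfold lexForm at hR
            omega
          rwa [this]
      · refine hread m (by omega) (fun i hi => ?_) m (by omega)
          (by unfold lexForm; omega) (fun i hi hne hR => ?_)
        · have := hval i hi
          omega
        · unfold lexForm at hR
          omega
  have h2 : c k = 0 := by
    by_cases h0 : (f 0 : ℕ) = 0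
    · refine hread (2 * k + 4) (by omega) (fun i hi => ?_) _ (by omega)
        (by unfold lexForm; omega) (fun i hi hne hR => ?_)
      · have := hval i hi
        rcases Nat.eq_zero_or_pos i with rfl | hi0 <;> omega
      · unfold lexForm at hR
        omega
    · refine hread 0 (by omega) (fun i hi => ?_) _ (by omega)
        (by unfold lexForm; omega) (fun i hi hne hR => h1 i ?_)
      · have := hval i hi
        rcases Nat.eq_zero_or_pos i with rfl | hi0 <;> omega
      · unfold lexForm at hR
        omega
  have h3 : c (k + 1) = 0 := by
    by_cases h0 : (f (k - 1) : ℕ) = k + 1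
    · refine hread (2 * k + 3) (by omega) (fun i hi => ?_) _ (by omega)
        (by unfold lexForm; omega) (fun i hi hne hR => ?_)
      · have := hval i hi
        rcases eq_or_ne i (k - 1) with rfl | hi0 <;> omega
      · unfold lexForm at hR
        omega
    · refine hread (k + 1) (by omega) (fun i hi => ?_) _ (by omega)
        (by unfold lexForm; omega) (fun i hi hne hR => h1 i ?_)
      · have := hval i hi
        rcases eq_or_ne i (k - 1) with rfl | hi0 <;> omega
      · unfold lexForm at hR
        omega
  have h4 : ∀ i n, (i = k + 2 ∧ n = k) ∨ (i = k + 3 ∧ n = 2 * k + 1) ∨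
      (i = k + 4 ∧ n = 2 * k + 2) → c i = 0 := by
    intro i n hin
    refine hread n (by omega) (fun j hj => ?_) i (by omega) (by unfold lexForm; omega)
      (fun j hj hne hR => ?_)
    · have := hval j hj
      omega
    · unfold lexForm at hR
      omega
  intro i hi
  rw [List.mem_range] at hi
  rcases Nat.lt_or_ge i k with h | h
  · exact h1 i h
  · have : i = k ∨ i = k + 1 ∨ i = k + 2 ∨ i = k + 3 ∨ i = k + 4 := by omega
    rcases this with rfl | rfl | rfl | rfl | rfl
    · exact h2
    · exact h3
    · exact h4 _ k (by omega)
    · exact h4 _ (2 * k + 1) (by omega)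
    · exact h4 _ (2 * k + 2) (by omega)

theorem isCohenMacaulayQuot_lexExps (K : Type*) [Field K] {k : ℕ} (hk : 1 ≤ k) :
    IsCohenMacaulayQuot (monIdeal K (lexExps k)) := by
  have h0 : (0 : Fin (2 * k + 5) →₀ ℕ) ∉ lexExps k := by
    rw [mem_lexExps]
    rintro ⟨i, j, -, -, h, -⟩
    obtain ⟨x, hx⟩ := lexBlockA_nonempty k i
    exact h x hx rfl
  refine isCohenMacaulayQuot_of_weaklyRegularMod (monIdeal_le_idealOfVars h0) ?_
    ((primeFiltered_lexExps k).weaklyRegularMod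
      (fun i => sumForm K fun x : Fin (2 * k + 5) => lexForm k i x) (List.range (k + 5))
      List.nodup_range fun S hS c => lexForm_independent hk hS c) ?_
  · intro r hr
    obtain ⟨i, -, rfl⟩ := List.mem_map.1 hr
    exact linForm_mem_idealOfVars _
  · rw [List.length_map, List.length_range]
    exact (primeFiltered_lexExps k).ringKrullDim_le (k + 5) fun S hS => card_compl_le_of_lexPiece hS

end Lex

/-! ### The depth of the reverse lexicographic initial ideal -/

section Rev

/-- The variable with index `n` occurs in the `i`-th form of the regular sequence `a_0`, `e`,
`b_0 + b_k`, `d + b_k`, `a_1 + b_k`, `a_k + c` for the reverse lexicographic initial ideal. -/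
def revForm (k i n : ℕ) : Prop :=
  (i = 0 ∧ n = 0) ∨ (i = 1 ∧ n = 2 * k + 4) ∨ (i = 2 ∧ (n = k + 1 ∨ n = 2 * k + 1)) ∨
    (i = 3 ∧ (n = 2 * k + 3 ∨ n = 2 * k + 1)) ∨ (i = 4 ∧ (n = 1 ∨ n = 2 * k + 1)) ∨
    (i = 5 ∧ (n = k ∨ n = 2 * k + 2))

/-- The sets of variables for which the six forms stay linearly independent, as far as they occur in
the filtration of the reverse lexicographic initial ideal. -/
def revPiece (k : ℕ) (S : Set (Fin (2 * k + 5))) : Prop :=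
  idx k 0 ∉ S ∧ idx k (2 * k + 4) ∉ S ∧
    ((idx k (k + 1) ∉ S ∧ idx k (2 * k + 3) ∉ S ∧
        ((idx k k ∉ S ∧ idx k (2 * k + 1) ∉ S) ∨
          (idx k (2 * k + 2) ∉ S ∧ (idx k 1 ∉ S ∨ idx k (2 * k + 1) ∉ S)))) ∨
      (2 ≤ k ∧ idx k k ∉ S ∧ idx k 1 ∉ S ∧
        ((idx k (2 * k + 1) ∉ S ∧ (idx k (k + 1) ∉ S ∨ idx k (2 * k + 3) ∉ S)) ∨
          (idx k (k + 1) ∉ S ∧ idx k (2 * k + 3) ∉ S))))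

theorem revForm_independent {K : Type*} [Field K] {k : ℕ} (hk : 1 ≤ k)
    {S : Set (Fin (2 * k + 5))} (hS : revPiece k S) (c : ℕ → K)
    (hc : ∀ x, x ∉ S → ∑ i ∈ (List.range 6).toFinset,
      c i * sumForm K (fun x : Fin (2 * k + 5) => revForm k i x) x = 0) :
    ∀ i ∈ List.range 6, c i = 0 := by
  -- The coefficient of the variable with index `n`.
  have hread : ∀ i₀ n, n < 2 * k + 5 → idx k n ∉ S → i₀ < 6 →
      revForm k i₀ n → (∀ i, i < 6 → i ≠ i₀ → revForm k i n → c i = 0) → c i₀ = 0 := by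
    intro i₀ n hn hx hi₀ hR h0
    exact coeff_eq_zero_of_sum_sumForm (hc _ hx) hi₀ (by rwa [idx_val hn])
      (fun i hi hne hRi => h0 i hi hne (by rwa [idx_val hn] at hRi))
  have r2 : idx k (k + 1) ∉ S → c 2 = 0 := fun h =>
    hread 2 (k + 1) (by omega) h (by omega) (by unfold revForm; omega) fun i hi hne hR => by
      unfold revForm at hR
      omega
  have r3 : idx k (2 * k + 3) ∉ S → c 3 = 0 := fun h =>
    hread 3 (2 * k + 3) (by omega) h (by omega) (by unfold revForm; omega) fun i hi hne hR => by
      unfold revForm at hR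
      omega
  have r5 : idx k (2 * k + 2) ∉ S → c 5 = 0 := fun h =>
    hread 5 (2 * k + 2) (by omega) h (by omega) (by unfold revForm; omega) fun i hi hne hR => by
      unfold revForm at hR
      omega
  have r5' : idx k k ∉ S → 2 ≤ k ∨ c 4 = 0 → c 5 = 0 := fun h h4 =>
    hread 5 k (by omega) h (by omega) (by unfold revForm; omega) fun i hi hne hR => by
      rcases h4 with h4 | h4
      · unfold revForm at hR
        omega
      · have : i = 4 := by
          unfold revForm at hR
          omega
        rwa [this]
  have r4 : idx k 1 ∉ S → 2 ≤ k ∨ c 5 = 0 → c 4 = 0 := fun h h5 =>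
    hread 4 1 (by omega) h (by omega) (by unfold revForm; omega) fun i hi hne hR => by
      rcases h5 with h5 | h5
      · unfold revForm at hR
        omega
      · have : i = 5 := by
          unfold revForm at hR
          omega
        rwa [this]
  have rb : ∀ i, i = 2 ∨ i = 3 ∨ i = 4 → idx k (2 * k + 1) ∉ S →
      (∀ j, j = 2 ∨ j = 3 ∨ j = 4 → j ≠ i → c j = 0) → c i = 0 := fun i hi h hj =>
    hread i (2 * k + 1) (by omega) h (by omega) (by unfold revForm; omega) fun j hj' hne hR =>
      hj j (by unfold revForm at hR; omega) hne
  obtain ⟨h0, h1, h⟩ := hS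
  have c0 : c 0 = 0 :=
    hread 0 0 (by omega) h0 (by omega) (by unfold revForm; omega) fun i hi hne hR => by
      unfold revForm at hR
      omega
  have c1 : c 1 = 0 :=
    hread 1 (2 * k + 4) (by omega) h1 (by omega) (by unfold revForm; omega) fun i hi hne hR => by
      unfold revForm at hR
      omega
  have main : c 2 = 0 ∧ c 3 = 0 ∧ c 4 = 0 ∧ c 5 = 0 := by
    rcases h with ⟨hb, hd, h | ⟨hc5, h⟩⟩ | ⟨hk2, hak, ha1, h⟩
    · have c2 := r2 hb
      have c3 := r3 hd
      have c4 : c 4 = 0 := rb 4 (by omega) h.2 (by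
        rintro j (rfl | rfl | rfl) hj
        exacts [c2, c3, absurd rfl hj])
      exact ⟨c2, c3, c4, r5' h.1 (Or.inr c4)⟩
    · have c2 := r2 hb
      have c3 := r3 hd
      have c5 := r5 hc5
      rcases h with h | h
      · exact ⟨c2, c3, r4 h (Or.inr c5), c5⟩
      · refine ⟨c2, c3, rb 4 (by omega) h ?_, c5⟩
        rintro j (rfl | rfl | rfl) hj
        exacts [c2, c3, absurd rfl hj]
    · have c4 := r4 ha1 (Or.inl hk2)
      have c5 := r5' hak (Or.inl hk2)
      rcases h with ⟨hbk, hb | hd⟩ | ⟨hb, hd⟩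
      · have c2 := r2 hb
        refine ⟨c2, rb 3 (by omega) hbk ?_, c4, c5⟩
        rintro j (rfl | rfl | rfl) hj
        exacts [c2, absurd rfl hj, c4]
      · have c3 := r3 hd
        refine ⟨rb 2 (by omega) hbk ?_, c3, c4, c5⟩
        rintro j (rfl | rfl | rfl) hj
        exacts [absurd rfl hj, c3, c4]
      · exact ⟨r2 hb, r3 hd, c4, c5⟩
  intro i hi
  rw [List.mem_range] at hi
  interval_cases i
  exacts [c0, c1, main.1, main.2.1, main.2.2.1, main.2.2.2]

/-- The blocks `A 0 = {b_k}` and `A i = {b_i}`, `0 < i < k`, of the staircases in the reverse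
lexicographic initial ideal. -/
def revBlockA (k i : ℕ) : Finset (Fin (2 * k + 5)) :=
  {idx k (if i = 0 then 2 * k + 1 else k + 1 + i)}

/-- The blocks `B j = {a_j}`, `0 < j ≤ k`, of the staircases in the reverse lexicographic initial
ideal. -/
def revBlockB (k j : ℕ) : Finset (Fin (2 * k + 5)) := {idx k j}

theorem PrimeFiltered.of_mem_iff {σ : Type*} {P : Set σ → Prop} {U : Set (σ →₀ ℕ)} {S : Set σ}
    (hS : P S) (h : ∀ u, u ∈ U ↔ ∃ s ∈ S, u s ≠ 0) : PrimeFiltered P U := by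
  have : U = {u | ∃ s ∈ S, u s ≠ 0} := Set.ext h
  rw [this]
  exact PrimeFiltered.prime S hS

/-- The filtration of a staircase with the blocks `b_i` and `a_j`, together with a set of
variables `T`. -/
theorem primeFiltered_revStaircase {k m n : ℕ} (T : Set (Fin (2 * k + 5))) (hmn : m ≤ n)
    (hn : n ≤ k) (hT : ∀ x ∈ T, ∀ i, m ≤ i → i < n → x ∉ revBlockA k i)
    (h : ∀ q, m ≤ q → q ≤ n → revPiece k (T ∪ {x | (∃ i, m ≤ i ∧ i < q ∧ x ∈ revBlockA k i) ∨
      ∃ j, q < j ∧ j ≤ n ∧ x ∈ revBlockB k j})) :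
    PrimeFiltered (revPiece k) (sqfree ((fun x => ({x} : Finset (Fin (2 * k + 5)))) '' T ∪
      {F | ∃ i j, m ≤ i ∧ i < j ∧ j ≤ n ∧ F = revBlockA k i ∪ revBlockB k j})) := by
  refine PrimeFiltered.staircase (revBlockA k) (revBlockB k) _ hmn ?_ ?_ ?_ fun q hmq hqn =>
    PrimeFiltered.of_mem_iff (h q hmq hqn) ?_
  · rintro i hi hin _ ⟨x, hx, rfl⟩
    exact Finset.disjoint_singleton_left.2 (hT x hx i hi hin)
  · intro i j _ hi _ hj hij
    rw [revBlockA, revBlockA, Finset.disjoint_singleton, ne_eq, idx_inj] <;> (try split_ifs) <;> omega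
  · intro i j _ hi _ hj
    rw [revBlockA, revBlockB, Finset.disjoint_singleton, ne_eq, idx_inj] <;> (try split_ifs) <;> omega
  · intro u
    simp only [sqfree, Set.mem_ofPred_eq, Set.mem_union, Set.mem_image, Set.mem_Ico, Set.mem_Ioc,
      revBlockA, revBlockB, Finset.mem_singleton]
    constructor
    · rintro ⟨F, ⟨x, hx, rfl⟩ | ⟨i, hi, rfl⟩ | ⟨j, hj, rfl⟩, hF⟩
      · exact ⟨x, Or.inl hx, hF x (Finset.mem_singleton_self x)⟩
      · exact ⟨_, Or.inr (Or.inl ⟨i, hi.1, hi.2, rfl⟩), hF _ (Finset.mem_singleton_self _)⟩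
      · exact ⟨_, Or.inr (Or.inr ⟨j, hj.1, hj.2, rfl⟩), hF _ (Finset.mem_singleton_self _)⟩
    · rintro ⟨x, hx | ⟨i, hi, hi', rfl⟩ | ⟨j, hj, hj', rfl⟩, hux⟩
      · exact ⟨_, Or.inl ⟨x, hx, rfl⟩, by simpa using hux⟩
      · exact ⟨_, Or.inr (Or.inl ⟨i, ⟨hi, hi'⟩, rfl⟩), by simpa using hux⟩
      · exact ⟨_, Or.inr (Or.inr ⟨j, ⟨hj, hj'⟩, rfl⟩), by simpa using hux⟩

theorem add_single_idx_apply {k m n : ℕ} (hm : m < 2 * k + 5) (hn : n < 2 * k + 5)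
    (u : Fin (2 * k + 5) →₀ ℕ) :
    (u + Finsupp.single (idx k m) 1 : Fin (2 * k + 5) →₀ ℕ) (idx k n) = u (idx k n) + if m = n then 1 else 0 := by
  rw [Finsupp.add_apply, single_idx_apply hm hn]

/-- The exponents of the ideal of the products `b_i a_j`, `0 < i < j < k`. -/
def stairExps (k : ℕ) : Set (Fin (2 * k + 5) →₀ ℕ) :=
  {u | ∃ i j, 1 ≤ i ∧ i < j ∧ j < k ∧ u (idx k (k + 1 + i)) ≠ 0 ∧ u (idx k j) ≠ 0}

theorem isUpperSet_stairExps (k : ℕ) : IsUpperSet (stairExps k) := by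
  rintro u v h ⟨i, j, hi, hij, hj, h1, h2⟩
  have := h (idx k (k + 1 + i))
  have := h (idx k j)
  exact ⟨i, j, hi, hij, hj, by omega, by omega⟩

theorem isUpperSet_ne_zero {σ : Type*} (x : σ) : IsUpperSet {u : σ →₀ ℕ | u x ≠ 0} := by
  intro u v h hu
  have := h x
  rw [Set.mem_ofPred_eq] at hu ⊢
  omega

/-- The exponents of the square of the ideal `(a_i : 0 < i < k)`. -/
def squareExps (k : ℕ) : Set (Fin (2 * k + 5) →₀ ℕ) :=
  {u | 2 ≤ ∑ i ∈ Finset.Ico 1 k, u (idx k i)}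

theorem isUpperSet_squareExps (k : ℕ) : IsUpperSet (squareExps k) := by
  intro u v h hu
  exact le_trans hu (Finset.sum_le_sum fun i _ => h (idx k i))

theorem sum_add_single {k m : ℕ} (hm : m < 2 * k + 5) (u : Fin (2 * k + 5) →₀ ℕ) :
    ∑ i ∈ Finset.Ico 1 k, (u + Finsupp.single (idx k m) 1 : Fin (2 * k + 5) →₀ ℕ) (idx k i) =
      ∑ i ∈ Finset.Ico 1 k, u (idx k i) + if m ∈ Finset.Ico 1 k then 1 else 0 := by
  have : ∀ i ∈ Finset.Ico 1 k,
      (u + Finsupp.single (idx k m) 1 : Fin (2 * k + 5) →₀ ℕ) (idx k i) =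
      u (idx k i) + if m = i then 1 else 0 := by
    intro i hi
    rw [Finset.mem_Ico] at hi
    exact add_single_idx_apply hm (by omega) u
  rw [Finset.sum_congr rfl this, Finset.sum_add_distrib, Finset.sum_ite_eq]

/-- The filtration of the ideal `(c, b_i a_j, a_i a_j)`. -/
theorem primeFiltered_square {k : ℕ} (hk : 1 ≤ k) : PrimeFiltered (revPiece k)
    ((stairExps k ∪ {u | u (idx k (2 * k + 2)) ≠ 0}) ∪ squareExps k) := by
  have hpiece : ∀ q, q ≤ k → revPiece k ({x | x = idx k (2 * k + 2) ∨
      (∃ i, 1 ≤ i ∧ i < q ∧ x = idx k (k + 1 + i)) ∨ ∃ j, 1 ≤ j ∧ j < k ∧ x = idx k j}) := by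
    intro q hq
    have hn : ∀ n, n < 2 * k + 5 → n = 0 ∨ n = 2 * k + 4 ∨ n = k + 1 ∨ n = 2 * k + 3 ∨ n = k ∨
        n = 2 * k + 1 → idx k n ∉ ({x | x = idx k (2 * k + 2) ∨
      (∃ i, 1 ≤ i ∧ i < q ∧ x = idx k (k + 1 + i)) ∨ ∃ j, 1 ≤ j ∧ j < k ∧ x = idx k j}) := by
      rintro n hn hn' (h | ⟨i, hi, hi', h⟩ | ⟨j, hj, hj', h⟩)
      · rw [idx_inj hn (by omega)] at h
        omega
      · rw [idx_inj hn (by omega)] at h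
        omega
      · rw [idx_inj hn (by omega)] at h
        omega
    exact ⟨hn _ (by omega) (by omega), hn _ (by omega) (by omega), Or.inl
      ⟨hn _ (by omega) (by omega), hn _ (by omega) (by omega), Or.inl
        ⟨hn _ (by omega) (by omega), hn _ (by omega) (by omega)⟩⟩⟩
  -- Adding the variables `a_1, a_2, …` one after the other.
  have key : ∀ q, 1 ≤ q → q ≤ k → PrimeFiltered (revPiece k)
      (((stairExps k ∪ {u | u (idx k (2 * k + 2)) ≠ 0}) ∪ squareExps k) ∪
        {u | ∃ i, 1 ≤ i ∧ i < q ∧ u (idx k i) ≠ 0}) := by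
    intro q hq1 hqk
    revert hq1
    induction hqk using Nat.decreasingInduction with
    | self =>
      intro _
      refine PrimeFiltered.of_mem_iff (hpiece 0 (by omega)) fun u => ?_
      constructor
      · rintro (((⟨i, j, hi, hij, hj, -, h⟩ | h) | h) | ⟨i, hi, hi', h⟩)
        · exact ⟨_, Or.inr (Or.inr ⟨j, by omega, hj, rfl⟩), h⟩
        · exact ⟨_, Or.inl rfl, h⟩
        · have hpos : ∑ i ∈ Finset.Ico 1 k, u (idx k i) ≠ 0 := by
            have : 2 ≤ ∑ i ∈ Finset.Ico 1 k, u (idx k i) := h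
            omega
          obtain ⟨i, hi, hui⟩ := Finset.exists_ne_zero_of_sum_ne_zero hpos
          rw [Finset.mem_Ico] at hi
          exact ⟨_, Or.inr (Or.inr ⟨i, hi.1, hi.2, rfl⟩), hui⟩
        · exact ⟨_, Or.inr (Or.inr ⟨i, hi, hi', rfl⟩), h⟩
      · rintro ⟨_, rfl | ⟨i, hi, hi', rfl⟩ | ⟨j, hj, hj', rfl⟩, h⟩
        · exact Or.inl (Or.inl (Or.inr h))
        · omega
        · exact Or.inr ⟨j, hj, hj', h⟩
    | of_succ q hqk ih =>
      intro hq1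
      refine PrimeFiltered.split ?_ (Finsupp.single (idx k q) 1) ?_ ?_
      · refine (((isUpperSet_stairExps k).union (isUpperSet_ne_zero _)).union
          (isUpperSet_squareExps k)).union ?_
        rintro u v h ⟨i, hi, hi', hu⟩
        have := h (idx k i)
        exact ⟨i, hi, hi', by omega⟩
      · refine PrimeFiltered.of_mem_iff (hpiece q hqk.le) fun u => ?_
        have hv := fun n (hn : n < 2 * k + 5) =>
          add_single_idx_apply (k := k) (m := q) (by omega) hn u
        constructor
        · rintro (((⟨i, j, hi, hij, hj, h1, h2⟩ | h) | h) | ⟨i, hi, hi', h⟩)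
          · rw [hv _ (by omega), if_neg (by omega)] at h1
            rw [hv _ (by omega)] at h2
            by_cases hqj : q = j
            · subst hqj
              exact ⟨_, Or.inr (Or.inl ⟨i, hi, hij, rfl⟩), h1⟩
            · rw [if_neg hqj] at h2
              exact ⟨_, Or.inr (Or.inr ⟨j, by omega, hj, rfl⟩), h2⟩
          · rw [Set.mem_ofPred_eq, hv _ (by omega), if_neg (by omega)] at h
            exact ⟨_, Or.inl rfl, h⟩
          · rw [squareExps, Set.mem_ofPred_eq, sum_add_single (by omega),
              if_pos (Finset.mem_Ico.2 ⟨hq1, hqk⟩)] at h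
            obtain ⟨i, hi, hui⟩ := Finset.exists_ne_zero_of_sum_ne_zero
              (by omega : ∑ i ∈ Finset.Ico 1 k, u (idx k i) ≠ 0)
            rw [Finset.mem_Ico] at hi
            exact ⟨_, Or.inr (Or.inr ⟨i, hi.1, hi.2, rfl⟩), hui⟩
          · rw [hv _ (by omega), if_neg (by omega)] at h
            exact ⟨_, Or.inr (Or.inr ⟨i, hi, by omega, rfl⟩), h⟩
        · rintro ⟨_, rfl | ⟨i, hi, hi', rfl⟩ | ⟨j, hj, hj', rfl⟩, h⟩
          · refine Or.inl (Or.inl (Or.inr ?_))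
            rw [Set.mem_ofPred_eq, hv _ (by omega)]
            omega
          · refine Or.inl (Or.inl (Or.inl ⟨i, q, hi, hi', hqk, ?_, ?_⟩))
            · rw [hv _ (by omega)]
              omega
            · rw [hv _ (by omega), if_pos rfl]
              omega
          · refine Or.inl (Or.inr ?_)
            rw [squareExps, Set.mem_ofPred_eq, sum_add_single (by omega),
              if_pos (Finset.mem_Ico.2 ⟨hq1, hqk⟩)]
            have := Finset.single_le_sum (f := fun i => u (idx k i)) (fun i _ => Nat.zero_le _)
              (Finset.mem_Ico.2 ⟨hj, hj'⟩)
            omega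
      · convert ih (by omega) using 1
        rw [Set.union_assoc]
        congr 1
        ext u
        simp only [Set.mem_union, Set.mem_ofPred_eq, Finsupp.single_le_iff,
          Nat.one_le_iff_ne_zero]
        constructor
        · rintro (⟨i, hi, hi', h⟩ | h)
          · exact ⟨i, by omega, by omega, h⟩
          · exact ⟨q, by omega, by omega, h⟩
        · rintro ⟨i, hi, hi', h⟩
          rcases (Nat.lt_succ_iff.1 hi').eq_or_lt with rfl | hlt
          · exact Or.inr h
          · exact Or.inl ⟨i, hi, hlt, h⟩
  convert key 1 le_rfl hk using 1
  ext u
  simp only [Set.mem_union, Set.mem_ofPred_eq]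
  refine ⟨Or.inl, fun h => h.resolve_right ?_⟩
  rintro ⟨i, h1, h2, -⟩
  omega

/-- The filtration of the ideal `(x, c, b_i a_j)` for one of the variables `x = b_0, b_k, d`. -/
theorem primeFiltered_stair_var {k n : ℕ} (hk : 2 ≤ k)
    (hn : n = k + 1 ∨ n = 2 * k + 1 ∨ n = 2 * k + 3) : PrimeFiltered (revPiece k)
    ((stairExps k ∪ {u | u (idx k (2 * k + 2)) ≠ 0}) ∪ {u | u (idx k n) ≠ 0}) := by
  have h := primeFiltered_revStaircase (k := k) (m := 1) (n := k - 1)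
    {idx k (2 * k + 2), idx k n} (by omega) (by omega) ?_ ?_
  · convert h using 1
    ext u
    simp only [sqfree, stairExps, Set.mem_union, Set.mem_ofPred_eq, Set.image_insert_eq,
      Set.image_singleton, Set.mem_insert_iff, Set.mem_singleton_iff, revBlockA, revBlockB]
    constructor
    · rintro ((⟨i, j, hi, hij, hj, h1, h2⟩ | h) | h)
      · refine ⟨_, Or.inr ⟨i, j, hi, hij, by omega, rfl⟩, ?_⟩
        simp only [Finset.mem_union, Finset.mem_singleton]
        rintro x (rfl | rfl)
        · rwa [if_neg (by omega)]
        · exact h2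
      · exact ⟨_, Or.inl (Or.inl rfl), by simpa using h⟩
      · exact ⟨_, Or.inl (Or.inr rfl), by simpa using h⟩
    · rintro ⟨_, (rfl | rfl) | ⟨i, j, hi, hij, hj, rfl⟩, h⟩
      · exact Or.inl (Or.inr (h _ (Finset.mem_singleton_self _)))
      · exact Or.inr (h _ (Finset.mem_singleton_self _))
      · refine Or.inl (Or.inl ⟨i, j, hi, hij, by omega, ?_, h _ (by simp)⟩)
        have := h (idx k (if i = 0 then 2 * k + 1 else k + 1 + i)) (by simp)
        rwa [if_neg (by omega)] at this
  · rintro x (rfl | rfl) i hi hi'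
    · rw [revBlockA, Finset.mem_singleton, if_neg (by omega), idx_inj (by omega) (by omega)]
      omega
    · rw [revBlockA, Finset.mem_singleton, if_neg (by omega), idx_inj (by omega) (by omega)]
      omega
  · intro q hq1 hq
    have hnot : ∀ m, m < 2 * k + 5 → m ≠ n → m ≤ 1 ∨ m = k ∨ m = k + 1 ∨ m = 2 * k + 1 ∨
        2 * k + 3 ≤ m → idx k m ∉ ({idx k (2 * k + 2), idx k n} : Set (Fin (2 * k + 5))) ∪
          {x | (∃ i, 1 ≤ i ∧ i < q ∧ x ∈ revBlockA k i) ∨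
            ∃ j, q < j ∧ j ≤ k - 1 ∧ x ∈ revBlockB k j} := by
      rintro m hm hmn hm' ((h | h) | ⟨i, hi, hi', h⟩ | ⟨j, hj, hj', h⟩)
      · rw [idx_inj hm (by omega)] at h
        omega
      · rw [Set.mem_singleton_iff, idx_inj hm (by omega)] at h
        omega
      · rw [revBlockA, Finset.mem_singleton, if_neg (by omega), idx_inj hm (by omega)] at h
        omega
      · rw [revBlockB, Finset.mem_singleton, idx_inj hm (by omega)] at h
        omega
    refine ⟨hnot _ (by omega) (by omega) (by omega), hnot _ (by omega) (by omega) (by omega),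
      Or.inr ⟨hk, hnot _ (by omega) (by omega) (by omega),
        hnot _ (by omega) (by omega) (by omega), ?_⟩⟩
    rcases hn with rfl | rfl | rfl
    · exact Or.inl ⟨hnot _ (by omega) (by omega) (by omega),
        Or.inr (hnot _ (by omega) (by omega) (by omega))⟩
    · exact Or.inr ⟨hnot _ (by omega) (by omega) (by omega),
        hnot _ (by omega) (by omega) (by omega)⟩
    · exact Or.inl ⟨hnot _ (by omega) (by omega) (by omega),
        Or.inl (hnot _ (by omega) (by omega) (by omega))⟩

/-- The filtration of the sum of the reverse lexicographic initial ideal and `(c)`. -/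
theorem primeFiltered_revExps_sup {k : ℕ} (hk : 1 ≤ k) : PrimeFiltered (revPiece k)
    ((stairExps k ∪ {u | u (idx k (2 * k + 2)) ≠ 0}) ∪ {u | u ∈ squareExps k ∧
      ∀ x ∈ ({idx k (k + 1), idx k (2 * k + 1), idx k (2 * k + 3)} : Finset _), u x ≠ 0}) := by
  rcases hk.eq_or_lt with rfl | hk2
  · -- For `k = 1` the ideal is `(c)`.
    refine PrimeFiltered.of_mem_iff (S := {idx 1 4}) ?_ fun u => ?_
    · have hnot : ∀ m, m < 2 * 1 + 5 → m ≠ 4 → idx 1 m ∉ ({idx 1 4} : Set (Fin (2 * 1 + 5))) := by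
        intro m hm hm' h
        rw [Set.mem_singleton_iff, idx_inj hm (by omega)] at h
        exact hm' h
      exact ⟨hnot _ (by omega) (by omega), hnot _ (by omega) (by omega),
        Or.inl ⟨hnot _ (by omega) (by omega), hnot _ (by omega) (by omega),
          Or.inl ⟨hnot _ (by omega) (by omega), hnot _ (by omega) (by omega)⟩⟩⟩
    · constructor
      · rintro ((⟨i, j, hi, hij, hj, -⟩ | h) | ⟨h, -⟩)
        · omega
        · exact ⟨_, rfl, h⟩
        · rw [squareExps, Set.mem_ofPred_eq, Finset.Ico_self, Finset.sum_empty] at h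
          omega
      · rintro ⟨_, rfl, h⟩
        exact Or.inl (Or.inr h)
  · have hT : ∀ x ∈ ({idx k (k + 1), idx k (2 * k + 1), idx k (2 * k + 3)} :
        Finset (Fin (2 * k + 5))),
        ∃ n, (n = k + 1 ∨ n = 2 * k + 1 ∨ n = 2 * k + 3) ∧ x = idx k n := by
      intro x hx
      simp only [Finset.mem_insert, Finset.mem_singleton] at hx
      rcases hx with rfl | rfl | rfl
      exacts [⟨_, Or.inl rfl, rfl⟩, ⟨_, Or.inr (Or.inl rfl), rfl⟩, ⟨_, Or.inr (Or.inr rfl), rfl⟩]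
    refine PrimeFiltered.union_inter
      ((isUpperSet_stairExps k).union (isUpperSet_ne_zero _)) (isUpperSet_squareExps k) _ ?_ ?_ ?_
      (primeFiltered_square hk)
    · intro x hx u
      obtain ⟨n, hn, rfl⟩ := hT x hx
      have hv := fun l (hl : l < 2 * k + 5) (hne : n ≠ l) =>
        (add_single_idx_apply (k := k) (m := n) (by omega) hl u).trans
          (by rw [if_neg hne, add_zero])
      refine or_congr ?_ ?_
      · refine exists_congr fun i => exists_congr fun j => and_congr_right fun hi =>
          and_congr_right fun hij => and_congr_right fun hj => ?_
        rw [hv _ (by omega) (by omega), hv _ (by omega) (by omega)]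
      · rw [Set.mem_ofPred_eq, Set.mem_ofPred_eq, hv _ (by omega) (by omega)]
    · intro x hx u
      obtain ⟨n, hn, rfl⟩ := hT x hx
      rw [squareExps, Set.mem_ofPred_eq, Set.mem_ofPred_eq, sum_add_single (by omega),
        if_neg (by rw [Finset.mem_Ico]; omega), add_zero]
    · intro x hx
      obtain ⟨n, hn, rfl⟩ := hT x hx
      exact primeFiltered_stair_var hk2 hn

/-- The generators of the colon ideal of the reverse lexicographic initial ideal by `c`. -/
def revColon (k : ℕ) : Set (Finset (Fin (2 * k + 5))) :=
  insert {idx k k, idx k (2 * k + 1), idx k (2 * k + 2)}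
    {F | ∃ i j, i < j ∧ j ≤ k ∧ ¬ (i = 0 ∧ j = k) ∧ F = revBlockA k i ∪ revBlockB k j}

/-- The variables that generate the associated prime of dimension six. -/
def deepPrime (k : ℕ) : Set (Fin (2 * k + 5)) :=
  {x | x = idx k (2 * k + 2) ∨ ∃ i, 1 ≤ i ∧ i < k ∧ (x = idx k i ∨ x = idx k (k + 1 + i))}

theorem idx_notMem_deepPrime {k n : ℕ} (hn : n = 0 ∨ n = k ∨ n = k + 1 ∨ n = 2 * k + 1 ∨
    n = 2 * k + 3 ∨ n = 2 * k + 4) : idx k n ∉ deepPrime k := by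
  rintro (h | ⟨i, hi, hi', h | h⟩)
  · rw [idx_inj (by omega) (by omega)] at h
    omega
  · rw [idx_inj (by omega) (by omega)] at h
    omega
  · rw [idx_inj (by omega) (by omega)] at h
    omega

theorem revPiece_deepPrime (k : ℕ) : revPiece k (deepPrime k) :=
  ⟨idx_notMem_deepPrime (by omega), idx_notMem_deepPrime (by omega),
    Or.inl ⟨idx_notMem_deepPrime (by omega), idx_notMem_deepPrime (by omega),
      Or.inl ⟨idx_notMem_deepPrime (by omega), idx_notMem_deepPrime (by omega)⟩⟩⟩

theorem primeFiltered_revColon {k : ℕ} (hk : 1 ≤ k) :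
    PrimeFiltered (revPiece k) (sqfree (revColon k)) := by
  have hstair := primeFiltered_revStaircase (k := k) (m := 0) (n := k) ∅ (by omega) le_rfl
    (by simp) ?_
  · rw [Set.image_empty, Set.empty_union] at hstair
    refine PrimeFiltered.split_sqfree {idx k k, idx k (2 * k + 1)}
      (PrimeFiltered.of_singletons (revPiece_deepPrime k)) hstair ?_ ?_ ?_ ?_ ?_
    · rintro G (rfl | ⟨i, j, hij, hj, hne, rfl⟩)
      · refine ⟨_, ⟨_, Or.inl rfl, rfl⟩, ?_⟩
        rw [Finset.singleton_subset_iff, Finset.mem_sdiff]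
        refine ⟨by simp, ?_⟩
        rw [Finset.mem_insert, Finset.mem_singleton, idx_inj (by omega) (by omega),
          idx_inj (by omega) (by omega)]
        omega
      · rcases Nat.eq_zero_or_pos i with rfl | hi
        · refine ⟨_, ⟨_, Or.inr ⟨j, hij, by omega, Or.inl rfl⟩, rfl⟩, ?_⟩
          rw [Finset.singleton_subset_iff, Finset.mem_sdiff]
          refine ⟨by simp [revBlockB], ?_⟩
          rw [Finset.mem_insert, Finset.mem_singleton, idx_inj (by omega) (by omega),
            idx_inj (by omega) (by omega)]
          omega
        · refine ⟨_, ⟨_, Or.inr ⟨i, hi, by omega, Or.inr rfl⟩, rfl⟩, ?_⟩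
          rw [Finset.singleton_subset_iff, Finset.mem_sdiff]
          refine ⟨by simp [revBlockA, hi.ne'], ?_⟩
          rw [Finset.mem_insert, Finset.mem_singleton, idx_inj (by omega) (by omega),
            idx_inj (by omega) (by omega)]
          omega
    · rintro _ ⟨x, rfl | ⟨i, hi, hi', rfl | rfl⟩, rfl⟩
      · refine ⟨_, Or.inl rfl, fun y hy => ?_⟩
        simp only [Finset.mem_sdiff, Finset.mem_insert, Finset.mem_singleton] at hy ⊢
        tauto
      · refine ⟨_, Or.inr ⟨0, i, hi, hi'.le, by omega, rfl⟩, fun y hy => ?_⟩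
        simp only [revBlockA, revBlockB, if_true, Finset.mem_sdiff, Finset.mem_union,
          Finset.mem_insert, Finset.mem_singleton] at hy ⊢
        tauto
      · refine ⟨_, Or.inr ⟨i, k, hi', le_rfl, by omega, rfl⟩, fun y hy => ?_⟩
        simp only [revBlockA, revBlockB, if_neg (by omega : ¬ i = 0), Finset.mem_sdiff,
          Finset.mem_union, Finset.mem_insert, Finset.mem_singleton] at hy ⊢
        tauto
    · rintro G (rfl | ⟨i, j, hij, hj, hne, rfl⟩)
      · refine ⟨_, ⟨0, k, le_rfl, hk, le_rfl, rfl⟩, fun y hy => ?_⟩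
        simp only [revBlockA, revBlockB, if_true, Finset.mem_union, Finset.mem_insert,
          Finset.mem_singleton] at hy ⊢
        tauto
      · exact ⟨_, ⟨i, j, Nat.zero_le i, hij, hj, rfl⟩, le_rfl⟩
    · refine ⟨_, ⟨0, k, le_rfl, hk, le_rfl, rfl⟩, fun y hy => ?_⟩
      simp only [revBlockA, revBlockB, if_true, Finset.mem_union, Finset.mem_insert,
        Finset.mem_singleton] at hy ⊢
      tauto
    · rintro H ⟨i, j, -, hij, hj, rfl⟩
      by_cases hne : i = 0 ∧ j = k
      · right
        obtain ⟨rfl, rfl⟩ := hne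
        intro y hy
        simp only [revBlockA, revBlockB, if_true, Finset.mem_union, Finset.mem_insert,
          Finset.mem_singleton] at hy ⊢
        tauto
      · exact Or.inl ⟨_, Or.inr ⟨i, j, hij, hj, hne, rfl⟩, le_rfl⟩
  · intro q _ hq
    have hnot : ∀ m, m < 2 * k + 5 → m = 0 ∨ (m = 1 ∧ 0 < q) ∨ m = k + 1 ∨
        (m = 2 * k + 1 ∧ q = 0) ∨ 2 * k + 2 ≤ m → idx k m ∉
          (∅ : Set (Fin (2 * k + 5))) ∪ {x | (∃ i, 0 ≤ i ∧ i < q ∧ x ∈ revBlockA k i) ∨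
            ∃ j, q < j ∧ j ≤ k ∧ x ∈ revBlockB k j} := by
      rintro m hm hm' (h | ⟨i, hi, hi', h⟩ | ⟨j, hj, hj', h⟩)
      · exact h
      · rw [revBlockA, Finset.mem_singleton, idx_inj hm (by split_ifs <;> omega)] at h
        split_ifs at h <;> omega
      · rw [revBlockB, Finset.mem_singleton, idx_inj hm (by omega)] at h
        omega
    refine ⟨hnot _ (by omega) (by omega), hnot _ (by omega) (by omega),
      Or.inl ⟨hnot _ (by omega) (by omega), hnot _ (by omega) (by omega),
        Or.inr ⟨hnot _ (by omega) (by omega), ?_⟩⟩⟩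
    rcases Nat.eq_zero_or_pos q with rfl | hq0
    · exact Or.inr (hnot _ (by omega) (by omega))
    · exact Or.inl (hnot _ (by omega) (by omega))

theorem isUpperSet_revExps (k : ℕ) : IsUpperSet (revExps k) := by
  intro u v h hu
  have h' := fun n => h (idx k n)
  have hs := Finset.sum_le_sum (s := Finset.Ico 1 k) fun i _ => h' i
  have hne : ∀ n, u (idx k n) ≠ 0 → v (idx k n) ≠ 0 := fun n hn => by
    have := h' n
    omega
  rcases hu with ⟨i, j, hi, hij, hj, h1, h2⟩ | ⟨j, hj, hj', h1, h2, h3⟩ | ⟨i, hi, hi', h1, h2, h3⟩ |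
    ⟨h1, h2, h3⟩ | ⟨h1, h2, h3, h4⟩
  · exact Or.inl ⟨i, j, hi, hij, hj, hne _ h1, hne _ h2⟩
  · exact Or.inr (Or.inl ⟨j, hj, hj', hne _ h1, hne _ h2, hne _ h3⟩)
  · exact Or.inr (Or.inr (Or.inl ⟨i, hi, hi', hne _ h1, hne _ h2, hne _ h3⟩))
  · exact Or.inr (Or.inr (Or.inr (Or.inl ⟨h1.trans (h' _), hne _ h2, hne _ h3⟩)))
  · exact Or.inr (Or.inr (Or.inr (Or.inr ⟨h1.trans hs, hne _ h2, hne _ h3, hne _ h4⟩)))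

theorem primeFiltered_revExps {k : ℕ} (hk : 1 ≤ k) :
    PrimeFiltered (revPiece k) (revExps k) := by
  refine PrimeFiltered.split (isUpperSet_revExps k) (Finsupp.single (idx k (2 * k + 2)) 1) ?_ ?_
  · convert primeFiltered_revColon hk using 1
    ext u
    have hv := fun l (hl : l < 2 * k + 5) (hne : 2 * k + 2 ≠ l) =>
      (add_single_idx_apply (k := k) (m := 2 * k + 2) (by omega) hl u).trans
        (by rw [if_neg hne, add_zero])
    have hvc : (u + Finsupp.single (idx k (2 * k + 2)) 1 : Fin (2 * k + 5) →₀ ℕ)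
        (idx k (2 * k + 2)) =
        u (idx k (2 * k + 2)) + 1 := by
      rw [add_single_idx_apply (by omega) (by omega), if_pos rfl]
    have hstair : ∀ i j, i < j → j ≤ k → ¬ (i = 0 ∧ j = k) →
        u (idx k (if i = 0 then 2 * k + 1 else k + 1 + i)) ≠ 0 → u (idx k j) ≠ 0 →
        u ∈ sqfree (revColon k) := by
      intro i j hij hj hne h1 h2
      refine ⟨_, Or.inr ⟨i, j, hij, hj, hne, rfl⟩, fun x hx => ?_⟩
      rw [revBlockA, revBlockB, Finset.mem_union, Finset.mem_singleton,
        Finset.mem_singleton] at hx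
      rcases hx with rfl | rfl
      exacts [h1, h2]
    constructor
    · rintro (⟨i, j, hi, hij, hj, h1, h2⟩ | ⟨j, hj, hj', h1, h2, h3⟩ | ⟨i, hi, hi', h1, h2, h3⟩ |
        ⟨h1, h2, h3⟩ | ⟨h1, h2, h3, h4⟩)
      · rw [hv _ (by omega) (by omega)] at h1 h2
        exact hstair i j hij hj.le (by omega) (by rwa [if_neg (by omega)]) h2
      · rw [hv _ (by omega) (by omega)] at h2 h3
        exact hstair 0 j hj hj'.le (by omega) (by rwa [if_pos rfl]) h3
      · rw [hv _ (by omega) (by omega)] at h2 h3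
        exact hstair i k hi' le_rfl (by omega) (by rwa [if_neg (by omega)]) h2
      · rw [hv _ (by omega) (by omega)] at h2 h3
        rw [hvc] at h1
        refine ⟨_, Or.inl rfl, fun x hx => ?_⟩
        simp only [Finset.mem_insert, Finset.mem_singleton] at hx
        rcases hx with rfl | rfl | rfl
        · exact h2
        · exact h3
        · omega
      · rw [hv _ (by omega) (by omega)] at h3
        rw [sum_add_single (by omega), if_neg (by rw [Finset.mem_Ico]; omega), add_zero] at h1
        obtain ⟨j, hj, huj⟩ := Finset.exists_ne_zero_of_sum_ne_zero
          (by omega : ∑ i ∈ Finset.Ico 1 k, u (idx k i) ≠ 0)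
        rw [Finset.mem_Ico] at hj
        exact hstair 0 j hj.1 hj.2.le (by omega) (by rwa [if_pos rfl]) huj
    · rintro ⟨_, rfl | ⟨i, j, hij, hj, hne, rfl⟩, hF⟩
      · have h1 := hF (idx k k) (by simp)
        have h2 := hF (idx k (2 * k + 1)) (by simp)
        have h3 := hF (idx k (2 * k + 2)) (by simp)
        refine Or.inr (Or.inr (Or.inr (Or.inl ⟨?_, ?_, ?_⟩)))
        · rw [hvc]
          omega
        · rwa [hv _ (by omega) (by omega)]
        · rwa [hv _ (by omega) (by omega)]
      · have h1 := hF (idx k (if i = 0 then 2 * k + 1 else k + 1 + i)) (by simp [revBlockA])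
        have h2 := hF (idx k j) (by simp [revBlockB])
        rcases Nat.eq_zero_or_pos i with rfl | hi
        · rw [if_pos rfl] at h1
          refine Or.inr (Or.inl ⟨j, hij, by omega, ?_, ?_, ?_⟩)
          · rw [hvc]
            omega
          · rwa [hv _ (by omega) (by omega)]
          · rwa [hv _ (by omega) (by omega)]
        · rw [if_neg (by omega)] at h1
          rcases hj.eq_or_lt with rfl | hj'
          · refine Or.inr (Or.inr (Or.inl ⟨i, hi, hij, ?_, ?_, ?_⟩))
            · rw [hvc]
              omega
            · rwa [hv _ (by omega) (by omega)]
            · rwa [hv _ (by omega) (by omega)]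
          · refine Or.inl ⟨i, j, hi, hij, hj', ?_, ?_⟩
            · rwa [hv _ (by omega) (by omega)]
            · rwa [hv _ (by omega) (by omega)]
  · convert primeFiltered_revExps_sup hk using 1
    ext u
    simp only [Set.mem_union, Set.mem_ofPred_eq, Finsupp.single_le_iff, Nat.one_le_iff_ne_zero,
      revExps, stairExps, squareExps, Finset.forall_mem_insert, Finset.mem_singleton, forall_eq]
    constructor
    · rintro ((h | ⟨j, -, -, h, -⟩ | ⟨i, -, -, h, -⟩ | ⟨h, -⟩ | h) | h)
      · exact Or.inl (Or.inl h)
      · exact Or.inl (Or.inr h)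
      · exact Or.inl (Or.inr h)
      · exact Or.inl (Or.inr (by omega))
      · exact Or.inr h
      · exact Or.inl (Or.inr h)
    · rintro ((h | h) | h)
      · exact Or.inl (Or.inl h)
      · exact Or.inr h
      · exact Or.inl (Or.inr (Or.inr (Or.inr (Or.inr h))))

/-- The prime generated by `c` and the `a_i`, `b_i` with `0 < i < k` is the annihilator of the
residue class of `a_k b_k c`. -/
theorem mul_monomial_mem_monIdeal_revExps {K : Type*} [Field K] {k : ℕ} (hk : 1 ≤ k)
    (g : MvPolynomial (Fin (2 * k + 5)) K) :
    g * monomial (listExp k [k, 2 * k + 1, 2 * k + 2]) 1 ∈ monIdeal K (revExps k) ↔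
      g ∈ Ideal.span (X '' deepPrime k : Set (MvPolynomial (Fin (2 * k + 5)) K)) := by
  rw [mul_comm g, monomial_mul_mem_monIdeal (isUpperSet_revExps k), ← monIdeal_exists_ne_zero]
  suffices h : {u | u + listExp k [k, 2 * k + 1, 2 * k + 2] ∈ revExps k} =
      {u | ∃ s ∈ deepPrime k, u s ≠ 0} by rw [h]
  ext u
  have hv : ∀ n, n < 2 * k + 5 → (u + listExp k [k, 2 * k + 1, 2 * k + 2]) (idx k n) =
      u (idx k n) + if n = k ∨ n = 2 * k + 1 ∨ n = 2 * k + 2 then 1 else 0 := by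
    intro n hn
    rw [Finsupp.add_apply, listExp_apply (by simp; omega) hn]
    congr 1
    simp only [List.count_cons, List.count_nil, beq_iff_eq]
    split_ifs <;> omega
  have hs : ∑ i ∈ Finset.Ico 1 k, (u + listExp k [k, 2 * k + 1, 2 * k + 2]) (idx k i) =
      ∑ i ∈ Finset.Ico 1 k, u (idx k i) := by
    refine Finset.sum_congr rfl fun i hi => ?_
    rw [Finset.mem_Ico] at hi
    rw [hv i (by omega), if_neg (by omega), add_zero]
  constructor
  · rintro (⟨i, j, hi, hij, hj, h1, h2⟩ | ⟨j, hj, hj', h1, h2, h3⟩ | ⟨i, hi, hi', h1, h2, h3⟩ |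
      ⟨h1, h2, h3⟩ | ⟨h1, h2, h3, h4⟩)
    · rw [hv _ (by omega), if_neg (by omega)] at h2
      exact ⟨_, Or.inr ⟨j, by omega, hj, Or.inl rfl⟩, h2⟩
    · rw [hv _ (by omega), if_neg (by omega)] at h3
      exact ⟨_, Or.inr ⟨j, hj, hj', Or.inl rfl⟩, h3⟩
    · rw [hv _ (by omega), if_neg (by omega)] at h3
      exact ⟨_, Or.inr ⟨i, hi, hi', Or.inr rfl⟩, h3⟩
    · rw [hv _ (by omega), if_pos (by omega)] at h1
      exact ⟨_, Or.inl rfl, by omega⟩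
    · rw [hs] at h1
      obtain ⟨j, hj, huj⟩ := Finset.exists_ne_zero_of_sum_ne_zero
        (by omega : ∑ i ∈ Finset.Ico 1 k, u (idx k i) ≠ 0)
      rw [Finset.mem_Ico] at hj
      exact ⟨_, Or.inr ⟨j, hj.1, hj.2, Or.inl rfl⟩, huj⟩
  · have h1 : (u + listExp k [k, 2 * k + 1, 2 * k + 2]) (idx k k) ≠ 0 := by
      rw [hv _ (by omega), if_pos (by omega)]
      omega
    have h2 : (u + listExp k [k, 2 * k + 1, 2 * k + 2]) (idx k (2 * k + 1)) ≠ 0 := by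
      rw [hv _ (by omega), if_pos (by omega)]
      omega
    have h3 : (u + listExp k [k, 2 * k + 1, 2 * k + 2]) (idx k (2 * k + 2)) ≠ 0 := by
      rw [hv _ (by omega), if_pos (by omega)]
      omega
    rintro ⟨_, rfl | ⟨i, hi, hi', rfl | rfl⟩, h⟩
    · refine Or.inr (Or.inr (Or.inr (Or.inl ⟨?_, h1, h2⟩)))
      rw [hv _ (by omega), if_pos (by omega)]
      omega
    · refine Or.inr (Or.inl ⟨i, hi, hi', h3, h2, ?_⟩)
      rw [hv _ (by omega)]
      omega
    · refine Or.inr (Or.inr (Or.inl ⟨i, hi, hi', h3, h1, ?_⟩))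
      rw [hv _ (by omega)]
      omega

theorem card_compl_deepPrime_le (k : ℕ) :
    Nat.card ((deepPrime k)ᶜ : Set (Fin (2 * k + 5))) ≤ 6 := by
  have hsub : (deepPrime k)ᶜ ⊆ (({idx k 0, idx k k, idx k (k + 1), idx k (2 * k + 1),
      idx k (2 * k + 3), idx k (2 * k + 4)} : Finset (Fin (2 * k + 5))) : Set _) := by
    intro x hx
    rw [← idx_coe x] at hx ⊢
    have hx2 := x.2
    generalize (x : ℕ) = n at hx hx2
    simp only [Finset.coe_insert, Finset.coe_singleton, Set.mem_insert_iff,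
      Set.mem_singleton_iff]
    by_contra hne
    simp only [not_or] at hne
    obtain ⟨n1, n2, n3, n4, n5, n6⟩ := hne
    have m1 : n ≠ 0 := by rintro rfl; exact n1 rfl
    have m2 : n ≠ k := by rintro rfl; exact n2 rfl
    have m3 : n ≠ k + 1 := by rintro rfl; exact n3 rfl
    have m4 : n ≠ 2 * k + 1 := by rintro rfl; exact n4 rfl
    have m5 : n ≠ 2 * k + 3 := by rintro rfl; exact n5 rfl
    have m6 : n ≠ 2 * k + 4 := by rintro rfl; exact n6 rfl
    refine hx ?_
    rcases eq_or_ne n (2 * k + 2) with rfl | m7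
    · exact Or.inl rfl
    rcases Nat.lt_or_ge n k with hnk | hnk
    · exact Or.inr ⟨n, by omega, hnk, Or.inl rfl⟩
    · refine Or.inr ⟨n - (k + 1), by omega, by omega, Or.inr ?_⟩
      congr 1
      omega
  rw [Nat.card_coe_set_eq]
  refine (Set.ncard_le_ncard hsub (Finset.finite_toSet _)).trans ?_
  rw [Set.ncard_coe_finset]
  exact Finset.card_le_six

theorem depthQuot_revExps (K : Type*) [Field K] {k : ℕ} (hk : 1 ≤ k) :
    depthQuot (monIdeal K (revExps k)) = 6 := by
  refine le_antisymm ?_ ?_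
  · have h1 := depthQuot_le (isPrime_span_X_image (K := K) (deepPrime k))
      (Ideal.span_mono (Set.image_subset_range _ _))
      (mul_monomial_mem_monIdeal_revExps (K := K) hk)
    have h2 := h1.trans ((ringKrullDim_quotient_span_X_image_le (K := K) (deepPrime k)).trans
      (Nat.cast_le.2 (card_compl_deepPrime_le k)))
    exact WithBot.coe_le_coe.1 (h2.trans (le_of_eq rfl))
  · have h0 : (0 : Fin (2 * k + 5) →₀ ℕ) ∉ revExps k := by
      rintro (⟨i, j, -, -, -, h, -⟩ | ⟨j, -, -, h, -⟩ | ⟨i, -, -, h, -⟩ | ⟨-, h, -⟩ | ⟨-, h, -⟩) <;>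
        exact h rfl
    have := le_depthQuot (monIdeal_le_idealOfVars h0) ?_
      ((primeFiltered_revExps hk).weaklyRegularMod
        (fun i => sumForm K fun x : Fin (2 * k + 5) => revForm k i x) (List.range 6)
        List.nodup_range fun S hS c => revForm_independent hk hS c)
    · simpa using this
    · intro r hr
      obtain ⟨i, -, rfl⟩ := List.mem_map.1 hr
      exact linForm_mem_idealOfVars _

end Rev

end EdgeRing

theorem lemma0p2 (K : Type*) [Field K] (k : ℕ) (hk : 1 ≤ k) :
    EdgeRing.depthQuot
        (EdgeRing.initialIdeal EdgeRing.revLex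
          (EdgeRing.toricIdeal K (EdgeRing.graph k) (EdgeRing.edgeEquiv hk))) = 6 ∧
      EdgeRing.IsCohenMacaulayQuot
        (EdgeRing.initialIdeal MonomialOrder.lex
          (EdgeRing.toricIdeal K (EdgeRing.graph k) (EdgeRing.edgeEquiv hk))) := by
  rw [EdgeRing.initialIdeal_revLex K hk, EdgeRing.initialIdeal_lex K hk]
  exact ⟨EdgeRing.depthQuot_revExps K hk, EdgeRing.isCohenMacaulayQuot_lexExps K hk⟩
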